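/- **Setting.** Let $W$ be an $(n+k)$-dimensional smooth manifold with a Riemannian metric $g$, and $\zeta\subset TW$ a smooth $n$-dimensional distribution. A *$\zeta$-FLIF* $\Phi=(\Phi^0,\Phi^1,\Phi^2,\lambda^+)$ (on an open subset of $W$, with respect to a smooth Euclidean metric on $\zeta$) consists of a function $\Phi^0$; a smooth section $\Phi^1$ of $\zeta$, transverse to zero, with zero set $V$; a smooth field $\Phi^2$ of self-adjoint operators on $\mathrm{Vert}=\zeta|_V$, which has corank $1$ over a subset $\Sigma\subset V$, is nondegenerate over $V\setminus\Sigma$, and is such that $\det\Phi^2$ has $\Sigma$ as its regular zero level in $V$; and a smooth unit section $\lambda^+$ of the line bundle $\lambda=\ker\Phi^2$ over $\Sigma$. Let $\mathrm{Norm}=(TV)^\perp\subset TW|_V$, let $\widehat\Gamma_\Phi:TW|_V\to\mathrm{Vert}$ be the differential of the section $\Phi^1$ along its zero set, and let $\Gamma_\Phi=\widehat\Gamma_\Phi|_{\mathrm{Norm}}:\mathrm{Norm}\to\mathrm{Vert}$ (an isomorphism). The *index coorientation* of $\Sigma$ in $V$ points in the direction of decreasing index (dimension of the negative eigenspace) of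 $\Phi^2$. $\Phi$ is *prepared* if $V$ is folded with respect to $\zeta$ with fold $\Sigma$ (i.e. $\Sigma$ is the locus where $V$ is not transverse to $\zeta$, and all tangencies are of fold type), $TV\cap\zeta|_\Sigma=\lambda$, $\lambda^+$ defines the index coorientation, and $n^+=\Gamma_\Phi^{-1}(\lambda^+)$ defines the characteristic coorientation of the fold (the coorientation of $T\Sigma\oplus\zeta|_\Sigma$ pointing out of the side which contains $V$ of the hypersurface swept by the leaves through $\Sigma$). For a prepared $\Phi$ let $K:\mathrm{Vert}\to\mathrm{Norm}$ be the orthogonal projection, and let $\Pi_\Phi:\mathrm{Norm}\to\mathrm{Vert}$ be the isomorphism which continuously extends $\Phi^2\circ K^{-1}$ from $V\setminus\Sigma$ to $V$. $\Phi$ is *well balanced* if it is prepared and $\Pi_\Phi$, $\Gamma_\Phi$ are homotopic as bundle isomorphisms. Given a $\zeta$-FLIF $\Phi$, choose a closed tubular neighborhood $U=\Sigma\times[-\epsilon,\epsilon]$ of $\Sigma$ in $V$, with $\widetilde\tau^+=\partial/\partial t$ defining the index coorientation, over which $\lambda^+$ extends to a smooth unit eigenvector field $\widetilde\lambda^+$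 of $\Phi^2$, $\Phi^2\widetilde\lambda^+=c\,\widetilde\lambda^+$; a smooth function $\theta:U\to[-\frac\pi2,\frac\pi2]$ with $\Sigma$ as its regular zero level and equal to $\pm\frac\pi2$ near $\Sigma\times(\pm\epsilon)$; and a smooth positive function $\widetilde c$ on $U$ equal to $\pm c$ on $\Sigma\times(\pm\epsilon)$. Put $\widetilde n^+=\Gamma_\Phi^{-1}(\widetilde\lambda^+)$ and $\mu^+=\sin\theta\,\widetilde n^++\cos\theta\,\widetilde\tau^+$. The *twisted normal bundle* ${}^\Phi\mathrm{Vert}\subset TW|_V$ is $\mathrm{Norm}$ over $V\setminus U$ and $\mathrm{Span}(\Gamma_\Phi^{-1}((\widetilde\lambda^+)^\perp),\mu^+)$ over $U$, and $\Delta_\Phi:\mathrm{Vert}\to{}^\Phi\mathrm{Vert}$ equals $\Gamma_\Phi^{-1}\circ\Phi^2$ over $V\setminus U$ and on $(\widetilde\lambda^+)^\perp$ over $U$, and sends $\widetilde\lambda^+$ to $\widetilde c\,\mu^+$ over $U$. **Statement.** Let $\Phi$ be any $\zeta$-FLIF. For any choices as above, and any extension of $\Delta_\Phi$ to a smooth injective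 bundle homomorphism $F:\zeta|_N\to TW|_N$ over an open neighborhood $N$ of $V$ (contained in the domain of $\Phi$), put $\nu=F(\zeta|_N)$. Then $\nu|_V={}^\Phi\mathrm{Vert}$, and the push-forward $$\widehat\Phi=\Phi^{\mathrm{Norm}}=(\mathrm{Id},F)_*\Phi=(\Phi^0,\;F\Phi^1,\;F\Phi^2F^{-1},\;F\lambda^+)$$ is a $\nu$-FLIF on $N$ (for the transported metric on $\nu$) and is well balanced. Moreover, if the choices are such that $\widetilde c\,\sin\theta=c$ on $U$, then $\Pi_{\widehat\Phi}=\Gamma_{\widehat\Phi}$. -/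

import Mathlib

open scoped Manifold ContDiff Topology

noncomputable section

namespace Igusa

variable {m : ℕ} {W : Type*} [TopologicalSpace W] [ChartedSpace (EuclideanSpace ℝ (Fin m)) W]
  [IsManifold (𝓡 m) ∞ W]

/-! ### Tangent vectors, vector fields, submanifolds and distributions -/

/-- The velocity of a curve, as a point of the tangent bundle. -/
def velocity (c : ℝ → W) (t : ℝ) : TangentBundle (𝓡 m) W :=
  ⟨c t, mfderiv 𝓘(ℝ, ℝ) (𝓡 m) c t (1 : ℝ)⟩

/-- `c` is a germ at `0` of a smooth curve which lies in `S`, starts at `p` and has the initial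
velocity `w`. -/
structure IsCurveIn (S : Set W) (c : ℝ → W) (p : W) (w : TangentSpace (𝓡 m) p) : Prop where
  smooth : ContMDiffAt 𝓘(ℝ, ℝ) (𝓡 m) ∞ c 0
  mem : ∀ᶠ t in 𝓝 (0 : ℝ), c t ∈ S
  velocity_eq : velocity c 0 = (⟨p, w⟩ : TangentBundle (𝓡 m) W)

/-- The tangent space `T_p S` of a submanifold `S ⊆ W`: the span (for a submanifold: the set) of the
initial velocities of the smooth curves in `S` through `p`. -/
def tangentTo (S : Set W) (p : W) : Submodule ℝ (TangentSpace (𝓡 m) p) :=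
  Submodule.span ℝ {w | ∃ c : ℝ → W, IsCurveIn S c p w}

/-- The field `Z` of tangent vectors of `W` is smooth along `S`. -/
def SmoothFieldOn (S : Set W) (Z : ∀ x : W, TangentSpace (𝓡 m) x) : Prop :=
  ContMDiffOn (𝓡 m) (𝓡 m).tangent ∞ (fun x => (⟨x, Z x⟩ : TangentBundle (𝓡 m) W)) S

/-- The field `Z` of tangent vectors of `W` is continuous along `S`. -/
def ContinuousFieldOn (S : Set W) (Z : ∀ x : W, TangentSpace (𝓡 m) x) : Prop :=
  ContinuousOn (fun x => (⟨x, Z x⟩ : TangentBundle (𝓡 m) W)) S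

/-- `ζ` is a smooth `n`-dimensional distribution (a subbundle of `TW` of rank `n`) over `N`. -/
def IsDistributionOn (n : ℕ) (N : Set W) (ζ : ∀ x : W, Submodule ℝ (TangentSpace (𝓡 m) x)) : Prop :=
  ∀ p ∈ N, ∃ O : Set W, IsOpen O ∧ p ∈ O ∧ ∃ e : Fin n → ∀ x : W, TangentSpace (𝓡 m) x,
    (∀ i, SmoothFieldOn O (e i)) ∧
    ∀ x ∈ O, LinearIndependent ℝ (fun i => e i x) ∧ Submodule.span ℝ (Set.range fun i => e i x) = ζ x

/-- The differential at `x` of a vector field `X` which vanishes at `x`. It is computed in a local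
trivialization of `TW`, on which it does not depend because `X x = 0`. If `X` is a section of a
distribution `ζ`, its values lie in `ζ x`, and it is the vertical part of the differential of the
section `X : W → ζ` with respect to the canonical splitting of the tangent space of the total space
along the zero section. -/
def linearization (X : ∀ x : W, TangentSpace (𝓡 m) x) (x : W) :
    TangentSpace (𝓡 m) x →L[ℝ] TangentSpace (𝓡 m) x :=
  ((trivializationAt (EuclideanSpace ℝ (Fin m)) (TangentSpace (𝓡 m)) x).symmL ℝ x).comp
    (mfderiv (𝓡 m) 𝓘(ℝ, EuclideanSpace ℝ (Fin m))
      (fun y => (trivializationAt (EuclideanSpace ℝ (Fin m)) (TangentSpace (𝓡 m)) x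
        (⟨y, X y⟩ : TangentBundle (𝓡 m) W)).2) x)

/-- Riemannian metrics on `W`. -/
abbrev Metric (m : ℕ) (W : Type*) [TopologicalSpace W]
    [ChartedSpace (EuclideanSpace ℝ (Fin m)) W] [IsManifold (𝓡 m) ∞ W] :=
  Bundle.ContMDiffRiemannianMetric (𝓡 m) ∞ (EuclideanSpace ℝ (Fin m))
    (fun x : W => TangentSpace (𝓡 m) x)

/-- The normal space `Norm_p = (T_p S)^⊥ ⊆ T_p W` of a submanifold `S ⊆ W`. -/
def normalTo (g : Metric m W) (S : Set W) (p : W) : Submodule ℝ (TangentSpace (𝓡 m) p) where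
  carrier := {w | ∀ u ∈ tangentTo S p, g.inner p u w = 0}
  add_mem' := fun ha hb u hu => by rw [map_add, ha u hu, hb u hu, add_zero]
  zero_mem' := fun u _ => map_zero _
  smul_mem' := fun r a ha u hu => by rw [map_smul, ha u hu, smul_zero]

/-- A path `A s`, `0 ≤ s ≤ 1`, of fibrewise linear maps between two subbundles of `TW|_S` is a
continuous path of bundle homomorphisms. -/
def IsContinuousPathOn (S : Set W) {B ζ : ∀ x : W, Submodule ℝ (TangentSpace (𝓡 m) x)}
    (A : ℝ → ∀ x : W, B x →ₗ[ℝ] ζ x) : Prop :=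
  ∀ (Z : ∀ x : W, B x) (O : Set W), IsOpen O → ContinuousFieldOn (S ∩ O) (fun x => (Z x : TangentSpace (𝓡 m) x)) →
    ContinuousOn
      (fun q : ℝ × W => (⟨q.2, (A q.1 q.2 (Z q.2) : TangentSpace (𝓡 m) q.2)⟩ : TangentBundle (𝓡 m) W))
      (Set.Icc 0 1 ×ˢ (S ∩ O))

/-- A family of fibrewise linear maps between two subbundles of `TW|_S` is a continuous bundle
homomorphism. -/
def IsContinuousHomOn (S : Set W) {B ζ : ∀ x : W, Submodule ℝ (TangentSpace (𝓡 m) x)}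
    (A : ∀ x : W, B x →ₗ[ℝ] ζ x) : Prop :=
  ∀ (Z : ∀ x : W, B x) (O : Set W), IsOpen O → ContinuousFieldOn (S ∩ O) (fun x => (Z x : TangentSpace (𝓡 m) x)) →
    ContinuousFieldOn (S ∩ O) (fun x => (A x (Z x) : TangentSpace (𝓡 m) x))

/-! ### Fold type tangency of a submanifold to a distribution -/

/-- An auxiliary pair at a point `p` of the tangency locus of a submanifold `V` and a distribution
`ζ`: a smooth `1`-form `α` near `p` which annihilates `ζ` and, at `p`, is a nonzero form which
annihilates `T_p V` as well; and a smooth field `Y` along `V` near `p` which is tangent to `V` and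
at `p` is a nonzero vector of `ζ`. The function `α(Y)` on `V` is a matrix entry of the homomorphism
`π : TV → TW/ζ`, namely the one from its kernel to its cokernel at `p`. -/
structure IsTangencyPair (V : Set W) (ζ : ∀ x : W, Submodule ℝ (TangentSpace (𝓡 m) x)) (p : W)
    (α : ∀ x : W, TangentSpace (𝓡 m) x →L[ℝ] ℝ) (Y : ∀ x : W, TangentSpace (𝓡 m) x) : Prop where
  exists_nhd : ∃ O : Set W, IsOpen O ∧ p ∈ O ∧
    ContMDiffOn (𝓡 m).tangent 𝓘(ℝ, ℝ) ∞ (fun q : TangentBundle (𝓡 m) W => α q.1 q.2)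
      {q | q.1 ∈ O} ∧
    (∀ x ∈ O, ∀ w ∈ ζ x, α x w = 0) ∧
    SmoothFieldOn (V ∩ O) Y ∧ ∀ x ∈ V ∩ O, Y x ∈ tangentTo V x
  form_ne_zero : α p ≠ 0
  form_tangent : ∀ w ∈ tangentTo V p, α p w = 0
  field_ne_zero : Y p ≠ 0
  field_mem : Y p ∈ ζ p

/-- `V` has at `p` a tangency of fold type to `ζ`, where `S` is the locus of tangency points:
the projection `π : T_p V → T_p W / ζ` has corank one (`V` and `ζ` have complementary dimensions);
the `1`-jet of the inclusion of `V` is transverse at `p` to the variety of jets that are not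
transverse to `ζ`; and `π` is injective on `T_p S`. The tangent space of the corank one stratum at
a homomorphism `A` consists of the `B` which map `ker A` into `im A`, so that the transversality
condition says that the derivative along `V` of the component `ker → coker` of `π` is nonzero. -/
structure IsFoldTangency (V : Set W) (ζ : ∀ x : W, Submodule ℝ (TangentSpace (𝓡 m) x)) (S : Set W)
    (p : W) : Prop where
  corank : Module.finrank ℝ ↥(tangentTo V p ⊓ ζ p) = 1
  transverse : ∃ α Y, IsTangencyPair V ζ p α Y ∧ ∃ (w : TangentSpace (𝓡 m) p) (c : ℝ → W),
    IsCurveIn V c p w ∧ deriv (fun t => α (c t) (Y (c t))) 0 ≠ 0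
  injective : tangentTo S p ⊓ ζ p = ⊥

/-- `V` is folded with respect to `ζ`, with the fold along `S`. -/
def IsFolded (V : Set W) (ζ : ∀ x : W, Submodule ℝ (TangentSpace (𝓡 m) x)) (S : Set W) : Prop :=
  S ⊆ V ∧ (∀ p ∈ V, p ∈ S ↔ tangentTo V p ⊓ ζ p ≠ ⊥) ∧ ∀ p ∈ S, IsFoldTangency V ζ S p

/-- The vector `w` at a point `p` of the fold defines the characteristic coorientation of the
hyperplane `T S ⊕ ζ` (which contains `T_p V`): it points out of the side of the hypersurface swept
by the leaves through the fold which contains `V`. If `α = dh` with `h` constant on the leaves and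
zero on the leaves through the fold, this says that `dh(w) > 0` and that the second derivative of `h|_V` at `p`
in the direction of the kernel line is negative. For a general `ζ` the sign below is the
same for all tangency pairs with `α(w) > 0`, and depends on `ζ|_V` only. -/
def IsCharacteristicCoorientation (V : Set W) (ζ : ∀ x : W, Submodule ℝ (TangentSpace (𝓡 m) x))
    (p : W) (w : TangentSpace (𝓡 m) p) : Prop :=
  ∃ α Y, IsTangencyPair V ζ p α Y ∧ 0 < α p w ∧
    ∃ c : ℝ → W, IsCurveIn V c p (Y p) ∧ deriv (fun t => α (c t) (Y (c t))) 0 < 0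

/-! ### Formal leafwise Igusa functions -/

/-- The data of a `ζ`-FLIF on an open set `dom` of `W`: a Euclidean metric on `ζ`, a function `Φ0`,
a section `Φ1` of `ζ`, an operator `Φ2` on `ζ` and a section `lam` (the vector field `λ⁺`). Only
the values of `Φ2` over `V = {Φ1 = 0}` and those of `lam` over `Σ = {v ∈ V | ker Φ2 ≠ 0}` matter. -/
structure FLIFData (ζ : ∀ x : W, Submodule ℝ (TangentSpace (𝓡 m) x)) where
  dom : Set W
  metric : ∀ x : W, ζ x →ₗ[ℝ] ζ x →ₗ[ℝ] ℝ
  Φ0 : W → ℝ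
  Φ1 : ∀ x : W, ζ x
  Φ2 : ∀ x : W, ζ x →ₗ[ℝ] ζ x
  lam : ∀ x : W, ζ x

namespace FLIFData

variable {ζ : ∀ x : W, Submodule ℝ (TangentSpace (𝓡 m) x)} (Φ : FLIFData ζ)

/-- The zero set `V(Φ)`. -/
def V : Set W := {x | x ∈ Φ.dom ∧ Φ.Φ1 x = 0}

/-- The degeneration locus `Σ(Φ)`. -/
def Sig : Set W := {x | x ∈ Φ.V ∧ LinearMap.ker (Φ.Φ2 x) ≠ ⊥}

/-- The index of `Φ2`: the dimension of its negative eigenspace. -/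
def index (x : W) : ℕ :=
  Module.finrank ℝ ↥(⨆ μ : {μ : ℝ // μ < 0}, Module.End.eigenspace (Φ.Φ2 x) μ.1)

/-- The homomorphism `Γ̂ : TW|_V → ζ|_V ⊆ TW|_V` given by the differential of the section `Φ1`. -/
def gammaHat (x : W) : TangentSpace (𝓡 m) x →L[ℝ] TangentSpace (𝓡 m) x :=
  linearization (fun y => (Φ.Φ1 y : TangentSpace (𝓡 m) y)) x

/-- `Φ` is a (generic) formal leafwise Igusa function for the `n`-dimensional distribution `ζ`. -/
structure IsFLIF (n : ℕ) : Prop where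
  isOpen_dom : IsOpen Φ.dom
  distribution : IsDistributionOn n Φ.dom ζ
  /-- `metric` is a smooth Euclidean metric on `ζ`. -/
  metric_symm : ∀ x ∈ Φ.dom, ∀ u v, Φ.metric x u v = Φ.metric x v u
  metric_pos : ∀ x ∈ Φ.dom, ∀ u, u ≠ 0 → 0 < Φ.metric x u u
  metric_smooth : ∀ (Z Z' : ∀ x : W, ζ x) (O : Set W), IsOpen O →
    SmoothFieldOn O (fun x => (Z x : TangentSpace (𝓡 m) x)) →
    SmoothFieldOn O (fun x => (Z' x : TangentSpace (𝓡 m) x)) →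
    ContMDiffOn (𝓡 m) 𝓘(ℝ, ℝ) ∞ (fun x => Φ.metric x (Z x) (Z' x)) (Φ.dom ∩ O)
  /-- `Φ1` is a smooth section of `ζ`, transverse to the zero section. -/
  Φ1_smooth : SmoothFieldOn Φ.dom (fun x => (Φ.Φ1 x : TangentSpace (𝓡 m) x))
  Φ1_transverse : ∀ v ∈ Φ.V, ∀ z ∈ ζ v, ∃ w, Φ.gammaHat v w = z
  /-- `Φ2` is a smooth field of self-adjoint operators on `ζ|_V`, of corank one over `Σ` and
  nondegenerate elsewhere. -/
  Φ2_smooth : ∀ (Z : ∀ x : W, ζ x) (O : Set W), IsOpen O →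
    SmoothFieldOn O (fun x => (Z x : TangentSpace (𝓡 m) x)) →
    SmoothFieldOn (Φ.V ∩ O) (fun x => (Φ.Φ2 x (Z x) : TangentSpace (𝓡 m) x))
  Φ2_selfAdjoint : ∀ v ∈ Φ.V, ∀ u u', Φ.metric v (Φ.Φ2 v u) u' = Φ.metric v u (Φ.Φ2 v u')
  Φ2_corank : ∀ s ∈ Φ.Sig, Module.finrank ℝ ↥(LinearMap.ker (Φ.Φ2 s)) = 1
  /-- `Φ2` is transverse to the hypersurface of degenerate operators: the function `det Φ2` on `V`
  has `Σ` as its regular zero level. -/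
  Φ2_transverse : ∀ s ∈ Φ.Sig, ∃ (w : TangentSpace (𝓡 m) s) (c : ℝ → W),
    IsCurveIn Φ.V c s w ∧ deriv (fun t => LinearMap.det (Φ.Φ2 (c t))) 0 ≠ 0
  /-- `lam` is a smooth unit section of the line bundle `ker Φ2` over `Σ`. -/
  lam_smooth : SmoothFieldOn Φ.Sig (fun x => (Φ.lam x : TangentSpace (𝓡 m) x))
  lam_ker : ∀ s ∈ Φ.Sig, Φ.Φ2 s (Φ.lam s) = 0
  lam_unit : ∀ s ∈ Φ.Sig, Φ.metric s (Φ.lam s) (Φ.lam s) = 1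

/-- The vector `w` at the point `s` of `Σ` defines the index coorientation of `Σ` in `V`: it is
tangent to `V`, not to `Σ`, and points in the direction of decreasing index. -/
def IsIndexCoorientation (s : W) (w : TangentSpace (𝓡 m) s) : Prop :=
  w ∈ tangentTo Φ.V s ∧ w ∉ tangentTo Φ.Sig s ∧
  ∀ c : ℝ → W, IsCurveIn Φ.V c s w →
    (∀ᶠ t in 𝓝[>] (0 : ℝ), c t ∉ Φ.Sig ∧ Φ.index (c t) = Φ.index s) ∧
    (∀ᶠ t in 𝓝[<] (0 : ℝ), c t ∉ Φ.Sig ∧ Φ.index (c t) = Φ.index s + 1)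

/-- The normal bundle of `V(Φ)`. -/
abbrev Norm (g : Metric m W) (x : W) : Submodule ℝ (TangentSpace (𝓡 m) x) := normalTo g Φ.V x

/-- `Φ` is prepared. The vector `w` in the last clause is `n⁺ = Γ⁻¹(λ⁺)`. -/
structure IsPrepared (g : Metric m W) : Prop where
  folded : IsFolded Φ.V ζ Φ.Sig
  tangent_line : ∀ s ∈ Φ.Sig,
    tangentTo Φ.V s ⊓ ζ s = Submodule.span ℝ {(Φ.lam s : TangentSpace (𝓡 m) s)}
  index_coorientation : ∀ s ∈ Φ.Sig, Φ.IsIndexCoorientation s (Φ.lam s)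
  characteristic_coorientation : ∀ s ∈ Φ.Sig, ∃ w ∈ Φ.Norm g s,
    Φ.gammaHat s w = Φ.lam s ∧ IsCharacteristicCoorientation Φ.V ζ s w

/-- `P` is the isomorphism `Π : Norm → Vert`: a continuous nondegenerate homomorphism equal to
`Φ2 ∘ K⁻¹` over `V \ Σ`, where `K : Vert → Norm` is the restriction of the orthogonal projection
`TW|_V → Norm`, so that `w = K z` means `w ∈ Norm` and `z - w ∈ TV`. -/
structure IsPi (g : Metric m W) (P : ∀ x : W, Φ.Norm g x →ₗ[ℝ] ζ x) : Prop where
  continuous : IsContinuousHomOn Φ.V P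
  nondegenerate : ∀ v ∈ Φ.V, Function.Bijective (P v)
  eq_comp : ∀ v ∈ Φ.V, v ∉ Φ.Sig → ∀ (z : ζ v) (w : Φ.Norm g v),
    (z : TangentSpace (𝓡 m) v) - w ∈ tangentTo Φ.V v → P v w = Φ.Φ2 v z

/-- `Φ` is well balanced: it is prepared, and `Π` and `Γ = Γ̂|_Norm` are homotopic through bundle
isomorphisms `Norm → Vert`. -/
def IsWellBalanced (g : Metric m W) : Prop :=
  Φ.IsPrepared g ∧ ∃ P : ∀ x : W, Φ.Norm g x →ₗ[ℝ] ζ x, Φ.IsPi g P ∧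
    ∃ A : ℝ → ∀ x : W, Φ.Norm g x →ₗ[ℝ] ζ x, IsContinuousPathOn Φ.V A ∧
      (∀ s ∈ Set.Icc (0 : ℝ) 1, ∀ v ∈ Φ.V, Function.Bijective (A s v)) ∧
      (∀ v ∈ Φ.V, A 0 v = P v) ∧
      ∀ v ∈ Φ.V, ∀ w : Φ.Norm g v, (A 1 v w : TangentSpace (𝓡 m) v) = Φ.gammaHat v w

/-! ### Push-forward along a bundle monomorphism `F : ζ → TW` over the identity -/

/-- `F : ζ → TW` is a smooth injective bundle homomorphism over `N`. -/
def _root_.Igusa.IsBundleMonoOn (N : Set W) (F : ∀ x : W, ζ x →ₗ[ℝ] TangentSpace (𝓡 m) x) : Prop :=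
  (∀ x ∈ N, Function.Injective (F x)) ∧
  ∀ (Z : ∀ x : W, ζ x) (O : Set W), IsOpen O →
    SmoothFieldOn O (fun x => (Z x : TangentSpace (𝓡 m) x)) →
    SmoothFieldOn (N ∩ O) (fun x => F x (Z x))

/-- The inverse `F(ζ) → ζ` of `F` (over the points where `F` is injective). -/
def _root_.Igusa.rangeInv (F : ∀ x : W, ζ x →ₗ[ℝ] TangentSpace (𝓡 m) x) (x : W) :
    LinearMap.range (F x) →ₗ[ℝ] ζ x :=
  (F x).leftInverse ∘ₗ (LinearMap.range (F x)).subtype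

/-- The push-forward `(Id, F)_* Φ`, a FLIF for the distribution `F(ζ)` over `N`; the metric is
transported along with the operator. -/
def push (N : Set W) (F : ∀ x : W, ζ x →ₗ[ℝ] TangentSpace (𝓡 m) x) :
    FLIFData (fun x => LinearMap.range (F x)) where
  dom := N
  metric x := (Φ.metric x).compl₁₂ (rangeInv F x) (rangeInv F x)
  Φ0 := Φ.Φ0
  Φ1 x := (F x).rangeRestrict (Φ.Φ1 x)
  Φ2 x := (F x).rangeRestrict ∘ₗ Φ.Φ2 x ∘ₗ rangeInv F x
  lam x := (F x).rangeRestrict (Φ.lam x)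

/-! ### The twisted normal bundle -/

/-- A collar `Σ × ℝ ≅ Ω ⊆ V` (a diffeomorphism onto an open subset of `V`), with a closed tubular
neighbourhood `U ≅ Σ × [-ε, ε]` of `Σ` in `V` inside it, such that `τ = ∂/∂t` defines the index
coorientation of `Σ`. -/
structure Collar where
  ε : ℝ
  ε_pos : 0 < ε
  toFun : W → ℝ → W
  base : W → W
  coord : W → ℝ
  τ : ∀ x : W, TangentSpace (𝓡 m) x
  map_zero : ∀ s ∈ Φ.Sig, toFun s 0 = s
  map_mem : ∀ s ∈ Φ.Sig, ∀ t, toFun s t ∈ Φ.V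
  smooth : ContMDiffOn ((𝓡 m).prod 𝓘(ℝ, ℝ)) (𝓡 m) ∞ (fun q : W × ℝ => toFun q.1 q.2)
    (Φ.Sig ×ˢ Set.univ)
  base_map : ∀ s ∈ Φ.Sig, ∀ t, base (toFun s t) = s
  coord_map : ∀ s ∈ Φ.Sig, ∀ t, coord (toFun s t) = t
  base_smooth : ContMDiffOn (𝓡 m) (𝓡 m) ∞ base
    ((fun q : W × ℝ => toFun q.1 q.2) '' (Φ.Sig ×ˢ Set.univ))
  coord_smooth : ContMDiffOn (𝓡 m) 𝓘(ℝ, ℝ) ∞ coord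
    ((fun q : W × ℝ => toFun q.1 q.2) '' (Φ.Sig ×ˢ Set.univ))
  open_image : ∃ O : Set W, IsOpen O ∧
    (fun q : W × ℝ => toFun q.1 q.2) '' (Φ.Sig ×ˢ Set.univ) = Φ.V ∩ O
  closed_tube : ∃ K : Set W, IsClosed K ∧
    (fun q : W × ℝ => toFun q.1 q.2) '' (Φ.Sig ×ˢ Set.Icc (-ε) ε) = Φ.V ∩ K
  velocity_eq : ∀ s ∈ Φ.Sig, ∀ t, velocity (toFun s) t =
    (⟨toFun s t, τ (toFun s t)⟩ : TangentBundle (𝓡 m) W)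
  index_coorientation : ∀ s ∈ Φ.Sig, Φ.IsIndexCoorientation s (τ s)

/-- The closed tubular neighbourhood `U ≅ Σ × [-ε, ε]` of `Σ` in `V`. -/
def Collar.U {Φ : FLIFData ζ} (C : Φ.Collar) : Set W :=
  (fun q : W × ℝ => C.toFun q.1 q.2) '' (Φ.Sig ×ˢ Set.Icc (-C.ε) C.ε)

/-- The auxiliary choices in the construction of the twisted normal bundle: a tubular neighbourhood
`U` of `Σ` in `V` over which `λ⁺` is extended to a unit eigenvector field `lamT` of `Φ2`, with the
eigenvalue function `c`; an angle function `θ`; and an amplitude function `cT` (the function `c̃`). -/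
structure TwistChoices extends Φ.Collar where
  lamT : ∀ x : W, ζ x
  c : W → ℝ
  θ : W → ℝ
  cT : W → ℝ
  lamT_smooth : SmoothFieldOn toCollar.U (fun x => (lamT x : TangentSpace (𝓡 m) x))
  lamT_unit : ∀ x ∈ toCollar.U, Φ.metric x (lamT x) (lamT x) = 1
  lamT_eq : ∀ s ∈ Φ.Sig, lamT s = Φ.lam s
  lamT_eigen : ∀ x ∈ toCollar.U, Φ.Φ2 x (lamT x) = c x • lamT x
  θ_smooth : ContMDiffOn (𝓡 m) 𝓘(ℝ, ℝ) ∞ θ toCollar.U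
  θ_mem : ∀ x ∈ toCollar.U, θ x ∈ Set.Icc (-(Real.pi / 2)) (Real.pi / 2)
  θ_zero : ∀ x ∈ toCollar.U, θ x = 0 ↔ x ∈ Φ.Sig
  θ_regular : ∀ s ∈ Φ.Sig, deriv (fun t => θ (toFun s t)) 0 ≠ 0
  θ_top : ∀ s ∈ Φ.Sig, ∀ᶠ x in 𝓝[toCollar.U] (toFun s ε), θ x = Real.pi / 2
  θ_bot : ∀ s ∈ Φ.Sig, ∀ᶠ x in 𝓝[toCollar.U] (toFun s (-ε)), θ x = -(Real.pi / 2)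
  cT_smooth : ContMDiffOn (𝓡 m) 𝓘(ℝ, ℝ) ∞ cT toCollar.U
  cT_pos : ∀ x ∈ toCollar.U, 0 < cT x
  cT_top : ∀ s ∈ Φ.Sig, cT (toFun s ε) = c (toFun s ε)
  cT_bot : ∀ s ∈ Φ.Sig, cT (toFun s (-ε)) = -c (toFun s (-ε))

/-- The inverse `Γ⁻¹ : Vert → Norm` of the isomorphism `Γ = Γ̂|_Norm : Norm → Vert`. -/
def gammaInv (g : Metric m W) (x : W) (z : ζ x) : TangentSpace (𝓡 m) x :=
  (((Φ.gammaHat x).toLinearMap.domRestrict (Φ.Norm g x)).leftInverse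
    (z : TangentSpace (𝓡 m) x) : Φ.Norm g x)

namespace TwistChoices

variable {Φ} (C : Φ.TwistChoices) (g : Metric m W)

/-- The vector `μ⁺ = sin θ ñ⁺ + cos θ τ̃⁺`, where `ñ⁺ = Γ⁻¹(λ̃⁺)`. -/
def muPlus (x : W) : TangentSpace (𝓡 m) x :=
  Real.sin (C.θ x) • Φ.gammaInv g x (C.lamT x) + Real.cos (C.θ x) • C.τ x

open Classical in
/-- The twisted normal bundle (virtual vertical bundle) over `V`: it is `Norm` over `V \ U`, and
`Span(Γ⁻¹((λ̃⁺)^⊥), μ⁺)` over `U`. -/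
def twistedNormal (x : W) : Submodule ℝ (TangentSpace (𝓡 m) x) :=
  if x ∈ C.U then
    Submodule.span ℝ
      ({w | ∃ z : ζ x, Φ.metric x z (C.lamT x) = 0 ∧ w = Φ.gammaInv g x z} ∪ {C.muPlus g x})
  else Φ.Norm g x

open Classical in
/-- The isomorphism `Δ` from `Vert` to the twisted normal bundle: `Γ⁻¹ ∘ Φ2` over `V \ U` and on
`(λ̃⁺)^⊥` over `U`, and `λ̃⁺ ↦ c̃ μ⁺` over `U`. -/
def delta (x : W) (z : ζ x) : TangentSpace (𝓡 m) x :=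
  if x ∈ C.U then
    Φ.gammaInv g x (Φ.Φ2 x (z - Φ.metric x z (C.lamT x) • C.lamT x)) +
      Φ.metric x z (C.lamT x) • C.cT x • C.muPlus g x
  else Φ.gammaInv g x (Φ.Φ2 x z)

end TwistChoices

end FLIFData

end Igusa

end

/-!
The proof has a local part, on FLIFs in general, and a part on the collar of `Σ`.

In a local frame `e` of `ζ` the section `Φ1 = ∑ fᵢ eᵢ` gives equations `fᵢ` of `V`, and
`Γ̂ = ∑ dfᵢ ⊗ eᵢ` over `V` (`linearization_sum`). By transversality and the implicit function theorem
(`exists_isCurveIn`), the tangent space of `V` is the kernel of `Γ̂` (`IsFLIF.mem_tangentTo_iff`), so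
that `Γ` is invertible, with an inverse which is a combination of the gradients of the `fᵢ` and
hence smooth (`IsFLIF.gammaInv_fieldOn`). All the data of a FLIF are transported by `F`, and
`Γ̂` becomes `F ∘ Γ̂` (`IsFLIF.push_gammaHat`); therefore the push-forward is a FLIF (`IsFLIF.push`).

The position of `ν = F(ζ)` with respect to `V` is read off from `Γ̂ ∘ F` over `V`. Since `τ` is
tangent to `V`, this composition is the operator which is `Φ2` outside of the tube `U`, and over `U`
has `c̃ sin θ` instead of `c` as its eigenvalue on `λ̃⁺` (`IsFLIF.gammaHat_delta`, where it is
called `twist`). It is invertible off `Σ`, and its kernel over `Σ` is spanned by `λ⁺`, where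
`F(λ⁺) = c̃ τ`. So `ν` is tangent to `V` along `Σ` exactly, in the direction of `τ`, which gives
the line of tangency and the index coorientation. For a form `α` which annihilates `ν`, the
relation `α(μ⁺) = 0` reads `α(τ) = - tan θ α(Γ⁻¹ λ̃⁺)`, and the derivative of `θ` along `τ` is
positive; this shows that the tangency is a fold, and determines its characteristic coorientation
(`IsFLIF.exists_isTangencyPair`).

Off `Σ` the isomorphism `Π` of the push-forward is `F ∘ Φ2 ∘ (Γ̂ ∘ F)⁻¹ ∘ Γ̂`. It differs from its
`Γ`, which is `F ∘ Γ̂`, by the factor `h = c / (c̃ sin θ)` in the direction of `λ̃⁺` over `U`. Both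
`c` and `c̃ sin θ` have the sign of the collar coordinate and vanish to first order along `Σ`: the
former because `det Φ2` does, and `det Φ2 = c det A` with a smooth operator `A` (`IsFLIF.det_Φ2`).
Hence `h` extends to a positive continuous function on `V` (`IsFLIF.exists_ratio`), equal to `1` on
the boundary of the tube, and `1 + (1 - s) (h - 1)` gives the homotopy from `Π` to `Γ`. If
`c̃ sin θ = c`, then `h = 1`.
-/

set_option linter.unusedSectionVars false

namespace Igusa

variable {m : ℕ} {W : Type*} [TopologicalSpace W] [ChartedSpace (EuclideanSpace ℝ (Fin m)) W]
  [IsManifold (𝓡 m) ∞ W]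

/-! ### Fields and forms of class `C^r` -/

/-- The field `Z` of tangent vectors is of class `C^r` along `S`, a common form of `ContinuousFieldOn`
(for `r = 0`) and `SmoothFieldOn` (for `r = ∞`, by definition). -/
def FieldOn (r : WithTop ℕ∞) (S : Set W) (Z : ∀ x : W, TangentSpace (𝓡 m) x) : Prop :=
  ContMDiffOn (𝓡 m) (𝓡 m).tangent r (fun x => (⟨x, Z x⟩ : TangentBundle (𝓡 m) W)) S

lemma continuousFieldOn_iff {S : Set W} {Z : ∀ x : W, TangentSpace (𝓡 m) x} :
    ContinuousFieldOn S Z ↔ FieldOn 0 S Z := contMDiffOn_zero_iff.symm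

namespace FieldOn

variable {r : WithTop ℕ∞} {S T : Set W} {Z Z' : ∀ x : W, TangentSpace (𝓡 m) x}

lemma mono (h : FieldOn r S Z) (hT : T ⊆ S) : FieldOn r T Z := ContMDiffOn.mono h hT

lemma of_le {r' : WithTop ℕ∞} (h : FieldOn r S Z) (hr : r' ≤ r) : FieldOn r' S Z :=
  ContMDiffOn.of_le h hr

lemma congr (h : FieldOn r S Z) (hZ : ∀ x ∈ S, Z' x = Z x) : FieldOn r S Z' :=
  ContMDiffOn.congr h fun x hx => by rw [hZ x hx]

lemma of_locally (h : ∀ x ∈ S, ∃ O : Set W, IsOpen O ∧ x ∈ O ∧ FieldOn r (S ∩ O) Z) :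
    FieldOn r S Z :=
  contMDiffOn_of_locally_contMDiffOn h

lemma add (h : FieldOn r S Z) (h' : FieldOn r S Z') : FieldOn r S (fun x => Z x + Z' x) :=
  ContMDiffOn.add_section h h'

lemma sub (h : FieldOn r S Z) (h' : FieldOn r S Z') : FieldOn r S (fun x => Z x - Z' x) :=
  ContMDiffOn.sub_section h h'

lemma smul {f : W → ℝ} (hf : ContMDiffOn (𝓡 m) 𝓘(ℝ, ℝ) r f S) (h : FieldOn r S Z) :
    FieldOn r S (fun x => f x • Z x) :=
  ContMDiffOn.smul_section hf h

lemma sum {ι : Type*} {s : Finset ι} {Z : ι → ∀ x : W, TangentSpace (𝓡 m) x}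
    (h : ∀ i ∈ s, FieldOn r S (Z i)) : FieldOn r S (fun x => ∑ i ∈ s, Z i x) :=
  ContMDiffOn.sum_section h

end FieldOn

/-- `α` is a smooth `1`-form over `O`. -/
def SmoothForm (O : Set W) (α : ∀ x : W, TangentSpace (𝓡 m) x →L[ℝ] ℝ) : Prop :=
  ContMDiffOn (𝓡 m).tangent 𝓘(ℝ, ℝ) ∞ (fun q : TangentBundle (𝓡 m) W => α q.1 q.2) {q | q.1 ∈ O}

namespace SmoothForm

variable {O O' : Set W} {α β : ∀ x : W, TangentSpace (𝓡 m) x →L[ℝ] ℝ}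

lemma mono (h : SmoothForm O α) (hO : O' ⊆ O) : SmoothForm O' α :=
  ContMDiffOn.mono h fun _ hq => hO hq

lemma apply {r : WithTop ℕ∞} (hr : r ≤ ∞) (h : SmoothForm O α) {S : Set W} (hS : S ⊆ O)
    {Z : ∀ x : W, TangentSpace (𝓡 m) x} (hZ : FieldOn r S Z) :
    ContMDiffOn (𝓡 m) 𝓘(ℝ, ℝ) r (fun x => α x (Z x)) S :=
  (ContMDiffOn.of_le h hr).comp hZ fun _ hx => hS hx

lemma sub (h : SmoothForm O α) (h' : SmoothForm O β) : SmoothForm O (fun x => α x - β x) :=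
  ContMDiffOn.sub h h'

lemma smul {f : W → ℝ} (hf : ContMDiffOn (𝓡 m) 𝓘(ℝ, ℝ) ∞ f O) (h : SmoothForm O α) :
    SmoothForm O (fun x => f x • α x) :=
  (hf.comp (Bundle.contMDiffOn_proj _) fun _ hq => hq).smul h

lemma sum {ι : Type*} {s : Finset ι} {α : ι → ∀ x : W, TangentSpace (𝓡 m) x →L[ℝ] ℝ}
    (h : ∀ i ∈ s, SmoothForm O (α i)) : SmoothForm O (fun x => ∑ i ∈ s, α i x) := by
  refine ContMDiffOn.congr (contMDiffOn_finsetSum h) fun q _ => ?_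
  simp

end SmoothForm

/-- Every covector at `p` is the value of a smooth form near `p`, constant in a trivialization. -/
lemma exists_smoothForm (p : W) (L : TangentSpace (𝓡 m) p →L[ℝ] ℝ) :
    ∃ (O : Set W) (α : ∀ x : W, TangentSpace (𝓡 m) x →L[ℝ] ℝ),
      IsOpen O ∧ p ∈ O ∧ SmoothForm O α ∧ α p = L := by
  set e := trivializationAt (EuclideanSpace ℝ (Fin m)) (TangentSpace (𝓡 m) : W → Type _) p
  have hp : p ∈ e.baseSet := FiberBundle.mem_baseSet_trivializationAt' p
  refine ⟨e.baseSet, fun x => (L ∘L e.symmL ℝ p) ∘L e.continuousLinearMapAt ℝ x,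
    e.open_baseSet, hp, ?_, ?_⟩
  · have h1 : ContMDiffOn (𝓡 m).tangent ((𝓡 m).prod 𝓘(ℝ, EuclideanSpace ℝ (Fin m))) ∞ e e.source :=
      e.contMDiffOn
    have h2 : ContMDiffOn (𝓡 m).tangent 𝓘(ℝ, EuclideanSpace ℝ (Fin m)) ∞
        (fun q => (e q).2) e.source := contMDiff_snd.comp_contMDiffOn h1
    have h3 : ContMDiffOn (𝓡 m).tangent 𝓘(ℝ, ℝ) ∞
        (fun q => (L ∘L e.symmL ℝ p) (e q).2) e.source :=
      (L ∘L e.symmL ℝ p).contMDiff.comp_contMDiffOn h2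
    refine ContMDiffOn.congr (h3.mono fun q hq => e.mem_source.2 hq) fun q hq => ?_
    have : e.continuousLinearMapAt ℝ q.1 q.2 = (e q).2 := by
      rw [e.continuousLinearMapAt_apply ℝ, e.linearMapAt_apply]
      exact if_pos hq
    simp only [ContinuousLinearMap.comp_apply, this]
  · ext w
    simp only [ContinuousLinearMap.comp_apply]
    rw [e.symmL_continuousLinearMapAt hp]

/-- There is a smooth frame of `TW` near every point. -/
lemma exists_frame (p : W) : ∃ (O : Set W) (b : Fin m → ∀ x : W, TangentSpace (𝓡 m) x),
    IsOpen O ∧ p ∈ O ∧ (∀ i, FieldOn ∞ O (b i)) ∧ (∀ x ∈ O, LinearIndependent ℝ fun i => b i x) ∧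
    ∀ x ∈ O, Submodule.span ℝ (Set.range fun i => b i x) = ⊤ := by
  set e := trivializationAt (EuclideanSpace ℝ (Fin m)) (TangentSpace (𝓡 m) : W → Type _) p
  have h := e.isLocalFrameOn_localFrame_baseSet (𝓡 m) ∞ (EuclideanSpace.basisFun (Fin m) ℝ).toBasis
  exact ⟨e.baseSet, _, e.open_baseSet, FiberBundle.mem_baseSet_trivializationAt' p,
    fun i => h.contMDiffOn i, fun x hx => h.linearIndependent hx,
    fun x hx => top_le_iff.1 (h.generating hx)⟩

lemma contMDiffOn_inv {r : WithTop ℕ∞} {S : Set W} {f : W → ℝ}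
    (h : ContMDiffOn (𝓡 m) 𝓘(ℝ, ℝ) r f S) (h0 : ∀ x ∈ S, f x ≠ 0) :
    ContMDiffOn (𝓡 m) 𝓘(ℝ, ℝ) r (fun x => (f x)⁻¹) S := fun x hx =>
  ((contDiffAt_inv ℝ (h0 x hx)).contMDiffAt).comp_contMDiffWithinAt x (h x hx)

lemma contMDiffOn_det {ι : Type*} [Fintype ι] [DecidableEq ι] {r : WithTop ℕ∞} {S : Set W}
    {M : W → Matrix ι ι ℝ} (h : ∀ i j, ContMDiffOn (𝓡 m) 𝓘(ℝ, ℝ) r (fun x => M x i j) S) :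
    ContMDiffOn (𝓡 m) 𝓘(ℝ, ℝ) r (fun x => (M x).det) S := by
  simp only [Matrix.det_apply, Units.smul_def, zsmul_eq_mul]
  exact contMDiffOn_finsetSum fun σ _ => contMDiffOn_const.mul (contMDiffOn_finsetProd fun i _ => h _ _)

lemma contMDiffOn_matrix_inv {ι : Type*} [Fintype ι] [DecidableEq ι] {r : WithTop ℕ∞} {S : Set W}
    {M : W → Matrix ι ι ℝ} (h : ∀ i j, ContMDiffOn (𝓡 m) 𝓘(ℝ, ℝ) r (fun x => M x i j) S)
    (h0 : ∀ x ∈ S, (M x).det ≠ 0) (i j : ι) :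
    ContMDiffOn (𝓡 m) 𝓘(ℝ, ℝ) r (fun x => (M x)⁻¹ i j) S := by
  have : ∀ x, (M x)⁻¹ i j = ((M x).det)⁻¹ * ((M x).updateRow j (Pi.single i 1)).det := fun x => by
    rw [Matrix.inv_def, Matrix.smul_apply, Matrix.adjugate_apply, Ring.inverse_eq_inv', smul_eq_mul]
  simp only [this]
  refine (contMDiffOn_inv (contMDiffOn_det h) h0).mul (contMDiffOn_det fun k l => ?_)
  by_cases hk : k = j
  · subst hk; simpa using contMDiffOn_const
  · simpa [Matrix.updateRow_ne hk] using h k l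

/-- Smooth vector fields which are linearly independent at `p` have smooth dual forms near `p`. -/
lemma exists_coframe {n : ℕ} {O : Set W} (hO : IsOpen O) {p : W} (hp : p ∈ O)
    {e : Fin n → ∀ x : W, TangentSpace (𝓡 m) x} (he : ∀ i, FieldOn ∞ O (e i))
    (hli : LinearIndependent ℝ fun i => e i p) :
    ∃ (O' : Set W) (κ : Fin n → ∀ x : W, TangentSpace (𝓡 m) x →L[ℝ] ℝ), IsOpen O' ∧ p ∈ O' ∧
      O' ⊆ O ∧ (∀ i, SmoothForm O' (κ i)) ∧ ∀ x ∈ O', ∀ i j, κ i x (e j x) = if i = j then 1 else 0 := by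
  classical
  have : FiniteDimensional ℝ (TangentSpace (𝓡 m) p) :=
    inferInstanceAs (FiniteDimensional ℝ (EuclideanSpace ℝ (Fin m)))
  have : T2Space (TangentSpace (𝓡 m) p) :=
    inferInstanceAs (T2Space (EuclideanSpace ℝ (Fin m)))
  set ℓ := (Fintype.linearCombination ℝ fun i => e i p).leftInverse with hℓ
  have hker : LinearMap.ker (Fintype.linearCombination ℝ fun i => e i p) = ⊥ :=
    LinearMap.ker_eq_bot.2 (linearIndependent_iff_injective_fintypeLinearCombination.1 hli)
  have hdual : ∀ i j, ((LinearMap.proj i).comp ℓ) (e j p) = if i = j then (1 : ℝ) else 0 := by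
    intro i j
    have := LinearMap.leftInverse_apply_of_inj hker (Pi.single j 1)
    rw [Fintype.linearCombination_apply_single, one_smul] at this
    rw [LinearMap.comp_apply, hℓ, this]
    simp [Pi.single_apply]
  choose A α hAo hpA hα hαp using fun i : Fin n =>
    exists_smoothForm (W := W) p (LinearMap.toContinuousLinearMap ((LinearMap.proj i).comp ℓ))
  set O₁ : Set W := O ∩ ⋂ i, A i
  have hO₁ : IsOpen O₁ := hO.inter (isOpen_iInter_of_finite hAo)
  set M : W → Matrix (Fin n) (Fin n) ℝ := fun x => Matrix.of fun i j => α i x (e j x)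
  have hM : ∀ i j, ContMDiffOn (𝓡 m) 𝓘(ℝ, ℝ) ∞ (fun x => M x i j) O₁ := fun i j =>
    (hα i).apply le_rfl (fun x hx => Set.mem_iInter.1 hx.2 i) ((he j).mono fun x hx => hx.1)
  have hMp : M p = 1 := by
    ext i j
    simp only [M, Matrix.of_apply, hαp, LinearMap.coe_toContinuousLinearMap', hdual,
      Matrix.one_apply]
  have hO' : IsOpen (O₁ ∩ (fun x => (M x).det) ⁻¹' {0}ᶜ) :=
    (contMDiffOn_det hM).continuousOn.isOpen_inter_preimage hO₁ isOpen_compl_singleton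
  refine ⟨O₁ ∩ (fun x => (M x).det) ⁻¹' {0}ᶜ, fun i x => ∑ k, (M x)⁻¹ i k • α k x, hO',
    ⟨⟨hp, Set.mem_iInter.2 hpA⟩, by simp [hMp]⟩, fun x hx => hx.1.1, fun i => ?_,
    fun x hx i j => ?_⟩
  · exact SmoothForm.sum fun k _ => SmoothForm.smul
      (contMDiffOn_matrix_inv (fun i j => (hM i j).mono fun x hx => hx.1) (fun x hx => hx.2) i k)
      ((hα k).mono fun x hx => Set.mem_iInter.1 hx.1.2 k)
  · have : (M x)⁻¹ * M x = 1 := Matrix.nonsing_inv_mul _ (isUnit_iff_ne_zero.2 hx.2)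
    have := congrFun (congrFun this i) j
    rw [Matrix.mul_apply, Matrix.one_apply] at this
    simpa [M] using this

/-! ### Differentials of functions and curves in a zero set -/

lemma smoothForm_mvfderiv {O : Set W} (hO : IsOpen O) {f : W → ℝ}
    (hf : ContMDiffOn (𝓡 m) 𝓘(ℝ, ℝ) ∞ f O) : SmoothForm O (fun x => mvfderiv (𝓡 m) f x) := by
  have h1 := hf.contMDiffOn_tangentMapWithin (m := ∞) (by simp) hO.uniqueMDiffOn
  have h2 := (contMDiff_snd_tangentBundle_modelSpace (n := ∞) ℝ 𝓘(ℝ, ℝ)).comp_contMDiffOn h1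
  refine ContMDiffOn.congr h2 fun q hq => ?_
  simp only [Function.comp, tangentMapWithin]
  rw [mfderivWithin_of_isOpen hO hq]
  rfl

lemma IsCurveIn.left_eq {S : Set W} {c : ℝ → W} {p : W} {w : TangentSpace (𝓡 m) p}
    (h : IsCurveIn S c p w) : c 0 = p :=
  congrArg Bundle.TotalSpace.proj h.velocity_eq

lemma IsCurveIn.hasDerivAt_comp {S : Set W} {c : ℝ → W} {p : W} {w : TangentSpace (𝓡 m) p}
    (h : IsCurveIn S c p w) {f : W → ℝ} (hf : MDifferentiableAt (𝓡 m) 𝓘(ℝ, ℝ) f p) :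
    HasDerivAt (fun t => f (c t)) (mvfderiv (𝓡 m) f p w) 0 := by
  have h0 := h.left_eq
  subst h0
  have hw : mfderiv 𝓘(ℝ, ℝ) (𝓡 m) c 0 (1 : ℝ) = w := by
    have := h.velocity_eq
    rw [velocity, Bundle.TotalSpace.mk.injEq] at this
    exact eq_of_heq this.2
  have hc : MDifferentiableAt 𝓘(ℝ, ℝ) (𝓡 m) c 0 := h.smooth.mdifferentiableAt (by simp)
  have h1 : HasFDerivAt (fun t => f (c t)) ((mvfderiv (𝓡 m) f (c 0)).comp
      (show ℝ →L[ℝ] TangentSpace (𝓡 m) (c 0) from mfderiv 𝓘(ℝ, ℝ) (𝓡 m) c 0)) 0 :=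
    (hf.hasMFDerivAt.comp (0 : ℝ) hc.hasMFDerivAt).hasFDerivAt
  rw [← hw]
  exact h1.hasDerivAt

/-- The inverse of a chart parametrizes `W` near `p` by a submersion. -/
lemma exists_param (p : W) : ∃ (σ : EuclideanSpace ℝ (Fin m) → W) (y : EuclideanSpace ℝ (Fin m)),
    σ y = p ∧ ContMDiffAt 𝓘(ℝ, EuclideanSpace ℝ (Fin m)) (𝓡 m) ∞ σ y ∧
    Function.Surjective (mfderiv 𝓘(ℝ, EuclideanSpace ℝ (Fin m)) (𝓡 m) σ y) := by
  have hy := mem_extChartAt_target (I := 𝓡 m) p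
  refine ⟨(extChartAt (𝓡 m) p).symm, extChartAt (𝓡 m) p p, extChartAt_to_inv p, ?_, ?_⟩
  · exact (contMDiffOn_extChartAt_symm p).contMDiffAt (extChartAt_target_mem_nhds p)
  · have h := isInvertible_mfderivWithin_extChartAt_symm (I := 𝓡 m) hy
    rw [ModelWithCorners.range_eq_univ, mfderivWithin_univ] at h
    exact h.bijective.surjective

/-- The implicit function theorem is applied in a parametrization `σ`, to the equations
`f (σ (y + t u + R a)) = 0` in `t` and `a`, where `u` is a preimage of `w`, and `R` is a right inverse
of the differential of the equations; they have a solution `a = ψ t` with `ψ' 0 = 0`. -/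
lemma exists_isCurveIn_of_param {n : ℕ} {σ : EuclideanSpace ℝ (Fin m) → W}
    {y : EuclideanSpace ℝ (Fin m)}
    (hσ : ContMDiffAt 𝓘(ℝ, EuclideanSpace ℝ (Fin m)) (𝓡 m) ∞ σ y)
    (hs : Function.Surjective (mfderiv 𝓘(ℝ, EuclideanSpace ℝ (Fin m)) (𝓡 m) σ y))
    {f : Fin n → W → ℝ} (hf : ∀ i, ContMDiffAt (𝓡 m) 𝓘(ℝ, ℝ) ∞ (f i) (σ y))
    (h0 : ∀ i, f i (σ y) = 0)
    (hsurj : ∀ a : Fin n → ℝ, ∃ w, ∀ i, mvfderiv (𝓡 m) (f i) (σ y) w = a i)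
    (w : TangentSpace (𝓡 m) (σ y)) (hw : ∀ i, mvfderiv (𝓡 m) (f i) (σ y) w = 0) :
    ∃ c : ℝ → W, IsCurveIn {x | ∀ i, f i x = 0} c (σ y) w := by
  let D : EuclideanSpace ℝ (Fin m) →L[ℝ] TangentSpace (𝓡 m) (σ y) :=
    mfderiv 𝓘(ℝ, EuclideanSpace ℝ (Fin m)) (𝓡 m) σ y
  have hDs : Function.Surjective D := hs
  obtain ⟨u, hu⟩ := hDs w
  have hσd : MDifferentiableAt 𝓘(ℝ, EuclideanSpace ℝ (Fin m)) (𝓡 m) σ y :=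
    hσ.mdifferentiableAt (by simp)
  let G : EuclideanSpace ℝ (Fin m) → Fin n → ℝ := fun z i => f i (σ z)
  have hG : ContDiffAt ℝ ∞ G y :=
    contDiffAt_pi.2 fun i => ((hf i).comp y hσ).contDiffAt
  have hG' : ∀ v i, fderiv ℝ G y v i = mvfderiv (𝓡 m) (f i) (σ y) (D v) := by
    intro v i
    have h1 : HasFDerivAt (fun z => G z i) ((ContinuousLinearMap.proj i).comp (fderiv ℝ G y)) y :=
      (hasFDerivAt_pi'.1 (hG.differentiableAt (by simp)).hasFDerivAt) i
    have h2 := ((((hf i).mdifferentiableAt (by simp)).hasMFDerivAt).comp y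
      hσd.hasMFDerivAt).hasFDerivAt
    have := h1.unique h2
    exact congrArg (fun L : EuclideanSpace ℝ (Fin m) →L[ℝ] ℝ => L v) this
  -- a right inverse of the differential of the equations
  have hGs : ∃ R : (Fin n → ℝ) →L[ℝ] EuclideanSpace ℝ (Fin m), ∀ a, fderiv ℝ G y (R a) = a := by
    have : LinearMap.range (fderiv ℝ G y : EuclideanSpace ℝ (Fin m) →ₗ[ℝ] Fin n → ℝ) = ⊤ := by
      rw [LinearMap.range_eq_top]
      intro a
      obtain ⟨w', hw'⟩ := hsurj a
      obtain ⟨v, rfl⟩ := hDs w'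
      exact ⟨v, funext fun i => (hG' v i).trans (hw' i)⟩
    obtain ⟨R, hR⟩ := LinearMap.exists_rightInverse_of_surjective _ this
    exact ⟨LinearMap.toContinuousLinearMap R, fun a => LinearMap.congr_fun hR a⟩
  obtain ⟨R, hR⟩ := hGs
  let A : ℝ × (Fin n → ℝ) →L[ℝ] EuclideanSpace ℝ (Fin m) :=
    (ContinuousLinearMap.fst ℝ ℝ (Fin n → ℝ)).smulRight u +
      R.comp (ContinuousLinearMap.snd ℝ ℝ (Fin n → ℝ))
  let Ψ : ℝ × (Fin n → ℝ) → Fin n → ℝ := fun q => G (y + A q)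
  have hA0 : y + A (0 : ℝ × (Fin n → ℝ)) = y := by simp
  have hΨ : ContDiffAt ℝ ∞ Ψ 0 := by
    refine ContDiffAt.comp (0 : ℝ × (Fin n → ℝ)) (g := G) (by rw [hA0]; exact hG) ?_
    exact contDiffAt_const.add A.contDiff.contDiffAt
  have hΨ' : HasFDerivAt Ψ ((fderiv ℝ G y).comp A) 0 := by
    refine HasFDerivAt.comp (0 : ℝ × (Fin n → ℝ)) (g := G) ?_ (A.hasFDerivAt.const_add y)
    rw [hA0]; exact (hG.differentiableAt (by simp)).hasFDerivAt
  have hinr : fderiv ℝ Ψ 0 ∘L .inr ℝ ℝ (Fin n → ℝ) = ContinuousLinearMap.id ℝ _ := by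
    rw [hΨ'.fderiv]
    ext1 a
    simp [A, hR]
  have hu0 : fderiv ℝ G y u = 0 := funext fun i => by
    rw [hG', hu, hw, Pi.zero_apply]
  have hinl : fderiv ℝ Ψ 0 ∘L .inl ℝ ℝ (Fin n → ℝ) = 0 := by
    rw [hΨ'.fderiv]
    ext1
    simp [A, hu0]
  have hinv : (fderiv ℝ Ψ 0 ∘L .inr ℝ ℝ (Fin n → ℝ)).IsInvertible := by
    rw [hinr]; exact ContinuousLinearMap.isInvertible_equiv (f := ContinuousLinearEquiv.refl ℝ _)
  have hn0 : (∞ : WithTop ℕ∞) ≠ 0 := by simp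
  let ψ := hΨ.implicitFunction hn0 hinv
  have hψ0 : ψ 0 = 0 := hΨ.implicitFunction_apply_self hn0 hinv
  have hψs : ContDiffAt ℝ ∞ ψ 0 := hΨ.contDiffAt_implicitFunction hn0 hinv
  have hψd : HasFDerivAt ψ (0 : ℝ →L[ℝ] (Fin n → ℝ)) 0 := by
    have := (hΨ.hasStrictFDerivAt_implicitFunction hn0 hinv).hasFDerivAt
    rw [hinl, ContinuousLinearMap.comp_zero, neg_zero] at this
    exact this
  have hψe : ∀ᶠ t in 𝓝 (0 : ℝ), Ψ (t, ψ t) = 0 := by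
    have := hΨ.eventually_apply_implicitFunction hn0 hinv
    have hΨ0 : Ψ 0 = 0 := by
      funext i; simp only [Ψ, hA0]; exact h0 i
    rwa [hΨ0] at this
  let γ : ℝ → EuclideanSpace ℝ (Fin m) := fun t => y + A (t, ψ t)
  have hγ0 : γ 0 = y := by simp only [γ, hψ0]; exact hA0
  have hγs : ContDiffAt ℝ ∞ γ 0 :=
    contDiffAt_const.add (A.contDiff.contDiffAt.comp (0 : ℝ) (contDiffAt_id.prodMk hψs))
  have hγd : HasDerivAt γ u 0 := by
    have h1 : HasFDerivAt γ (A.comp ((ContinuousLinearMap.id ℝ ℝ).prod 0)) 0 :=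
      (A.hasFDerivAt.comp (0 : ℝ) ((hasFDerivAt_id (0 : ℝ)).prodMk hψd)).const_add y
    have := h1.hasDerivAt
    simpa [A] using this
  refine ⟨σ ∘ γ, ?_, ?_, ?_⟩
  · exact ContMDiffAt.comp (0 : ℝ) (by rw [hγ0]; exact hσ) hγs.contMDiffAt
  · filter_upwards [hψe] with t ht i using congrFun ht i
  · have hγm : MDifferentiableAt 𝓘(ℝ, ℝ) 𝓘(ℝ, EuclideanSpace ℝ (Fin m)) γ 0 :=
      hγd.differentiableAt.mdifferentiableAt
    have h1 := tangentMap_comp_at (I := 𝓘(ℝ, ℝ)) (I' := 𝓘(ℝ, EuclideanSpace ℝ (Fin m)))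
      (I'' := 𝓡 m) (g := σ) (f := γ) ⟨(0 : ℝ), (1 : ℝ)⟩ (by rw [hγ0]; exact hσd) hγm
    have h2 : tangentMap 𝓘(ℝ, ℝ) 𝓘(ℝ, EuclideanSpace ℝ (Fin m)) γ ⟨(0 : ℝ), (1 : ℝ)⟩ =
        (⟨y, u⟩ : TangentBundle 𝓘(ℝ, EuclideanSpace ℝ (Fin m)) (EuclideanSpace ℝ (Fin m))) := by
      have : mfderiv 𝓘(ℝ, ℝ) 𝓘(ℝ, EuclideanSpace ℝ (Fin m)) γ 0 = fderiv ℝ γ 0 := mfderiv_eq_fderiv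
      have : mfderiv 𝓘(ℝ, ℝ) 𝓘(ℝ, EuclideanSpace ℝ (Fin m)) γ 0 (1 : ℝ) = u :=
        (congrArg (fun L : ℝ →L[ℝ] EuclideanSpace ℝ (Fin m) => L 1) this).trans
          (fderiv_apply_one_eq_deriv.trans hγd.deriv)
      exact Bundle.TotalSpace.ext hγ0 (heq_of_eq this)
    rw [h2] at h1
    refine (show velocity (σ ∘ γ) 0 = _ from h1).trans ?_
    simp only [tangentMap]
    exact congrArg _ hu

/-- The implicit function theorem: a vector annihilated by the differentials of independent
functions is the velocity of a smooth curve in their common zero set. -/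
lemma exists_isCurveIn {n : ℕ} {p : W} {f : Fin n → W → ℝ}
    (hf : ∀ i, ContMDiffAt (𝓡 m) 𝓘(ℝ, ℝ) ∞ (f i) p) (h0 : ∀ i, f i p = 0)
    (hsurj : ∀ a : Fin n → ℝ, ∃ w, ∀ i, mvfderiv (𝓡 m) (f i) p w = a i)
    (w : TangentSpace (𝓡 m) p) (hw : ∀ i, mvfderiv (𝓡 m) (f i) p w = 0) :
    ∃ c : ℝ → W, IsCurveIn {x | ∀ i, f i x = 0} c p w := by
  obtain ⟨σ, y, rfl, hσ, hs⟩ := exists_param (m := m) p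
  exact exists_isCurveIn_of_param hσ hs hf h0 hsurj w hw

lemma mvfderiv_sum_smul {ι F : Type*} [NormedAddCommGroup F] [NormedSpace ℝ F] {p : W}
    {f : ι → W → ℝ} {E : ι → W → F} (hf : ∀ i, MDifferentiableAt (𝓡 m) 𝓘(ℝ, ℝ) (f i) p)
    (hE : ∀ i, MDifferentiableAt (𝓡 m) 𝓘(ℝ, F) (E i) p) (s : Finset ι) :
    MDifferentiableAt (𝓡 m) 𝓘(ℝ, F) (fun x => ∑ i ∈ s, f i x • E i x) p ∧
    mvfderiv (𝓡 m) (fun x => ∑ i ∈ s, f i x • E i x) p =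
      ∑ i ∈ s, (f i p • mvfderiv (𝓡 m) (E i) p + (mvfderiv (𝓡 m) (f i) p).smulRight (E i p)) := by
  classical
  induction s using Finset.induction_on with
  | empty => simpa using ⟨mdifferentiableAt_const, mvfderiv_const 0⟩
  | insert a s ha ih =>
    have h1 : MDifferentiableAt (𝓡 m) 𝓘(ℝ, F) (f a • E a) p := (hf a).smul (hE a)
    have h2 : (fun x => ∑ i ∈ insert a s, f i x • E i x) =
        f a • E a + fun x => ∑ i ∈ s, f i x • E i x := by
      funext x; simp [Finset.sum_insert ha]
    rw [h2, mvfderiv_add h1 ih.1, ih.2, Finset.sum_insert ha, mvfderiv_smul (hf a) (hE a)]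
    exact ⟨h1.add ih.1, rfl⟩

/-- The differential of `∑ fᵢ Xᵢ` at a common zero of the `fᵢ` is `∑ dfᵢ ⊗ Xᵢ`. -/
lemma linearization_sum {n : ℕ} {O : Set W} (hO : IsOpen O) {p : W} (hp : p ∈ O)
    {f : Fin n → W → ℝ} (hf : ∀ i, ContMDiffOn (𝓡 m) 𝓘(ℝ, ℝ) ∞ (f i) O) (h0 : ∀ i, f i p = 0)
    {e : Fin n → ∀ x : W, TangentSpace (𝓡 m) x} (he : ∀ i, FieldOn ∞ O (e i))
    {X : ∀ x : W, TangentSpace (𝓡 m) x} (hX : ∀ x ∈ O, X x = ∑ i, f i x • e i x)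
    (w : TangentSpace (𝓡 m) p) :
    linearization X p w = ∑ i, mvfderiv (𝓡 m) (f i) p w • e i p := by
  set T := trivializationAt (EuclideanSpace ℝ (Fin m)) (TangentSpace (𝓡 m) : W → Type _) p with hT
  have hpT : p ∈ T.baseSet := FiberBundle.mem_baseSet_trivializationAt' p
  have hOp : O ∈ 𝓝 p := hO.mem_nhds hp
  let E : Fin n → W → EuclideanSpace ℝ (Fin m) := fun i x =>
    (T (⟨x, e i x⟩ : TangentBundle (𝓡 m) W)).2
  have hE : ∀ i, MDifferentiableAt (𝓡 m) 𝓘(ℝ, EuclideanSpace ℝ (Fin m)) (E i) p := fun i =>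
    ((Bundle.contMDiffAt_section p).1 ((he i).contMDiffAt hOp)).mdifferentiableAt (by simp)
  have hfd : ∀ i, MDifferentiableAt (𝓡 m) 𝓘(ℝ, ℝ) (f i) p := fun i =>
    ((hf i).contMDiffAt hOp).mdifferentiableAt (by simp)
  have hloc : (fun x => (T (⟨x, X x⟩ : TangentBundle (𝓡 m) W)).2) =ᶠ[𝓝 p]
      fun x => ∑ i, f i x • E i x := by
    filter_upwards [hOp, T.open_baseSet.mem_nhds hpT] with x hx hxT
    have h1 : ∀ v : TangentSpace (𝓡 m) x, (T (⟨x, v⟩ : TangentBundle (𝓡 m) W)).2 =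
        T.continuousLinearMapAt ℝ x v := fun v => by
      rw [T.continuousLinearMapAt_apply ℝ, T.linearMapAt_apply]
      exact (if_pos hxT).symm
    simp only [E, h1, hX x hx, map_sum, map_smul]
  have hd : mvfderiv (𝓡 m) (fun x => (T (⟨x, X x⟩ : TangentBundle (𝓡 m) W)).2) p =
      ∑ i, (mvfderiv (𝓡 m) (f i) p).smulRight (E i p) := by
    have h1 : mvfderiv (𝓡 m) (fun x => (T (⟨x, X x⟩ : TangentBundle (𝓡 m) W)).2) p =
        mvfderiv (𝓡 m) (fun x => ∑ i, f i x • E i x) p := hloc.mfderiv_eq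
    rw [h1, (mvfderiv_sum_smul hfd hE Finset.univ).2]
    simp [h0]
  have h2 : linearization X p w = T.symmL ℝ p
      (mvfderiv (𝓡 m) (fun x => (T (⟨x, X x⟩ : TangentBundle (𝓡 m) W)).2) p w) := rfl
  have h3 : ∀ i, T.symmL ℝ p (E i p) = e i p := fun i => by
    have : E i p = T.continuousLinearMapAt ℝ p (e i p) := by
      rw [T.continuousLinearMapAt_apply ℝ, T.linearMapAt_apply]
      exact (if_pos hpT).symm
    rw [this, T.symmL_continuousLinearMapAt hpT]
  rw [h2, hd]
  simp [h3]

/-! ### Gradients -/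

lemma Metric.fieldOn (g : Metric m W) {r : WithTop ℕ∞} (hr : r ≤ ∞) {S : Set W}
    {Z Z' : ∀ x : W, TangentSpace (𝓡 m) x} (hZ : FieldOn r S Z) (hZ' : FieldOn r S Z') :
    ContMDiffOn (𝓡 m) 𝓘(ℝ, ℝ) r (fun x => g.inner x (Z x) (Z' x)) S := by
  intro x hx
  have : ContMDiffWithinAt (𝓡 m) ((𝓡 m).prod 𝓘(ℝ, ℝ)) r
      (fun x => Bundle.TotalSpace.mk' ℝ (E := Bundle.Trivial W ℝ) x (g.inner x (Z x) (Z' x))) S x := by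
    apply ContMDiffWithinAt.clm_bundle_apply₂ (F₁ := EuclideanSpace ℝ (Fin m))
      (F₂ := EuclideanSpace ℝ (Fin m))
    · exact (g.contMDiff.of_le hr).contMDiffAt.contMDiffWithinAt
    · exact hZ x hx
    · exact hZ' x hx
  simp only [Bundle.contMDiffWithinAt_totalSpace] at this
  exact this.2

/-- A smooth form has a smooth gradient near every point. -/
lemma exists_gradient (g : Metric m W) {O : Set W} (hO : IsOpen O) {p : W} (hp : p ∈ O)
    {α : ∀ x : W, TangentSpace (𝓡 m) x →L[ℝ] ℝ} (hα : SmoothForm O α) :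
    ∃ (O' : Set W) (Y : ∀ x : W, TangentSpace (𝓡 m) x), IsOpen O' ∧ p ∈ O' ∧ O' ⊆ O ∧
      FieldOn ∞ O' Y ∧ ∀ x ∈ O', ∀ w, g.inner x (Y x) w = α x w := by
  classical
  obtain ⟨A, b, hA, hpA, hb, hli, hspan⟩ := exists_frame (m := m) p
  let G : W → Matrix (Fin m) (Fin m) ℝ := fun x => Matrix.of fun i j => g.inner x (b i x) (b j x)
  have hG : ∀ i j, ContMDiffOn (𝓡 m) 𝓘(ℝ, ℝ) ∞ (fun x => G x i j) A := fun i j =>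
    g.fieldOn le_rfl (hb i) (hb j)
  -- a vector in the kernel of the Gram matrix `G` would be orthogonal to itself
  have hdet : ∀ x ∈ A, (G x).det ≠ 0 := by
    intro x hx h0
    obtain ⟨a, ha, ha0⟩ := Matrix.exists_vecMul_eq_zero_iff.2 h0
    set u : TangentSpace (𝓡 m) x := ∑ i, a i • b i x with hu
    have h1 : ∀ k, g.inner x u (b k x) = 0 := fun k => by
      have := congrFun ha0 k
      simpa [hu, Matrix.vecMul, dotProduct, G, sum_apply] using this
    have h2 : g.inner x u u = 0 := by
      conv_lhs => rw [hu, map_sum]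
      simp [← hu, h1]
    have h3 : u = 0 := by
      by_contra h
      exact (g.pos x u h).ne' h2
    exact ha (funext fun i => Fintype.linearIndependent_iff.1 (hli x hx) a h3 i)
  refine ⟨O ∩ A, fun x => ∑ i, (∑ j, α x (b j x) * (G x)⁻¹ j i) • b i x, hO.inter hA, ⟨hp, hpA⟩,
    Set.inter_subset_left, ?_, ?_⟩
  · refine FieldOn.sum fun i _ => FieldOn.smul (contMDiffOn_finsetSum fun j _ => ?_)
      ((hb i).mono Set.inter_subset_right)
    exact (hα.apply le_rfl Set.inter_subset_left ((hb j).mono Set.inter_subset_right)).mul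
      ((contMDiffOn_matrix_inv hG hdet j i).mono Set.inter_subset_right)
  · intro x hx w
    have key : ∀ k, g.inner x (∑ i, (∑ j, α x (b j x) * (G x)⁻¹ j i) • b i x) (b k x) =
        α x (b k x) := by
      intro k
      have h1 : (G x)⁻¹ * G x = 1 := Matrix.nonsing_inv_mul _ (isUnit_iff_ne_zero.2 (hdet x hx.2))
      calc g.inner x (∑ i, (∑ j, α x (b j x) * (G x)⁻¹ j i) • b i x) (b k x)
          = ∑ i, (∑ j, α x (b j x) * (G x)⁻¹ j i) * G x i k := by
            simp [G]
        _ = ∑ j, α x (b j x) * ((G x)⁻¹ * G x) j k := by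
            simp only [Finset.sum_mul, Matrix.mul_apply, Finset.mul_sum]
            rw [Finset.sum_comm]
            simp only [mul_assoc]
        _ = α x (b k x) := by simp [h1, Matrix.one_apply]
    have hw : w ∈ Submodule.span ℝ (Set.range fun i => b i x) := by rw [hspan x hx.2]; trivial
    induction hw using Submodule.span_induction with
    | mem y hy => obtain ⟨k, rfl⟩ := hy; exact key k
    | zero => simp
    | add y z _ _ h1 h2 => rw [map_add, map_add, h1, h2]
    | smul a y _ h1 => rw [map_smul, map_smul, h1]

/-! ### Local frames of distributions -/

variable {n : ℕ} {ζ : ∀ x : W, Submodule ℝ (TangentSpace (𝓡 m) x)}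

/-- A smooth frame `e` of the distribution `ζ` over the open set `O`, with smooth forms `κ` which
restrict to the dual frame of `ζ`. -/
structure LocalFrame (n : ℕ) (ζ : ∀ x : W, Submodule ℝ (TangentSpace (𝓡 m) x)) (O : Set W) where
  e : Fin n → ∀ x : W, ζ x
  κ : Fin n → ∀ x : W, TangentSpace (𝓡 m) x →L[ℝ] ℝ
  isOpen : IsOpen O
  e_smooth : ∀ i, FieldOn ∞ O (fun x => (e i x : TangentSpace (𝓡 m) x))
  κ_smooth : ∀ i, SmoothForm O (κ i)
  dual : ∀ x ∈ O, ∀ i j, κ i x (e j x : TangentSpace (𝓡 m) x) = if i = j then 1 else 0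
  expand : ∀ x ∈ O, ∀ z : ζ x, z = ∑ i, κ i x (z : TangentSpace (𝓡 m) x) • e i x

/-- A smooth frame of a distribution becomes a `LocalFrame` after its domain is shrunk. -/
lemma exists_localFrame_of_frame {A : Set W} (hA : IsOpen A) {p : W} (hp : p ∈ A)
    {e : Fin n → ∀ x : W, ζ x} (he : ∀ i, FieldOn ∞ A fun x => (e i x : TangentSpace (𝓡 m) x))
    (hli : LinearIndependent ℝ fun i => (e i p : TangentSpace (𝓡 m) p))
    (hspan : ∀ x ∈ A, ∀ z : ζ x, ∃ a : Fin n → ℝ, z = ∑ i, a i • e i x) :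
    ∃ (O : Set W) (L : LocalFrame n ζ O), p ∈ O ∧ O ⊆ A ∧ L.e = e := by
  classical
  obtain ⟨O, κ, hO, hpO, hOA, hκ, hdual⟩ := exists_coframe hA hp he hli
  refine ⟨O, ⟨e, κ, hO, fun i => (he i).mono hOA, hκ, hdual, fun x hx z => ?_⟩, hpO, hOA, rfl⟩
  obtain ⟨a, ha⟩ := hspan x (hOA hx) z
  have hκz : ∀ i, κ i x (z : TangentSpace (𝓡 m) x) = a i := fun i => by
    rw [ha]; simp [hdual x hx]
  simp only [hκz, ← ha]

lemma IsDistributionOn.exists_localFrame {N : Set W} (hζ : IsDistributionOn n N ζ) {p : W}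
    (hp : p ∈ N) {N' : Set W} (hN' : IsOpen N') (hpN' : p ∈ N') :
    ∃ (O : Set W) (_ : LocalFrame n ζ O), p ∈ O ∧ O ⊆ N' := by
  classical
  obtain ⟨A, hA, hpA, e, he, hspan⟩ := hζ p hp
  have hmem : ∀ x ∈ A, ∀ i, e i x ∈ ζ x := fun x hx i => by
    rw [← (hspan x hx).2]; exact Submodule.subset_span ⟨i, rfl⟩
  -- outside of `A` the fields `e i` need not be sections of `ζ`
  let e' : Fin n → ∀ x : W, ζ x := fun i x => if h : e i x ∈ ζ x then ⟨e i x, h⟩ else 0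
  have he' : ∀ x ∈ A, ∀ i, (e' i x : TangentSpace (𝓡 m) x) = e i x := fun x hx i => by
    simp [e', hmem x hx i]
  obtain ⟨O, L, hpO, hO, -⟩ := exists_localFrame_of_frame (ζ := ζ) (hA.inter hN') ⟨hpA, hpN'⟩
    (e := e') (fun i => (FieldOn.mono (he i) Set.inter_subset_left).congr
      fun x hx => he' x hx.1 i) (by simpa only [he' p hpA] using (hspan p hpA).1) fun x hx z => by
        have hz : (z : TangentSpace (𝓡 m) x) ∈ Submodule.span ℝ (Set.range fun i => e i x) := by
          rw [(hspan x hx.1).2]; exact z.2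
        obtain ⟨a, ha⟩ := (Submodule.mem_span_range_iff_exists_fun ℝ).1 hz
        exact ⟨a, Subtype.ext (by simp [he' x hx.1, ha])⟩
  exact ⟨O, L, hpO, fun x hx => (hO hx).2⟩

namespace LocalFrame

variable {O : Set W} (L : LocalFrame n ζ O)

/-- The restriction of a frame to a smaller open set. -/
def restrict {O' : Set W} (hO' : IsOpen O') (h : O' ⊆ O) : LocalFrame n ζ O' where
  e := L.e
  κ := L.κ
  isOpen := hO'
  e_smooth i := (L.e_smooth i).mono h
  κ_smooth i := (L.κ_smooth i).mono h
  dual x hx := L.dual x (h hx)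
  expand x hx := L.expand x (h hx)

lemma expand_coe {x : W} (hx : x ∈ O) (z : ζ x) : (z : TangentSpace (𝓡 m) x) =
    ∑ i, L.κ i x (z : TangentSpace (𝓡 m) x) • (L.e i x : TangentSpace (𝓡 m) x) := by
  have := congrArg (Subtype.val) (L.expand x hx z)
  simpa using this

lemma linearIndependent {x : W} (hx : x ∈ O) : LinearIndependent ℝ fun i => L.e i x := by
  rw [Fintype.linearIndependent_iff]
  intro a ha i
  have := congrArg (fun z : ζ x => L.κ i x (z : TangentSpace (𝓡 m) x)) ha
  simpa [L.dual x hx] using this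

/-- The frame as a basis of the fibre. -/
noncomputable def basis {x : W} (hx : x ∈ O) : Module.Basis (Fin n) ℝ (ζ x) :=
  Module.Basis.mk (L.linearIndependent hx)
    (by
      intro z _
      rw [L.expand x hx z]
      exact Submodule.sum_mem _ fun i _ => Submodule.smul_mem _ _ (Submodule.subset_span ⟨i, rfl⟩))

@[simp] lemma basis_apply {x : W} (hx : x ∈ O) (i : Fin n) : L.basis hx i = L.e i x := by
  simp [basis]

lemma basis_repr {x : W} (hx : x ∈ O) (z : ζ x) (i : Fin n) :
    (L.basis hx).repr z i = L.κ i x (z : TangentSpace (𝓡 m) x) := by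
  conv_lhs => rw [L.expand x hx z]
  simp only [← L.basis_apply hx, map_sum, map_smul, Module.Basis.repr_self]
  simp [Finsupp.single_apply]

lemma coeff_contMDiffOn {r : WithTop ℕ∞} (hr : r ≤ ∞) {S : Set W} (hS : S ⊆ O) {Z : ∀ x : W, ζ x}
    (hZ : FieldOn r S fun x => (Z x : TangentSpace (𝓡 m) x)) (i : Fin n) :
    ContMDiffOn (𝓡 m) 𝓘(ℝ, ℝ) r (fun x => L.κ i x (Z x : TangentSpace (𝓡 m) x)) S :=
  (L.κ_smooth i).apply hr hS hZ

lemma hom_fieldOn {T : Set W} {A : ∀ x : W, ζ x →ₗ[ℝ] TangentSpace (𝓡 m) x} {r : WithTop ℕ∞}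
    (hr : r ≤ ∞) (hA : ∀ i, FieldOn r (T ∩ O) fun x => A x (L.e i x)) {S : Set W} (hS : S ⊆ T ∩ O)
    {Z : ∀ x : W, ζ x} (hZ : FieldOn r S fun x => (Z x : TangentSpace (𝓡 m) x)) :
    FieldOn r S fun x => A x (Z x) := by
  have h : FieldOn r S fun x => ∑ i, L.κ i x (Z x : TangentSpace (𝓡 m) x) • A x (L.e i x) :=
    FieldOn.sum fun i _ => FieldOn.smul (L.coeff_contMDiffOn hr (fun x hx => (hS hx).2) hZ i)
      ((hA i).mono hS)
  refine h.congr fun x hx => ?_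
  conv_lhs => rw [L.expand x (hS hx).2 (Z x)]
  simp only [map_sum, map_smul]

lemma bilin_contMDiffOn {T : Set W} {B : ∀ x : W, ζ x →ₗ[ℝ] ζ x →ₗ[ℝ] ℝ} {r : WithTop ℕ∞}
    (hr : r ≤ ∞)
    (hB : ∀ i j, ContMDiffOn (𝓡 m) 𝓘(ℝ, ℝ) r (fun x => B x (L.e i x) (L.e j x)) (T ∩ O))
    {S : Set W} (hS : S ⊆ T ∩ O) {Z Z' : ∀ x : W, ζ x}
    (hZ : FieldOn r S fun x => (Z x : TangentSpace (𝓡 m) x))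
    (hZ' : FieldOn r S fun x => (Z' x : TangentSpace (𝓡 m) x)) :
    ContMDiffOn (𝓡 m) 𝓘(ℝ, ℝ) r (fun x => B x (Z x) (Z' x)) S := by
  have h : ContMDiffOn (𝓡 m) 𝓘(ℝ, ℝ) r (fun x => ∑ i, ∑ j,
      L.κ i x (Z x : TangentSpace (𝓡 m) x) * (L.κ j x (Z' x : TangentSpace (𝓡 m) x) *
        B x (L.e i x) (L.e j x))) S :=
    contMDiffOn_finsetSum fun i _ => contMDiffOn_finsetSum fun j _ =>
      (L.coeff_contMDiffOn hr (fun x hx => (hS hx).2) hZ i).mul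
      ((L.coeff_contMDiffOn hr (fun x hx => (hS hx).2) hZ' j).mul ((hB i j).mono hS))
  refine h.congr fun x hx => ?_
  conv_lhs => rw [L.expand x (hS hx).2 (Z x), L.expand x (hS hx).2 (Z' x)]
  simp only [map_sum, map_smul, LinearMap.sum_apply, LinearMap.smul_apply, smul_eq_mul,
    Finset.mul_sum]
  rw [Finset.sum_comm]
  exact Finset.sum_congr rfl fun i _ => Finset.sum_congr rfl fun j _ => by ring

end LocalFrame

/-- A homomorphism which maps smooth sections over open sets to smooth fields maps sections of
class `C^r` along arbitrary subsets to fields of class `C^r`. -/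
lemma IsDistributionOn.hom_fieldOn {N : Set W} (hζ : IsDistributionOn n N ζ) {T : Set W}
    (hT : T ⊆ N) {A : ∀ x : W, ζ x →ₗ[ℝ] TangentSpace (𝓡 m) x}
    (hA : ∀ (Z : ∀ x : W, ζ x) (O : Set W), IsOpen O →
      SmoothFieldOn O (fun x => (Z x : TangentSpace (𝓡 m) x)) →
      SmoothFieldOn (T ∩ O) (fun x => A x (Z x)))
    {r : WithTop ℕ∞} (hr : r ≤ ∞) {S : Set W} (hS : S ⊆ T) {Z : ∀ x : W, ζ x}
    (hZ : FieldOn r S fun x => (Z x : TangentSpace (𝓡 m) x)) :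
    FieldOn r S fun x => A x (Z x) := by
  refine FieldOn.of_locally fun p hp => ?_
  obtain ⟨O, L, hpO, -⟩ := hζ.exists_localFrame (hT (hS hp)) isOpen_univ (Set.mem_univ p)
  exact ⟨O, L.isOpen, hpO, L.hom_fieldOn hr
    (fun i => FieldOn.of_le (hA (L.e i) O L.isOpen (L.e_smooth i)) hr)
    (fun x hx => ⟨hS hx.1, hx.2⟩) (hZ.mono Set.inter_subset_left)⟩

namespace FLIFData

variable {Φ : FLIFData ζ}

/-! ### The zero set of a FLIF and the isomorphism `Γ` -/

lemma V_subset_dom : Φ.V ⊆ Φ.dom := fun _ hx => hx.1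

/-- The coefficient functions of the section `Φ1` in a frame of `ζ`: local equations of `V`. -/
noncomputable def coeff {O : Set W} (L : LocalFrame n ζ O) (Φ : FLIFData ζ) (i : Fin n) (x : W) : ℝ :=
  L.κ i x (Φ.Φ1 x : TangentSpace (𝓡 m) x)

namespace IsFLIF

variable (hΦ : Φ.IsFLIF n)
include hΦ

lemma exists_localFrame {p : W} (hp : p ∈ Φ.dom) :
    ∃ (O : Set W) (_ : LocalFrame n ζ O), p ∈ O ∧ O ⊆ Φ.dom :=
  hΦ.distribution.exists_localFrame hp hΦ.isOpen_dom hp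

lemma coeff_smooth {O : Set W} (L : LocalFrame n ζ O) (hO : O ⊆ Φ.dom) (i : Fin n) :
    ContMDiffOn (𝓡 m) 𝓘(ℝ, ℝ) ∞ (coeff L Φ i) O :=
  L.coeff_contMDiffOn le_rfl subset_rfl (FieldOn.mono hΦ.Φ1_smooth hO) i

omit hΦ in
lemma mem_V_iff {O : Set W} (L : LocalFrame n ζ O) (hO : O ⊆ Φ.dom) {x : W} (hx : x ∈ O) :
    x ∈ Φ.V ↔ ∀ i, coeff L Φ i x = 0 := by
  refine ⟨fun h i => by rw [coeff, h.2]; simp, fun h => ⟨hO hx, ?_⟩⟩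
  rw [L.expand x hx (Φ.Φ1 x)]
  exact Finset.sum_eq_zero fun i _ => by
    rw [show L.κ i x (Φ.Φ1 x : TangentSpace (𝓡 m) x) = 0 from h i, zero_smul]

/-- Over `V` the homomorphism `Γ̂` is `∑ dfᵢ ⊗ eᵢ`, where `Φ1 = ∑ fᵢ eᵢ`. -/
lemma gammaHat_eq {O : Set W} (L : LocalFrame n ζ O) (hO : O ⊆ Φ.dom) {x : W} (hx : x ∈ O)
    (hxV : x ∈ Φ.V) (w : TangentSpace (𝓡 m) x) : Φ.gammaHat x w =
      ∑ i, mvfderiv (𝓡 m) (coeff L Φ i) x w • (L.e i x : TangentSpace (𝓡 m) x) :=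
  linearization_sum L.isOpen hx (fun i => hΦ.coeff_smooth L hO i)
    ((mem_V_iff L hO hx).1 hxV) L.e_smooth (fun y hy => L.expand_coe hy (Φ.Φ1 y)) w

lemma gammaHat_mem {x : W} (hx : x ∈ Φ.V) (w : TangentSpace (𝓡 m) x) : Φ.gammaHat x w ∈ ζ x := by
  obtain ⟨O, L, hxO, hO⟩ := hΦ.exists_localFrame hx.1
  rw [hΦ.gammaHat_eq L hO hxO hx]
  exact Submodule.sum_mem _ fun i _ => Submodule.smul_mem _ _ (L.e i x).2

lemma coeff_surjective {O : Set W} (L : LocalFrame n ζ O) (hO : O ⊆ Φ.dom) {x : W} (hx : x ∈ O)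
    (hxV : x ∈ Φ.V) (a : Fin n → ℝ) : ∃ w, ∀ i, mvfderiv (𝓡 m) (coeff L Φ i) x w = a i := by
  obtain ⟨w, hw⟩ := hΦ.Φ1_transverse x hxV _ (∑ i, a i • L.e i x).2
  refine ⟨w, fun i => ?_⟩
  rw [hΦ.gammaHat_eq L hO hx hxV] at hw
  have := congrArg (L.κ i x) hw
  simpa [L.dual x hx] using this

lemma gammaHat_eq_zero_iff {O : Set W} (L : LocalFrame n ζ O) (hO : O ⊆ Φ.dom) {x : W}
    (hx : x ∈ O) (hxV : x ∈ Φ.V) (w : TangentSpace (𝓡 m) x) :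
    Φ.gammaHat x w = 0 ↔ ∀ i, mvfderiv (𝓡 m) (coeff L Φ i) x w = 0 := by
  rw [hΦ.gammaHat_eq L hO hx hxV]
  refine ⟨fun h i => ?_, fun h => Finset.sum_eq_zero fun i _ => by rw [h i, zero_smul]⟩
  have := congrArg (L.κ i x) h
  simpa [L.dual x hx] using this

/-- The tangent space of `V` is the kernel of `Γ̂`. -/
lemma mem_tangentTo_iff {x : W} (hx : x ∈ Φ.V) (w : TangentSpace (𝓡 m) x) :
    w ∈ tangentTo Φ.V x ↔ Φ.gammaHat x w = 0 := by
  obtain ⟨O, L, hxO, hO⟩ := hΦ.exists_localFrame hx.1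
  have hOx : O ∈ 𝓝 x := L.isOpen.mem_nhds hxO
  constructor
  · intro h
    induction h using Submodule.span_induction with
    | mem y hy =>
      obtain ⟨c, hc⟩ := hy
      rw [hΦ.gammaHat_eq_zero_iff L hO hxO hx]
      intro i
      have h1 := hc.hasDerivAt_comp (((hΦ.coeff_smooth L hO i).contMDiffAt hOx).mdifferentiableAt
        (by simp))
      have hcO : ∀ᶠ t in 𝓝 (0 : ℝ), c t ∈ O :=
        hc.smooth.continuousAt.eventually_mem (by rwa [hc.left_eq])
      have h2 : (fun t => coeff L Φ i (c t)) =ᶠ[𝓝 0] fun _ => (0 : ℝ) := by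
        filter_upwards [hc.mem, hcO] with t ht htO using (mem_V_iff L hO htO).1 ht i
      exact h1.unique ((hasDerivAt_const (0 : ℝ) (0 : ℝ)).congr_of_eventuallyEq h2)
    | zero => exact map_zero _
    | add y z _ _ h1 h2 => rw [map_add, h1, h2, add_zero]
    | smul a y _ h1 => rw [map_smul, h1, smul_zero]
  · intro h
    obtain ⟨c, hc⟩ := exists_isCurveIn (fun i => (hΦ.coeff_smooth L hO i).contMDiffAt hOx)
      ((mem_V_iff L hO hxO).1 hx) (hΦ.coeff_surjective L hO hxO hx) w
      ((hΦ.gammaHat_eq_zero_iff L hO hxO hx w).1 h)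
    have hcO : ∀ᶠ t in 𝓝 (0 : ℝ), c t ∈ O :=
      hc.smooth.continuousAt.eventually_mem (by rwa [hc.left_eq])
    refine Submodule.subset_span ⟨c, hc.smooth, ?_, hc.velocity_eq⟩
    filter_upwards [hc.mem, hcO] with t ht htO using (mem_V_iff L hO htO).2 ht

lemma gammaHat_fieldOn {r : WithTop ℕ∞} (hr : r ≤ ∞) {S : Set W} (hS : S ⊆ Φ.V)
    {Z : ∀ x : W, TangentSpace (𝓡 m) x} (hZ : FieldOn r S Z) :
    FieldOn r S fun x => Φ.gammaHat x (Z x) := by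
  refine FieldOn.of_locally fun p hp => ?_
  obtain ⟨O, L, hpO, hO⟩ := hΦ.exists_localFrame (hS hp).1
  refine ⟨O, L.isOpen, hpO, ?_⟩
  have h : FieldOn r (S ∩ O) fun x => ∑ i, mvfderiv (𝓡 m) (coeff L Φ i) x (Z x) •
      (L.e i x : TangentSpace (𝓡 m) x) :=
    FieldOn.sum fun i _ => FieldOn.smul
      ((smoothForm_mvfderiv L.isOpen (hΦ.coeff_smooth L hO i)).apply hr Set.inter_subset_right
        (hZ.mono Set.inter_subset_left))
      (((L.e_smooth i).mono Set.inter_subset_right).of_le hr)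
  exact h.congr fun x hx => hΦ.gammaHat_eq L hO hx.2 (hS hx.1) _

lemma eq_zero_of_mem_norm (g : Metric m W) {x : W} (hx : x ∈ Φ.V) {w : TangentSpace (𝓡 m) x}
    (hw : w ∈ Φ.Norm g x) (h0 : Φ.gammaHat x w = 0) : w = 0 := by
  by_contra h
  exact (g.pos x w h).ne' (hw w ((hΦ.mem_tangentTo_iff hx w).2 h0))

lemma gammaInv_eq (g : Metric m W) {x : W} (hx : x ∈ Φ.V) {w : TangentSpace (𝓡 m) x}
    (hw : w ∈ Φ.Norm g x) {z : ζ x} (hz : Φ.gammaHat x w = z) : Φ.gammaInv g x z = w := by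
  have hker : LinearMap.ker ((Φ.gammaHat x).toLinearMap.domRestrict (Φ.Norm g x)) = ⊥ := by
    rw [LinearMap.ker_eq_bot']
    exact fun u hu => Subtype.ext (hΦ.eq_zero_of_mem_norm g hx u.2 hu)
  have := LinearMap.leftInverse_apply_of_inj hker ⟨w, hw⟩
  rw [gammaInv, ← hz]
  exact congrArg Subtype.val this

/-- Near a point of `V`, the vector `Γ⁻¹ z` is the combination of the gradients of the local
equations `fᵢ` of `V` whose coefficients are obtained from those of `z` by the inverse of the
matrix `dfᵢ(∇fⱼ)`. -/
lemma exists_gammaInv_frame (g : Metric m W) {p : W} (hp : p ∈ Φ.V) :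
    ∃ (O : Set W) (L : LocalFrame n ζ O) (Y : Fin n → ∀ x : W, TangentSpace (𝓡 m) x)
      (B : Fin n → Fin n → W → ℝ), p ∈ O ∧ O ⊆ Φ.dom ∧ (∀ j, FieldOn ∞ O (Y j)) ∧
      (∀ i j, ContMDiffOn (𝓡 m) 𝓘(ℝ, ℝ) ∞ (B i j) (Φ.V ∩ O)) ∧
      ∀ x ∈ Φ.V ∩ O, ∀ z : ζ x, ∃ w ∈ Φ.Norm g x, Φ.gammaHat x w = z ∧
        w = ∑ j, (∑ i, B j i x * L.κ i x (z : TangentSpace (𝓡 m) x)) • Y j x := by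
  classical
  obtain ⟨O, L, hpO, hO⟩ := hΦ.exists_localFrame hp.1
  have hform : ∀ i, SmoothForm O (fun x => mvfderiv (𝓡 m) (coeff L Φ i) x) := fun i =>
    smoothForm_mvfderiv L.isOpen (hΦ.coeff_smooth L hO i)
  choose A Y hA hpA hAO hY hgrad using fun i => exists_gradient g L.isOpen hpO (hform i)
  set O₁ : Set W := O ∩ ⋂ i, A i
  have hO₁ : IsOpen O₁ := L.isOpen.inter (isOpen_iInter_of_finite hA)
  have hO₁O : O₁ ⊆ O := Set.inter_subset_left
  have hO₁A : ∀ i, O₁ ⊆ A i := fun i x hx => Set.mem_iInter.1 hx.2 i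
  let H : W → Matrix (Fin n) (Fin n) ℝ := fun x =>
    Matrix.of fun i j => mvfderiv (𝓡 m) (coeff L Φ i) x (Y j x)
  have hH : ∀ i j, ContMDiffOn (𝓡 m) 𝓘(ℝ, ℝ) ∞ (fun x => H x i j) O₁ := fun i j =>
    (hform i).apply le_rfl hO₁O ((hY j).mono (hO₁A j))
  -- a combination of the gradients which is annihilated by all `dfᵢ` is orthogonal to itself
  have hdet : ∀ x ∈ Φ.V ∩ O₁, (H x).det ≠ 0 := by
    intro x hx h0
    obtain ⟨b, hb, hb0⟩ := Matrix.exists_mulVec_eq_zero_iff.2 h0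
    set u : TangentSpace (𝓡 m) x := ∑ j, b j • Y j x with hu
    have h1 : ∀ i, mvfderiv (𝓡 m) (coeff L Φ i) x u = 0 := fun i => by
      have := congrFun hb0 i
      rw [hu, map_sum]
      simpa [Matrix.mulVec, dotProduct, H, mul_comm] using this
    have h2 : ∀ w, g.inner x u w = ∑ j, b j * mvfderiv (𝓡 m) (coeff L Φ j) x w := fun w => by
      rw [hu, map_sum]
      simp [sum_apply, hgrad _ x (hO₁A _ hx.2)]
    have h3 : u = 0 := by
      by_contra h
      refine (g.pos x u h).ne' ?_
      rw [h2]; simp [h1]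
    refine hb (funext fun i => ?_)
    obtain ⟨w, hw⟩ := hΦ.coeff_surjective L hO (hO₁O hx.2) hx.1 (Pi.single i 1)
    have := h2 w
    rw [h3, map_zero] at this
    simpa [hw, Pi.single_apply] using this.symm
  refine ⟨O₁, L.restrict hO₁ hO₁O, Y, fun j i x => (H x)⁻¹ j i, ⟨hpO, Set.mem_iInter.2 hpA⟩,
    hO₁O.trans hO, fun j => (hY j).mono (hO₁A j), fun i j => ?_, fun x hx z => ?_⟩
  · exact contMDiffOn_matrix_inv (fun i j => (hH i j).mono Set.inter_subset_right) hdet i j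
  · refine ⟨_, ?_, ?_, rfl⟩
    · intro u hu
      have h1 : ∀ j, g.inner x u (Y j x) = 0 := fun j => by
        rw [g.symm, hgrad j x (hO₁A j hx.2)]
        exact (hΦ.gammaHat_eq_zero_iff L hO (hO₁O hx.2) hx.1 u).1
          ((hΦ.mem_tangentTo_iff hx.1 u).1 hu) j
      simp [h1]
    · rw [hΦ.gammaHat_eq L hO (hO₁O hx.2) hx.1]
      conv_rhs => rw [L.expand_coe (hO₁O hx.2) z]
      refine Finset.sum_congr rfl fun i _ => ?_
      congr 1
      have h1 : H x * (H x)⁻¹ = 1 := Matrix.mul_nonsing_inv _ (isUnit_iff_ne_zero.2 (hdet x hx))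
      set a : Fin n → ℝ := fun i => L.κ i x (z : TangentSpace (𝓡 m) x) with ha
      have h2 : (H x).mulVec ((H x)⁻¹.mulVec a) = a := by
        rw [Matrix.mulVec_mulVec, h1, Matrix.one_mulVec]
      have h3 := congrFun h2 i
      simp only [Matrix.mulVec, dotProduct] at h3
      rw [map_sum]
      simp only [map_smul, smul_eq_mul]
      refine Eq.trans ?_ h3
      exact Finset.sum_congr rfl fun j _ => mul_comm _ _

lemma gammaInv_spec (g : Metric m W) {x : W} (hx : x ∈ Φ.V) (z : ζ x) :
    Φ.gammaInv g x z ∈ Φ.Norm g x ∧ Φ.gammaHat x (Φ.gammaInv g x z) = z := by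
  obtain ⟨O, L, Y, B, hxO, -, -, -, h⟩ := hΦ.exists_gammaInv_frame g hx
  obtain ⟨w, hw, hwz, -⟩ := h x ⟨hx, hxO⟩ z
  rw [hΦ.gammaInv_eq g hx hw hwz]
  exact ⟨hw, hwz⟩

lemma gammaInv_fieldOn (g : Metric m W) {r : WithTop ℕ∞} (hr : r ≤ ∞) {S : Set W} (hS : S ⊆ Φ.V)
    {Z : ∀ x : W, ζ x} (hZ : FieldOn r S fun x => (Z x : TangentSpace (𝓡 m) x)) :
    FieldOn r S fun x => Φ.gammaInv g x (Z x) := by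
  refine FieldOn.of_locally fun p hp => ?_
  obtain ⟨O, L, Y, B, hpO, -, hY, hB, h⟩ := hΦ.exists_gammaInv_frame g (hS hp)
  have hSO : S ∩ O ⊆ Φ.V ∩ O := fun x hx => ⟨hS hx.1, hx.2⟩
  refine ⟨O, L.isOpen, hpO, FieldOn.congr (Z := fun x => ∑ j, (∑ i, B j i x *
    L.κ i x (Z x : TangentSpace (𝓡 m) x)) • Y j x) (FieldOn.sum fun j _ => FieldOn.smul
      (contMDiffOn_finsetSum fun i _ => (((hB j i).of_le hr).mono hSO).mul
        (L.coeff_contMDiffOn hr Set.inter_subset_right (hZ.mono Set.inter_subset_left) i))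
      (((hY j).mono Set.inter_subset_right).of_le hr)) fun x hx => ?_⟩
  obtain ⟨w, hw, hwz, hwe⟩ := h x (hSO hx) (Z x)
  rw [hΦ.gammaInv_eq g (hS hx.1) hw hwz, hwe]

lemma Φ2_fieldOn {r : WithTop ℕ∞} (hr : r ≤ ∞) {S : Set W} (hS : S ⊆ Φ.V)
    {Z : ∀ x : W, ζ x} (hZ : FieldOn r S fun x => (Z x : TangentSpace (𝓡 m) x)) :
    FieldOn r S fun x => (Φ.Φ2 x (Z x) : TangentSpace (𝓡 m) x) :=
  hΦ.distribution.hom_fieldOn V_subset_dom (A := fun x => (ζ x).subtype ∘ₗ Φ.Φ2 x)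
    hΦ.Φ2_smooth hr hS hZ

lemma metric_contMDiffOn {r : WithTop ℕ∞} (hr : r ≤ ∞) {S : Set W} (hS : S ⊆ Φ.dom)
    {Z Z' : ∀ x : W, ζ x} (hZ : FieldOn r S fun x => (Z x : TangentSpace (𝓡 m) x))
    (hZ' : FieldOn r S fun x => (Z' x : TangentSpace (𝓡 m) x)) :
    ContMDiffOn (𝓡 m) 𝓘(ℝ, ℝ) r (fun x => Φ.metric x (Z x) (Z' x)) S := by
  refine contMDiffOn_of_locally_contMDiffOn fun p hp => ?_
  obtain ⟨O, L, hpO, -⟩ := hΦ.exists_localFrame (hS hp)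
  exact ⟨O, L.isOpen, hpO, L.bilin_contMDiffOn hr
    (fun i j => (hΦ.metric_smooth (L.e i) (L.e j) O L.isOpen (L.e_smooth i) (L.e_smooth j)).of_le hr)
    (fun x hx => ⟨hS hx.1, hx.2⟩) (hZ.mono Set.inter_subset_left)
    (hZ'.mono Set.inter_subset_left)⟩

end IsFLIF

end FLIFData

/-! ### The push-forward of a FLIF -/

section rangeInv

variable {F : ∀ x : W, ζ x →ₗ[ℝ] TangentSpace (𝓡 m) x}

lemma rangeInv_rangeRestrict {x : W} (h : Function.Injective (F x)) (z : ζ x) :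
    rangeInv F x ((F x).rangeRestrict z) = z :=
  LinearMap.leftInverse_apply_of_inj (LinearMap.ker_eq_bot.2 h) z

lemma rangeRestrict_rangeInv {x : W} (h : Function.Injective (F x)) (y : LinearMap.range (F x)) :
    (F x).rangeRestrict (rangeInv F x y) = y := by
  obtain ⟨_, z, rfl⟩ := y
  exact congrArg _ (rangeInv_rangeRestrict h z)

lemma rangeInv_injective {x : W} (h : Function.Injective (F x)) :
    Function.Injective (rangeInv F x) :=
  Function.LeftInverse.injective (g := (F x).rangeRestrict) (rangeRestrict_rangeInv h)

/-- The isomorphism `F : ζ → F(ζ)`. -/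
noncomputable def rangeEquiv {x : W} (h : Function.Injective (F x)) :
    ζ x ≃ₗ[ℝ] LinearMap.range (F x) :=
  LinearEquiv.ofLinearMap (F x).rangeRestrict (rangeInv F x)
    (LinearMap.ext (rangeRestrict_rangeInv h)) (LinearMap.ext (rangeInv_rangeRestrict h))

end rangeInv

namespace FLIFData

variable {Φ : FLIFData ζ} {N : Set W} {F : ∀ x : W, ζ x →ₗ[ℝ] TangentSpace (𝓡 m) x}

lemma push_V (hVN : Φ.V ⊆ N) (hNdom : N ⊆ Φ.dom) (hF : IsBundleMonoOn N F) :
    (Φ.push N F).V = Φ.V := by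
  ext x
  constructor
  · rintro ⟨hx, h0⟩
    refine ⟨hNdom hx, hF.1 x hx ?_⟩
    rw [map_zero]
    exact congrArg Subtype.val h0
  · intro hx
    refine ⟨hVN hx, Subtype.ext ?_⟩
    change F x (Φ.Φ1 x) = 0
    rw [hx.2, map_zero]

lemma push_Φ2_apply {x : W} (h : Function.Injective (F x)) (z : ζ x) :
    (Φ.push N F).Φ2 x ((F x).rangeRestrict z) = (F x).rangeRestrict (Φ.Φ2 x z) := by
  change (F x).rangeRestrict (Φ.Φ2 x (rangeInv F x ((F x).rangeRestrict z))) = _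
  rw [rangeInv_rangeRestrict h]

lemma push_Φ2_eq_conj {x : W} (h : Function.Injective (F x)) :
    (Φ.push N F).Φ2 x = (rangeEquiv h).conj (Φ.Φ2 x) := rfl

lemma push_ker {x : W} (h : Function.Injective (F x)) :
    LinearMap.ker ((Φ.push N F).Φ2 x) =
      (LinearMap.ker (Φ.Φ2 x)).map (rangeEquiv h).toLinearMap := by
  ext y
  rw [push_Φ2_eq_conj h]
  simp only [LinearMap.mem_ker, Submodule.mem_map]
  constructor
  · intro hy
    refine ⟨(rangeEquiv h).symm y, ?_, (rangeEquiv h).apply_symm_apply y⟩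
    rw [LinearEquiv.conj_apply_apply] at hy
    exact (rangeEquiv h).map_eq_zero_iff.1 hy
  · rintro ⟨z, hz, rfl⟩
    rw [LinearEquiv.conj_apply_apply]
    simp [hz]

lemma push_Sig (hVN : Φ.V ⊆ N) (hNdom : N ⊆ Φ.dom) (hF : IsBundleMonoOn N F) :
    (Φ.push N F).Sig = Φ.Sig := by
  ext x
  change x ∈ (Φ.push N F).V ∧ _ ↔ x ∈ Φ.V ∧ _
  rw [push_V hVN hNdom hF]
  refine and_congr_right fun hx => ?_
  rw [push_ker (hF.1 x (hVN hx)), Ne, Ne, Submodule.map_eq_bot_iff]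

lemma push_index {x : W} (h : Function.Injective (F x)) :
    (Φ.push N F).index x = Φ.index x := by
  have h1 : ∀ μ : ℝ, Module.End.eigenspace ((Φ.push N F).Φ2 x) μ =
      (Module.End.eigenspace (Φ.Φ2 x) μ).map (rangeEquiv h).toLinearMap := by
    intro μ
    ext y
    rw [push_Φ2_eq_conj h]
    simp only [Module.End.mem_eigenspace_iff, Submodule.mem_map]
    constructor
    · intro hy
      refine ⟨(rangeEquiv h).symm y, ?_, (rangeEquiv h).apply_symm_apply y⟩
      rw [LinearEquiv.conj_apply_apply] at hy
      rw [← map_smul, ← hy, LinearEquiv.symm_apply_apply]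
    · rintro ⟨z, hz, rfl⟩
      rw [LinearEquiv.conj_apply_apply]
      simp [hz]
  rw [index, iSup_congr fun μ : {μ : ℝ // μ < 0} => h1 μ, ← Submodule.map_iSup]
  exact LinearEquiv.finrank_map_eq (rangeEquiv h) _

lemma IsFLIF.F_fieldOn (hΦ : Φ.IsFLIF n) (hNdom : N ⊆ Φ.dom)
    (hF : IsBundleMonoOn N F) {r : WithTop ℕ∞} (hr : r ≤ ∞) {S : Set W} (hS : S ⊆ N)
    {Z : ∀ x : W, ζ x} (hZ : FieldOn r S fun x => (Z x : TangentSpace (𝓡 m) x)) :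
    FieldOn r S fun x => F x (Z x) :=
  hΦ.distribution.hom_fieldOn hNdom hF.2 hr hS hZ

/-- Near every point of `N` there are a frame of `ζ` and the frame of `F(ζ)` which is its image. -/
lemma IsFLIF.exists_localFrame_push (hΦ : Φ.IsFLIF n) (hN : IsOpen N) (hNdom : N ⊆ Φ.dom)
    (hF : IsBundleMonoOn N F) {p : W} (hp : p ∈ N) :
    ∃ (O : Set W) (L : LocalFrame n ζ O)
      (L' : LocalFrame n (fun x => LinearMap.range (F x)) O), p ∈ O ∧ O ⊆ N ∧
      ∀ i x, L'.e i x = (F x).rangeRestrict (L.e i x) := by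
  obtain ⟨A, L, hpA, hAN⟩ := hΦ.distribution.exists_localFrame (hNdom hp) hN hp
  obtain ⟨O, L', hpO, hOA, hL'⟩ := exists_localFrame_of_frame
    (ζ := fun x => LinearMap.range (F x)) L.isOpen hpA
    (e := fun i x => (F x).rangeRestrict (L.e i x))
    (fun i => hΦ.F_fieldOn hNdom hF le_rfl hAN (L.e_smooth i))
    ((L.linearIndependent hpA).map' (F p) (LinearMap.ker_eq_bot.2 (hF.1 p hp)))
    (by
      rintro x hx ⟨_, z, rfl⟩
      refine ⟨fun i => L.κ i x (z : TangentSpace (𝓡 m) x), Subtype.ext ?_⟩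
      conv_lhs => rw [L.expand x hx z]
      simp)
  exact ⟨O, L.restrict L'.isOpen hOA, L', hpO, hOA.trans hAN, fun i x => by rw [hL']; rfl⟩

lemma IsFLIF.rangeInv_fieldOn (hΦ : Φ.IsFLIF n) (hN : IsOpen N) (hNdom : N ⊆ Φ.dom)
    (hF : IsBundleMonoOn N F) {r : WithTop ℕ∞} (hr : r ≤ ∞) {S : Set W} (hS : S ⊆ N)
    {Z : ∀ x : W, LinearMap.range (F x)} (hZ : FieldOn r S fun x => (Z x : TangentSpace (𝓡 m) x)) :
    FieldOn r S fun x => (rangeInv F x (Z x) : TangentSpace (𝓡 m) x) := by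
  refine FieldOn.of_locally fun p hp => ?_
  obtain ⟨O, L, L', hpO, hON, hL'⟩ := hΦ.exists_localFrame_push hN hNdom hF (hS hp)
  refine ⟨O, L.isOpen, hpO, L'.hom_fieldOn (T := N) (A := fun x => (ζ x).subtype ∘ₗ rangeInv F x) hr
    (fun i => ?_) (fun x hx => ⟨hS hx.1, hx.2⟩) (hZ.mono Set.inter_subset_left)⟩
  refine (((L.e_smooth i).of_le hr).mono Set.inter_subset_right).congr fun x hx => ?_
  rw [hL', LinearMap.comp_apply, rangeInv_rangeRestrict (hF.1 x hx.1)]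
  rfl

lemma IsFLIF.push_gammaHat (hΦ : Φ.IsFLIF n) (hN : IsOpen N) (hVN : Φ.V ⊆ N) (hNdom : N ⊆ Φ.dom)
    (hF : IsBundleMonoOn N F) {x : W} (hx : x ∈ Φ.V) (w : TangentSpace (𝓡 m) x) :
    (Φ.push N F).gammaHat x w = F x ⟨Φ.gammaHat x w, hΦ.gammaHat_mem hx w⟩ := by
  obtain ⟨O, L, L', hxO, hON, hL'⟩ := hΦ.exists_localFrame_push hN hNdom hF (hVN hx)
  have h1 : (Φ.push N F).gammaHat x w = ∑ i, mvfderiv (𝓡 m) (coeff L Φ i) x w •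
      (L'.e i x : TangentSpace (𝓡 m) x) := by
    refine linearization_sum L.isOpen hxO (fun i => hΦ.coeff_smooth L (hON.trans hNdom) i)
      ((IsFLIF.mem_V_iff L (hON.trans hNdom) hxO).1 hx) L'.e_smooth (fun y hy => ?_) w
    change F y (Φ.Φ1 y) = _
    conv_lhs => rw [L.expand y hy (Φ.Φ1 y)]
    simp [hL', coeff]
  have h2 : (⟨Φ.gammaHat x w, hΦ.gammaHat_mem hx w⟩ : ζ x) =
      ∑ i, mvfderiv (𝓡 m) (coeff L Φ i) x w • L.e i x := by
    apply Subtype.ext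
    simp [hΦ.gammaHat_eq L (hON.trans hNdom) hxO hx w]
  rw [h1, h2]
  simp [hL']

/-- The push-forward of a FLIF is a FLIF. -/
lemma IsFLIF.push (hΦ : Φ.IsFLIF n) (hN : IsOpen N) (hVN : Φ.V ⊆ N) (hNdom : N ⊆ Φ.dom)
    (hF : IsBundleMonoOn N F) : (Φ.push N F).IsFLIF n := by
  have hV := push_V hVN hNdom hF
  have hS := push_Sig hVN hNdom hF
  have hinj : ∀ x ∈ Φ.V, Function.Injective (F x) := fun x hx => hF.1 x (hVN hx)
  have hSV : Φ.Sig ⊆ Φ.V := fun x hx => hx.1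
  constructor
  · exact hN
  · intro p hp
    obtain ⟨O, L, L', hpO, hON, hL'⟩ := hΦ.exists_localFrame_push hN hNdom hF hp
    refine ⟨O, L.isOpen, hpO, fun i x => L'.e i x, L'.e_smooth, fun x hx => ⟨?_, ?_⟩⟩
    · exact (L'.linearIndependent hx).map' (Submodule.subtype _) (Submodule.ker_subtype _)
    · apply le_antisymm
      · rw [Submodule.span_le]
        rintro _ ⟨i, rfl⟩
        exact (L'.e i x).2
      · intro z hz
        rw [show z = ((⟨z, hz⟩ : LinearMap.range (F x)) : TangentSpace (𝓡 m) x) from rfl,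
          L'.expand_coe hx]
        exact Submodule.sum_mem _ fun i _ => Submodule.smul_mem _ _ (Submodule.subset_span ⟨i, rfl⟩)
  · exact fun x hx u v => hΦ.metric_symm x (hNdom hx) _ _
  · intro x hx u hu
    exact hΦ.metric_pos x (hNdom hx) _ fun h => hu (rangeInv_injective (hF.1 x hx) (by simpa using h))
  · intro Z Z' O hO hZ hZ'
    exact hΦ.metric_contMDiffOn le_rfl (S := N ∩ O) (fun x hx => hNdom hx.1)
      (hΦ.rangeInv_fieldOn hN hNdom hF le_rfl Set.inter_subset_left
        (FieldOn.mono hZ Set.inter_subset_right))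
      (hΦ.rangeInv_fieldOn hN hNdom hF le_rfl Set.inter_subset_left
        (FieldOn.mono hZ' Set.inter_subset_right))
  · exact hΦ.F_fieldOn hNdom hF le_rfl subset_rfl (FieldOn.mono hΦ.Φ1_smooth hNdom)
  · rw [hV]
    rintro v hv _ ⟨z, rfl⟩
    obtain ⟨w, hw⟩ := hΦ.Φ1_transverse v hv z z.2
    refine ⟨w, ?_⟩
    rw [hΦ.push_gammaHat hN hVN hNdom hF hv]
    exact congrArg _ (Subtype.ext hw)
  · intro Z O hO hZ
    rw [hV]
    exact hΦ.F_fieldOn hNdom hF le_rfl (S := Φ.V ∩ O) (fun x hx => hVN hx.1)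
      (hΦ.Φ2_fieldOn le_rfl Set.inter_subset_left
        (hΦ.rangeInv_fieldOn hN hNdom hF le_rfl (fun x hx => hVN hx.1)
          (FieldOn.mono hZ Set.inter_subset_right)))
  · rw [hV]
    intro v hv u u'
    have := hΦ.Φ2_selfAdjoint v hv (rangeInv F v u) (rangeInv F v u')
    change Φ.metric v (rangeInv F v ((F v).rangeRestrict (Φ.Φ2 v (rangeInv F v u)))) _ =
      Φ.metric v _ (rangeInv F v ((F v).rangeRestrict (Φ.Φ2 v (rangeInv F v u'))))
    rwa [rangeInv_rangeRestrict (hinj v hv), rangeInv_rangeRestrict (hinj v hv)]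
  · rw [hS]
    intro s hs
    rw [push_ker (hinj s (hSV hs)), LinearEquiv.finrank_map_eq]
    exact hΦ.Φ2_corank s hs
  · rw [hS, hV]
    intro s hs
    obtain ⟨w, c, hc, hd⟩ := hΦ.Φ2_transverse s hs
    refine ⟨w, c, hc, ?_⟩
    have : (fun t => LinearMap.det ((Φ.push N F).Φ2 (c t))) =ᶠ[𝓝 0]
        fun t => LinearMap.det (Φ.Φ2 (c t)) := by
      filter_upwards [hc.mem] with t ht
      rw [push_Φ2_eq_conj (hinj _ ht), LinearEquiv.conj_apply, LinearMap.comp_assoc]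
      exact LinearMap.det_conj _ _
    rwa [this.deriv_eq]
  · rw [hS]
    exact hΦ.F_fieldOn hNdom hF le_rfl (fun x hx => hVN (hSV hx)) hΦ.lam_smooth
  · rw [hS]
    intro s hs
    have h1 := push_Φ2_apply (Φ := Φ) (N := N) (hinj s (hSV hs)) (Φ.lam s)
    rw [hΦ.lam_ker s hs, map_zero] at h1
    exact h1
  · rw [hS]
    intro s hs
    change Φ.metric s (rangeInv F s ((F s).rangeRestrict (Φ.lam s)))
      (rangeInv F s ((F s).rangeRestrict (Φ.lam s))) = 1
    rw [rangeInv_rangeRestrict (hinj s (hSV hs))]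
    exact hΦ.lam_unit s hs

end FLIFData

/-! ### The collar of the degeneration locus -/

lemma velocity_comp {c : ℝ → W} {h : ℝ → ℝ} {a t₀ t₁ : ℝ} (ht : h t₀ = t₁)
    (hc : MDifferentiableAt 𝓘(ℝ, ℝ) (𝓡 m) c t₁) (hh : HasDerivAt h a t₀) :
    velocity (fun t => c (h t)) t₀ =
      (⟨c t₁, a • (velocity c t₁).2⟩ : TangentBundle (𝓡 m) W) := by
  subst ht
  have h1 : mfderiv 𝓘(ℝ, ℝ) (𝓡 m) (fun t => c (h t)) t₀ (1 : ℝ) =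
      mfderiv 𝓘(ℝ, ℝ) (𝓡 m) c (h t₀) (mfderiv 𝓘(ℝ, ℝ) 𝓘(ℝ, ℝ) h t₀ (1 : ℝ)) :=
    mfderiv_comp_apply t₀ hc hh.differentiableAt.mdifferentiableAt (1 : ℝ)
  have h2 : mfderiv 𝓘(ℝ, ℝ) 𝓘(ℝ, ℝ) h t₀ (1 : ℝ) = (a • (1 : ℝ) : ℝ) := by
    have : mfderiv 𝓘(ℝ, ℝ) 𝓘(ℝ, ℝ) h t₀ = fderiv ℝ h t₀ := mfderiv_eq_fderiv
    refine (congrArg (fun L : ℝ →L[ℝ] ℝ => L 1) this).trans ?_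
    rw [smul_eq_mul, mul_one]
    exact fderiv_apply_one_eq_deriv.trans hh.deriv
  refine Bundle.TotalSpace.ext rfl (heq_of_eq ?_)
  refine h1.trans ?_
  rw [h2]
  exact map_smul (mfderiv 𝓘(ℝ, ℝ) (𝓡 m) c (h t₀)) a (1 : ℝ)

lemma IsCurveIn.comp_mul {S : Set W} {c : ℝ → W} {p : W} {w : TangentSpace (𝓡 m) p}
    (h : IsCurveIn S c p w) (a : ℝ) : IsCurveIn S (fun t => c (a * t)) p (a • w) := by
  have h0 : a * 0 = 0 := mul_zero a
  have hcont : Continuous fun t : ℝ => a * t := by fun_prop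
  refine ⟨?_, ?_, ?_⟩
  · refine ContMDiffAt.comp (g := c) (0 : ℝ) (by rw [h0]; exact h.smooth) ?_
    exact (contDiff_const.mul contDiff_id).contMDiff.contMDiffAt
  · exact (hcont.tendsto' 0 0 h0).eventually h.mem
  · rw [velocity_comp (t₀ := 0) h0 (h.smooth.mdifferentiableAt (by simp))
      (by simpa using (hasDerivAt_id (0 : ℝ)).const_mul a), h.velocity_eq]
    have := h.left_eq
    subst this
    rfl

namespace FLIFData

variable {Φ : FLIFData ζ}

namespace Collar

variable (C : Φ.Collar)

lemma toFun_smooth {s : W} (hs : s ∈ Φ.Sig) : ContMDiff 𝓘(ℝ, ℝ) (𝓡 m) ∞ (C.toFun s) :=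
  C.smooth.comp_contMDiff (contMDiff_const.prodMk contMDiff_id) fun _ => ⟨hs, trivial⟩

lemma isCurveIn {s : W} (hs : s ∈ Φ.Sig) (t : ℝ) :
    IsCurveIn Φ.V (fun r => C.toFun s (t + r)) (C.toFun s t) (C.τ (C.toFun s t)) := by
  refine ⟨?_, .of_forall fun r => C.map_mem s hs _, ?_⟩
  · exact ((C.toFun_smooth hs).comp (contDiff_const.add contDiff_id).contMDiff).contMDiffAt
  · rw [velocity_comp (t₀ := 0) (add_zero t) ((C.toFun_smooth hs).mdifferentiableAt (by simp))
      ((hasDerivAt_id (0 : ℝ)).const_add t), C.velocity_eq s hs]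
    simp

lemma isCurveIn_zero {s : W} (hs : s ∈ Φ.Sig) : IsCurveIn Φ.V (C.toFun s) s (C.τ s) := by
  refine ⟨(C.toFun_smooth hs).contMDiffAt, .of_forall fun r => C.map_mem s hs _, ?_⟩
  rw [C.velocity_eq s hs, C.map_zero s hs]

lemma tau_mem {s : W} (hs : s ∈ Φ.Sig) (t : ℝ) :
    C.τ (C.toFun s t) ∈ tangentTo Φ.V (C.toFun s t) :=
  Submodule.subset_span ⟨_, C.isCurveIn hs t⟩

lemma tau_mem_of_mem_U {x : W} (hx : x ∈ C.U) : C.τ x ∈ tangentTo Φ.V x := by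
  obtain ⟨⟨s, t⟩, ⟨hs, -⟩, rfl⟩ := hx
  exact C.tau_mem hs t

lemma U_subset_V : C.U ⊆ Φ.V := by
  rintro _ ⟨⟨s, t⟩, ⟨hs, -⟩, rfl⟩
  exact C.map_mem s hs t

lemma mem_U {s : W} (hs : s ∈ Φ.Sig) {t : ℝ} (ht : t ∈ Set.Icc (-C.ε) C.ε) : C.toFun s t ∈ C.U :=
  ⟨(s, t), ⟨hs, ht⟩, rfl⟩

lemma Sig_subset_U : Φ.Sig ⊆ C.U := fun s hs => by
  have := C.mem_U hs (t := 0) ⟨by linarith [C.ε_pos], C.ε_pos.le⟩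
  rwa [C.map_zero s hs] at this

lemma toFun_mem_Sig_iff {s : W} (hs : s ∈ Φ.Sig) (t : ℝ) : C.toFun s t ∈ Φ.Sig ↔ t = 0 := by
  constructor
  · intro h
    have h1 := C.coord_map _ h 0
    rw [C.map_zero _ h, C.coord_map s hs] at h1
    exact h1
  · rintro rfl
    rwa [C.map_zero s hs]

/-- Apart from the two boundary components, the tube `U` is a neighbourhood in `V` of its points. -/
lemma U_mem_nhdsWithin {s : W} (hs : s ∈ Φ.Sig) {t : ℝ} (ht : t ∈ Set.Ioo (-C.ε) C.ε) :
    C.U ∈ 𝓝[Φ.V] C.toFun s t := by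
  obtain ⟨O, hO, himg⟩ := C.open_image
  have hx : C.toFun s t ∈ (fun q : W × ℝ => C.toFun q.1 q.2) '' (Φ.Sig ×ˢ Set.univ) :=
    ⟨(s, t), ⟨hs, trivial⟩, rfl⟩
  have hxO := hx
  rw [himg] at hxO
  have h1 : ContinuousWithinAt C.coord (Φ.V ∩ O) (C.toFun s t) := by
    rw [← himg]; exact C.coord_smooth.continuousOn _ hx
  have h2 : ∀ᶠ y in 𝓝[Φ.V ∩ O] C.toFun s t, C.coord y ∈ Set.Ioo (-C.ε) C.ε :=
    h1.eventually_mem (by rw [C.coord_map s hs]; exact isOpen_Ioo.mem_nhds ht)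
  rw [nhdsWithin_inter_of_mem' (mem_nhdsWithin_of_mem_nhds (hO.mem_nhds hxO.2))] at h2
  filter_upwards [h2, self_mem_nhdsWithin, mem_nhdsWithin_of_mem_nhds (hO.mem_nhds hxO.2)]
    with y hy hyV hyO
  have hy' : y ∈ (fun q : W × ℝ => C.toFun q.1 q.2) '' (Φ.Sig ×ˢ Set.univ) := by
    rw [himg]; exact ⟨hyV, hyO⟩
  obtain ⟨⟨s', t'⟩, ⟨hs', -⟩, rfl⟩ := hy'
  simp only [C.coord_map s' hs'] at hy
  exact C.mem_U hs' (Set.Ioo_subset_Icc_self hy)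

lemma U_mem_nhdsWithin_of_mem_Sig {s : W} (hs : s ∈ Φ.Sig) : C.U ∈ 𝓝[Φ.V] s := by
  have := C.U_mem_nhdsWithin hs (t := 0) ⟨by linarith [C.ε_pos], C.ε_pos⟩
  rwa [C.map_zero s hs] at this

lemma compl_U_mem_nhdsWithin {x : W} (hx : x ∈ Φ.V) (hxU : x ∉ C.U) : C.Uᶜ ∈ 𝓝[Φ.V] x := by
  obtain ⟨K, hK, hUK⟩ := C.closed_tube
  have hU : C.U = Φ.V ∩ K := hUK
  rw [hU] at hxU ⊢
  have hxK : x ∈ Kᶜ := fun h => hxU ⟨hx, h⟩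
  filter_upwards [mem_nhdsWithin_of_mem_nhds (hK.isOpen_compl.mem_nhds hxK)] with y hy h
  exact hy h.2

end Collar

/-! ### The auxiliary functions of the twisted normal bundle -/

namespace TwistChoices

variable (C : Φ.TwistChoices)

lemma lamT_ne_zero {x : W} (hx : x ∈ C.U) : C.lamT x ≠ 0 := fun h => by
  have := C.lamT_unit x hx
  rw [h] at this
  simp at this

lemma mem_Sig_of_c_eq_zero {x : W} (hx : x ∈ C.U) (h : C.c x = 0) : x ∈ Φ.Sig := by
  refine ⟨C.U_subset_V hx, fun hker => C.lamT_ne_zero hx ?_⟩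
  have h1 : C.lamT x ∈ LinearMap.ker (Φ.Φ2 x) := by
    rw [LinearMap.mem_ker, C.lamT_eigen x hx, h, zero_smul]
  rwa [hker] at h1

lemma sin_eq_zero_iff {x : W} (hx : x ∈ C.U) : Real.sin (C.θ x) = 0 ↔ x ∈ Φ.Sig := by
  have h := C.θ_mem x hx
  rw [← C.θ_zero x hx]
  refine Real.sin_eq_zero_iff_of_lt_of_lt ?_ ?_
  · linarith [h.1, Real.pi_pos]
  · linarith [h.2, Real.pi_pos]

section signs

lemma pos_of_pos_right {f : ℝ → ℝ} {a b : ℝ} (hab : a ≤ b) (hf : ContinuousOn f (Set.Icc a b))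
    (h0 : ∀ t ∈ Set.Icc a b, f t ≠ 0) (hb : 0 < f b) : 0 < f a := by
  by_contra h
  obtain ⟨t, ht, ht0⟩ := intermediate_value_Icc hab hf ⟨not_lt.1 h, hb.le⟩
  exact h0 t ht ht0

lemma theta_top_eq {s : W} (hs : s ∈ Φ.Sig) : C.θ (C.toFun s C.ε) = Real.pi / 2 :=
  (C.θ_top s hs).self_of_nhdsWithin (C.mem_U hs ⟨by linarith [C.ε_pos], le_rfl⟩)

lemma theta_bot_eq {s : W} (hs : s ∈ Φ.Sig) : C.θ (C.toFun s (-C.ε)) = -(Real.pi / 2) :=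
  (C.θ_bot s hs).self_of_nhdsWithin (C.mem_U hs ⟨le_rfl, by linarith [C.ε_pos]⟩)

lemma continuousOn_comp_toFun {f : W → ℝ} (hf : ContinuousOn f C.U) {s : W} (hs : s ∈ Φ.Sig) :
    ContinuousOn (fun t => f (C.toFun s t)) (Set.Icc (-C.ε) C.ε) :=
  hf.comp (C.toFun_smooth hs).continuous.continuousOn fun _ ht => C.mem_U hs ht

/-- A continuous function on `U` which vanishes exactly on `Σ`, is positive on the top and negative
on the bottom of `U`, has the sign of the collar coordinate. -/
lemma pos_of_top {f : W → ℝ} (hf : ContinuousOn f C.U) (h0 : ∀ x ∈ C.U, f x = 0 → x ∈ Φ.Sig)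
    {s : W} (hs : s ∈ Φ.Sig) (htop : 0 < f (C.toFun s C.ε)) {t : ℝ} (ht : t ∈ Set.Ioc 0 C.ε) :
    0 < f (C.toFun s t) := by
  have hsub : Set.Icc t C.ε ⊆ Set.Icc (-C.ε) C.ε :=
    Set.Icc_subset_Icc_left (by linarith [ht.1, C.ε_pos])
  refine pos_of_pos_right (f := fun t => f (C.toFun s t)) ht.2
    ((C.continuousOn_comp_toFun hf hs).mono hsub) (fun r hr hr0 => ?_) htop
  have := (C.toFun_mem_Sig_iff hs r).1 (h0 _ (C.mem_U hs (hsub hr)) hr0)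
  linarith [hr.1, ht.1]

lemma neg_of_bot {f : W → ℝ} (hf : ContinuousOn f C.U) (h0 : ∀ x ∈ C.U, f x = 0 → x ∈ Φ.Sig)
    {s : W} (hs : s ∈ Φ.Sig) (hbot : f (C.toFun s (-C.ε)) < 0) {t : ℝ}
    (ht : t ∈ Set.Ico (-C.ε) 0) : f (C.toFun s t) < 0 := by
  have hneg : ∀ r ∈ Set.Icc (-t) C.ε, -r ∈ Set.Icc (-C.ε) C.ε := fun r hr =>
    ⟨by linarith [hr.2], by linarith [hr.1, ht.2, C.ε_pos]⟩
  have := pos_of_pos_right (f := fun r => -f (C.toFun s (-r))) (a := -t) (b := C.ε)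
    (by linarith [ht.1])
    (((C.continuousOn_comp_toFun hf hs).comp continuous_neg.continuousOn hneg).neg)
    (fun r hr hr0 => ?_) (by simpa using hbot)
  · simpa using this
  · have := (C.toFun_mem_Sig_iff hs (-r)).1 (h0 _ (C.mem_U hs (hneg r hr)) (neg_eq_zero.1 hr0))
    linarith [hr.1, ht.2]

lemma theta_pos {s : W} (hs : s ∈ Φ.Sig) {t : ℝ} (ht : t ∈ Set.Ioc 0 C.ε) :
    0 < C.θ (C.toFun s t) :=
  C.pos_of_top C.θ_smooth.continuousOn (fun x hx h => (C.θ_zero x hx).1 h) hs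
    (by rw [C.theta_top_eq hs]; positivity) ht

lemma theta_neg {s : W} (hs : s ∈ Φ.Sig) {t : ℝ} (ht : t ∈ Set.Ico (-C.ε) 0) :
    C.θ (C.toFun s t) < 0 :=
  C.neg_of_bot C.θ_smooth.continuousOn (fun x hx h => (C.θ_zero x hx).1 h) hs
    (by rw [C.theta_bot_eq hs]; linarith [Real.pi_pos]) ht

end signs

end TwistChoices

namespace IsFLIF

variable (hΦ : Φ.IsFLIF n) (C : Φ.TwistChoices)
include hΦ

lemma c_smooth : ContMDiffOn (𝓡 m) 𝓘(ℝ, ℝ) ∞ C.c C.U := by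
  refine (hΦ.metric_contMDiffOn le_rfl (C.U_subset_V.trans V_subset_dom)
    (hΦ.Φ2_fieldOn le_rfl C.U_subset_V C.lamT_smooth) C.lamT_smooth).congr fun x hx => ?_
  rw [C.lamT_eigen x hx, map_smul, LinearMap.smul_apply, C.lamT_unit x hx, smul_eq_mul, mul_one]

lemma c_pos {s : W} (hs : s ∈ Φ.Sig) {t : ℝ} (ht : t ∈ Set.Ioc 0 C.ε) :
    0 < C.c (C.toFun s t) :=
  C.pos_of_top (hΦ.c_smooth C).continuousOn (fun x hx h => C.mem_Sig_of_c_eq_zero hx h) hs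
    (by rw [← C.cT_top s hs]; exact C.cT_pos _ (C.mem_U hs ⟨by linarith [C.ε_pos], le_rfl⟩)) ht

lemma c_neg {s : W} (hs : s ∈ Φ.Sig) {t : ℝ} (ht : t ∈ Set.Ico (-C.ε) 0) :
    C.c (C.toFun s t) < 0 :=
  C.neg_of_bot (hΦ.c_smooth C).continuousOn (fun x hx h => C.mem_Sig_of_c_eq_zero hx h) hs
    (by
      have h1 := C.cT_bot s hs
      have h2 := C.cT_pos _ (C.mem_U hs (t := -C.ε) ⟨le_rfl, by linarith [C.ε_pos]⟩)
      linarith) ht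

lemma c_eq_zero {s : W} (hs : s ∈ Φ.Sig) : C.c s = 0 := by
  have h1 := C.lamT_eigen s (C.Sig_subset_U hs)
  rw [C.lamT_eq s hs, hΦ.lam_ker s hs, ← C.lamT_eq s hs] at h1
  exact (smul_eq_zero.1 h1.symm).resolve_right (C.lamT_ne_zero (C.Sig_subset_U hs))

/-- Off `Σ` the eigenvalue `c` has the sign of `sin θ`. -/
lemma div_sinAmp_pos {x : W} (hx : x ∈ C.U) (hxS : x ∉ Φ.Sig) :
    0 < C.c x / (C.cT x * Real.sin (C.θ x)) := by
  have hθ := C.θ_mem x hx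
  have hcT := C.cT_pos x hx
  obtain ⟨⟨s, t⟩, ⟨hs, ht⟩, rfl⟩ := hx
  rcases lt_trichotomy t 0 with h | rfl | h
  · have h1 := hΦ.c_neg C hs ⟨ht.1, h⟩
    have h2 := C.theta_neg hs ⟨ht.1, h⟩
    exact div_pos_of_neg_of_neg h1 (mul_neg_of_pos_of_neg hcT
      (Real.sin_neg_of_neg_of_neg_pi_lt h2 (by linarith [hθ.1, Real.pi_pos])))
  · exact absurd ((C.toFun_mem_Sig_iff hs 0).2 rfl) hxS
  · have h1 := hΦ.c_pos C hs ⟨h, ht.2⟩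
    have h2 := C.theta_pos hs ⟨h, ht.2⟩
    exact div_pos h1 (mul_pos hcT
      (Real.sin_pos_of_pos_of_lt_pi h2 (by linarith [hθ.2, Real.pi_pos])))

end IsFLIF

end FLIFData

/-! ### Fibrewise linear algebra over the tube -/

instance finiteDimensional_tangentSpace (x : W) : FiniteDimensional ℝ (TangentSpace (𝓡 m) x) :=
  inferInstanceAs (FiniteDimensional ℝ (EuclideanSpace ℝ (Fin m)))

namespace FLIFData

variable {Φ : FLIFData ζ}

namespace TwistChoices

variable (C : Φ.TwistChoices)

/-- The orthogonal projection of `ζ` to the line spanned by the unit vector `λ̃⁺`. -/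
noncomputable def lamProj (x : W) : ζ x →ₗ[ℝ] ζ x :=
  ((Φ.metric x).flip (C.lamT x)).smulRight (C.lamT x)

@[simp] lemma lamProj_apply (x : W) (z : ζ x) :
    C.lamProj x z = Φ.metric x z (C.lamT x) • C.lamT x := rfl

/-- The operator on `ζ` obtained from `Φ2` by changing the eigenvalue of `λ̃⁺` to `k`. -/
noncomputable def modify (x : W) (k : ℝ) : ζ x →ₗ[ℝ] ζ x :=
  Φ.Φ2 x + (k - C.c x) • C.lamProj x

lemma modify_apply (x : W) (k : ℝ) (z : ζ x) : C.modify x k z =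
    Φ.Φ2 x z + ((k - C.c x) * Φ.metric x z (C.lamT x)) • C.lamT x := by
  simp [modify, mul_smul]

open Classical in
/-- The composition of `Γ̂` with the isomorphism `Δ` from `Vert` to the twisted normal bundle; see
`IsFLIF.gammaHat_delta`. -/
noncomputable def twist (x : W) : ζ x →ₗ[ℝ] ζ x :=
  if x ∈ C.U then C.modify x (C.cT x * Real.sin (C.θ x)) else Φ.Φ2 x

lemma twist_of_mem {x : W} (hx : x ∈ C.U) :
    C.twist x = C.modify x (C.cT x * Real.sin (C.θ x)) := if_pos hx

lemma twist_of_notMem {x : W} (hx : x ∉ C.U) : C.twist x = Φ.Φ2 x := if_neg hx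

end TwistChoices

lemma gammaInv_zero (g : Metric m W) (x : W) : Φ.gammaInv g x 0 = 0 := by
  rw [gammaInv, ZeroMemClass.coe_zero, map_zero, ZeroMemClass.coe_zero]

namespace IsFLIF

variable (hΦ : Φ.IsFLIF n) (C : Φ.TwistChoices)
include hΦ

lemma metric_Φ2_lamT {x : W} (hx : x ∈ C.U) (z : ζ x) :
    Φ.metric x (Φ.Φ2 x z) (C.lamT x) = C.c x * Φ.metric x z (C.lamT x) := by
  rw [hΦ.Φ2_selfAdjoint x (C.U_subset_V hx), C.lamT_eigen x hx, map_smul, smul_eq_mul]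

lemma metric_modify_lamT {x : W} (hx : x ∈ C.U) (k : ℝ) (z : ζ x) :
    Φ.metric x (C.modify x k z) (C.lamT x) = k * Φ.metric x z (C.lamT x) := by
  rw [C.modify_apply, map_add, LinearMap.add_apply, hΦ.metric_Φ2_lamT C hx, map_smul,
    LinearMap.smul_apply, C.lamT_unit x hx, smul_eq_mul]
  ring

omit hΦ in
lemma modify_lamT {x : W} (hx : x ∈ C.U) (k : ℝ) : C.modify x k (C.lamT x) = k • C.lamT x := by
  rw [C.modify_apply, C.lamT_unit x hx, C.lamT_eigen x hx, ← add_smul]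
  congr 1; ring

omit hΦ in
lemma Φ2_injective {x : W} (hx : x ∈ Φ.V) (hxS : x ∉ Φ.Sig) : Function.Injective (Φ.Φ2 x) := by
  rw [← LinearMap.ker_eq_bot]
  by_contra h
  exact hxS ⟨hx, h⟩

/-- Over `Σ` the kernel of `Φ2` is spanned by `λ̃⁺`. -/
lemma exists_eq_smul_lamT {x : W} (hx : x ∈ Φ.Sig) {z : ζ x} (hz : Φ.Φ2 x z = 0) :
    ∃ a : ℝ, z = a • C.lamT x := by
  have hl : Φ.Φ2 x (C.lamT x) = 0 := by rw [C.lamT_eq x hx, hΦ.lam_ker x hx]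
  obtain ⟨a, ha⟩ := exists_smul_eq_of_finrank_eq_one (hΦ.Φ2_corank x hx)
    (x := (⟨C.lamT x, hl⟩ : LinearMap.ker (Φ.Φ2 x)))
    (fun h => C.lamT_ne_zero (C.Sig_subset_U hx) (congrArg Subtype.val h)) ⟨z, hz⟩
  exact ⟨a, (congrArg Subtype.val ha).symm⟩

/-- The operator `Φ2` is nondegenerate apart from its eigenvalue on `λ̃⁺`. -/
lemma modify_injective {x : W} (hx : x ∈ C.U) {k : ℝ} (hk : k ≠ 0) :
    Function.Injective (C.modify x k) := by
  rw [← LinearMap.ker_eq_bot, LinearMap.ker_eq_bot']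
  intro z hz
  have h1 := hΦ.metric_modify_lamT C hx k z
  rw [hz, map_zero, LinearMap.zero_apply] at h1
  have h2 : Φ.metric x z (C.lamT x) = 0 := (mul_eq_zero.1 h1.symm).resolve_left hk
  rw [C.modify_apply, h2, mul_zero, zero_smul, add_zero] at hz
  by_cases hxS : x ∈ Φ.Sig
  · obtain ⟨a, rfl⟩ := hΦ.exists_eq_smul_lamT C hxS hz
    rw [map_smul, LinearMap.smul_apply, C.lamT_unit x hx, smul_eq_mul, mul_one] at h2
    rw [h2, zero_smul]
  · exact Φ2_injective (C.U_subset_V hx) hxS (by rw [hz, map_zero])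

lemma modify_surjective {x : W} (hx : x ∈ C.U) {k : ℝ} (hk : k ≠ 0) :
    Function.Surjective (C.modify x k) :=
  LinearMap.injective_iff_surjective.1 (hΦ.modify_injective C hx hk)

/-- The eigenvalue `c` splits off the determinant of `Φ2`, which is the composition of `modify x 1`
with the map that multiplies `λ̃⁺` by `c`. -/
lemma det_Φ2 {x : W} (hx : x ∈ C.U) :
    LinearMap.det (Φ.Φ2 x) = C.c x * LinearMap.det (C.modify x 1) := by
  have h1 : Φ.Φ2 x = C.modify x 1 ∘ₗ
      LinearMap.transvection ((Φ.metric x).flip (C.lamT x)) ((C.c x - 1) • C.lamT x) := by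
    refine LinearMap.ext fun z => ?_
    rw [LinearMap.comp_apply, LinearMap.transvection.apply, map_add, map_smul, map_smul,
      modify_lamT C hx, C.modify_apply]
    simp only [LinearMap.flip_apply, one_smul, smul_smul]
    rw [add_assoc, ← add_smul]
    convert (add_zero _).symm using 2
    rw [show (1 - C.c x) * Φ.metric x z (C.lamT x) + Φ.metric x z (C.lamT x) * (C.c x - 1) = 0 by
      ring, zero_smul]
  rw [h1, LinearMap.det_comp, LinearMap.transvection.det, mul_comm]
  congr 1
  rw [LinearMap.flip_apply, map_smul, LinearMap.smul_apply, C.lamT_unit x hx, smul_eq_mul]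
  ring

lemma modify_fieldOn {r : WithTop ℕ∞} (hr : r ≤ ∞) {k : W → ℝ} {S : Set W} (hS : S ⊆ C.U)
    (hk : ContMDiffOn (𝓡 m) 𝓘(ℝ, ℝ) r k S) {Z : ∀ x : W, ζ x}
    (hZ : FieldOn r S fun x => (Z x : TangentSpace (𝓡 m) x)) :
    FieldOn r S fun x => (C.modify x (k x) (Z x) : TangentSpace (𝓡 m) x) := by
  have hl : FieldOn r S fun x => (C.lamT x : TangentSpace (𝓡 m) x) :=
    FieldOn.of_le (FieldOn.mono C.lamT_smooth hS) hr
  refine ((hΦ.Φ2_fieldOn hr (hS.trans C.U_subset_V) hZ).add (FieldOn.smul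
    ((hk.sub (((hΦ.c_smooth C).mono hS).of_le hr)).mul
      (hΦ.metric_contMDiffOn hr ((hS.trans C.U_subset_V).trans V_subset_dom) hZ hl))
    hl)).congr fun x _ => ?_
  rw [C.modify_apply]
  rfl

lemma det_modify_smooth :
    ContMDiffOn (𝓡 m) 𝓘(ℝ, ℝ) ∞ (fun x => LinearMap.det (C.modify x 1)) C.U := by
  classical
  refine contMDiffOn_of_locally_contMDiffOn fun p hp => ?_
  obtain ⟨O, L, hpO, -⟩ := hΦ.exists_localFrame (C.U_subset_V hp).1
  refine ⟨O, L.isOpen, hpO, ContMDiffOn.congr (contMDiffOn_det (M := fun x => Matrix.of fun i j =>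
    L.κ i x (C.modify x 1 (L.e j x) : TangentSpace (𝓡 m) x)) fun i j => ?_) fun x hx => ?_⟩
  · exact L.coeff_contMDiffOn le_rfl Set.inter_subset_right
      (hΦ.modify_fieldOn C le_rfl (k := fun _ => 1) Set.inter_subset_left contMDiffOn_const
        ((L.e_smooth j).mono Set.inter_subset_right)) i
  · rw [← LinearMap.det_toMatrix (L.basis hx.2)]
    congr 1
    ext i j
    rw [LinearMap.toMatrix_apply, L.basis_repr, L.basis_apply]
    rfl

lemma gammaHat_muPlus (g : Metric m W) {x : W} (hx : x ∈ C.U) :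
    Φ.gammaHat x (C.muPlus g x) = Real.sin (C.θ x) • (C.lamT x : TangentSpace (𝓡 m) x) := by
  have hV := C.U_subset_V hx
  rw [TwistChoices.muPlus, map_add, map_smul, map_smul, (hΦ.gammaInv_spec g hV _).2,
    (hΦ.mem_tangentTo_iff hV _).1 (C.tau_mem_of_mem_U hx), smul_zero, add_zero]

lemma gammaHat_delta (g : Metric m W) {x : W} (hx : x ∈ Φ.V) (z : ζ x) :
    Φ.gammaHat x (C.delta g x z) = C.twist x z := by
  by_cases hU : x ∈ C.U
  · rw [C.twist_of_mem hU, TwistChoices.delta, if_pos hU, map_add, map_smul, map_smul,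
      hΦ.gammaHat_muPlus C g hU, (hΦ.gammaInv_spec g hx _).2, C.modify_apply, map_sub, map_smul,
      C.lamT_eigen x hU]
    simp only [Submodule.coe_add, Submodule.coe_sub, Submodule.coe_smul]
    module
  · rw [C.twist_of_notMem hU, TwistChoices.delta, if_neg hU, (hΦ.gammaInv_spec g hx _).2]

lemma twist_injective {x : W} (hx : x ∈ Φ.V) (hxS : x ∉ Φ.Sig) :
    Function.Injective (C.twist x) := by
  by_cases hU : x ∈ C.U
  · rw [C.twist_of_mem hU]
    exact hΦ.modify_injective C hU
      (mul_ne_zero (C.cT_pos x hU).ne' fun h => hxS ((C.sin_eq_zero_iff hU).1 h))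
  · rw [C.twist_of_notMem hU]
    exact Φ2_injective hx hxS

lemma twist_surjective {x : W} (hx : x ∈ Φ.V) (hxS : x ∉ Φ.Sig) :
    Function.Surjective (C.twist x) :=
  LinearMap.injective_iff_surjective.1 (hΦ.twist_injective C hx hxS)

lemma twist_of_mem_Sig {s : W} (hs : s ∈ Φ.Sig) : C.twist s = Φ.Φ2 s := by
  have hU := C.Sig_subset_U hs
  rw [C.twist_of_mem hU, (C.sin_eq_zero_iff hU).2 hs, TwistChoices.modify, hΦ.c_eq_zero C hs]
  simp

/-- The image of the isomorphism onto the twisted normal bundle. -/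
lemma range_eq_twistedNormal (g : Metric m W) {x : W} (hx : x ∈ Φ.V)
    {f : ζ x →ₗ[ℝ] TangentSpace (𝓡 m) x} (hf : ∀ z, f z = C.delta g x z) :
    LinearMap.range f = C.twistedNormal g x := by
  by_cases hU : x ∈ C.U
  · have hl := C.lamT_unit x hU
    have hfl : f (C.lamT x) = C.cT x • C.muPlus g x := by
      rw [hf, TwistChoices.delta, if_pos hU, hl, one_smul, sub_self, map_zero, gammaInv_zero,
        zero_add, one_smul]
    rw [TwistChoices.twistedNormal, if_pos hU]
    apply le_antisymm
    · rintro _ ⟨z, rfl⟩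
      rw [hf, TwistChoices.delta, if_pos hU]
      refine Submodule.add_mem _ (Submodule.subset_span (.inl ⟨_, ?_, rfl⟩))
        (Submodule.smul_mem _ _ (Submodule.smul_mem _ _ (Submodule.subset_span (.inr rfl))))
      rw [hΦ.metric_Φ2_lamT C hU, map_sub, map_smul, LinearMap.sub_apply, LinearMap.smul_apply, hl]
      simp
    · rw [Submodule.span_le, Set.union_subset_iff]
      constructor
      · rintro _ ⟨z, hz, rfl⟩
        obtain ⟨y, hy⟩ := hΦ.modify_surjective C hU one_ne_zero z
        have h1 := hΦ.metric_modify_lamT C hU 1 y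
        rw [hy, hz, one_mul] at h1
        rw [C.modify_apply, ← h1, mul_zero, zero_smul, add_zero] at hy
        refine ⟨y, ?_⟩
        rw [hf, TwistChoices.delta, if_pos hU, ← h1, zero_smul, zero_smul, sub_zero, add_zero, hy]
      · rintro _ rfl
        refine ⟨(C.cT x)⁻¹ • C.lamT x, ?_⟩
        rw [map_smul, hfl, inv_smul_smul₀ (C.cT_pos x hU).ne']
  · rw [TwistChoices.twistedNormal, if_neg hU]
    have hd : ∀ z, f z = Φ.gammaInv g x (Φ.Φ2 x z) := fun z => by
      rw [hf, TwistChoices.delta, if_neg hU]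
    apply le_antisymm
    · rintro _ ⟨z, rfl⟩
      rw [hd]
      exact (hΦ.gammaInv_spec g hx _).1
    · intro w hw
      obtain ⟨z, hz⟩ := hΦ.twist_surjective C hx (fun h => hU (C.Sig_subset_U h))
        ⟨Φ.gammaHat x w, hΦ.gammaHat_mem hx w⟩
      rw [C.twist_of_notMem hU] at hz
      refine ⟨z, ?_⟩
      rw [hd, hz]
      exact hΦ.gammaInv_eq g hx hw rfl

end IsFLIF
end FLIFData

/-! ### Division by the collar coordinate -/

/-- A function of class `C¹` on `T × ℝ` which vanishes on `T × 0` is, up to a factor which is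
continuous at `(p, 0)`, the coordinate of `ℝ`. The set `T` is arbitrary. -/
lemma tendsto_div_snd {E : Type*} [NormedAddCommGroup E] [NormedSpace ℝ E] {T : Set E} {p : E}
    (hp : p ∈ T) {H : E × ℝ → ℝ} (hH : ContDiffWithinAt ℝ 1 H (T ×ˢ Set.univ) (p, 0))
    (h0 : ∀ u ∈ T, H (u, 0) = 0) {L : ℝ} (hL : HasDerivAt (fun t => H (p, t)) L 0) :
    Filter.Tendsto (fun q : E × ℝ => H q / q.2) (𝓝[T ×ˢ {0}ᶜ] (p, 0)) (𝓝 L) := by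
  have hps : (p, (0 : ℝ)) ∈ T ×ˢ (Set.univ : Set ℝ) := ⟨hp, trivial⟩
  rw [show (1 : WithTop ℕ∞) = 0 + 1 from rfl,
    contDiffWithinAt_succ_iff_hasFDerivWithinAt' (by simp)] at hH
  obtain ⟨u, hu, -, -, f', hf', hcont⟩ := hH
  rw [Set.insert_eq_of_mem hps] at hu
  have hder : ∀ x ∈ T, ∀ t, (x, t) ∈ u → HasDerivAt (fun t => H (x, t)) (f' (x, t) (0, 1)) t := by
    intro x hx t hxt
    have h1 : HasDerivWithinAt (fun t : ℝ => (x, t)) ((0 : E), (1 : ℝ)) Set.univ t :=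
      (hasDerivWithinAt_const t _ x).prodMk (hasDerivWithinAt_id t _)
    have := (hf' (x, t) hxt).comp_hasDerivWithinAt t h1 fun _ _ => ⟨hx, trivial⟩
    exact hasDerivWithinAt_univ.1 this
  have hL' : f' (p, 0) (0, 1) = L := (hder p hp 0 (mem_of_mem_nhdsWithin hps hu)).unique hL
  have hψ : Filter.Tendsto (fun q => f' q (0, 1)) (𝓝[T ×ˢ Set.univ] (p, 0)) (𝓝 L) := by
    rw [← hL']
    exact (hcont.continuousWithinAt).clm_apply continuousWithinAt_const
  rw [Metric.tendsto_nhds]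
  intro η hη
  have h1 : ∀ᶠ q in 𝓝[T ×ˢ Set.univ] (p, (0 : ℝ)), q ∈ u ∧ ‖f' q (0, 1) - L‖ ≤ η / 2 := by
    filter_upwards [hu, (Metric.tendsto_nhds.1 hψ) (η / 2) (by positivity)] with q hq hq'
    exact ⟨hq, by rw [← dist_eq_norm]; exact hq'.le⟩
  obtain ⟨δ, hδ, hball⟩ := Metric.mem_nhdsWithin_iff.1 h1
  filter_upwards [self_mem_nhdsWithin, mem_nhdsWithin_of_mem_nhds (Metric.ball_mem_nhds _ hδ)]
    with ⟨x, t⟩ ⟨hx, ht⟩ hxt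
  have ht : t ≠ 0 := ht
  rw [← ball_prod_same] at hxt hball
  have hkey : ∀ r ∈ Metric.ball (0 : ℝ) δ, (x, r) ∈ u ∧ ‖f' (x, r) (0, 1) - L‖ ≤ η / 2 :=
    fun r hr => hball ⟨⟨hxt.1, hr⟩, hx, trivial⟩
  have hmv := (convex_ball (0 : ℝ) δ).norm_image_sub_le_of_norm_hasDerivWithin_le
    (f := fun r => H (x, r) - r * L) (f' := fun r => f' (x, r) (0, 1) - L) (C := η / 2)
    (fun r hr => ((hder x hx r (hkey r hr).1).sub
      (by simpa using (hasDerivAt_id r).mul_const L)).hasDerivWithinAt)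
    (fun r hr => (hkey r hr).2) (Metric.mem_ball_self hδ) hxt.2
  simp only [h0 x hx, zero_mul, sub_zero] at hmv
  rw [dist_eq_norm, show H (x, t) / t - L = (H (x, t) - t * L) / t by field_simp, norm_div]
  have htpos : 0 < ‖t‖ := norm_pos_iff.2 ht
  calc ‖H (x, t) - t * L‖ / ‖t‖ ≤ η / 2 := by rwa [div_le_iff₀ htpos]
    _ < η := by linarith

lemma IsCurveIn.tendsto {V : Set W} {γ : ℝ → W} {p : W} {w : TangentSpace (𝓡 m) p}
    (hγ : IsCurveIn V γ p w) : Filter.Tendsto γ (𝓝 0) (𝓝[V] p) := by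
  refine tendsto_nhdsWithin_iff.2 ⟨?_, hγ.mem⟩
  have := hγ.smooth.continuousAt.tendsto
  rwa [hγ.left_eq] at this

lemma IsCurveIn.differentiableAt_comp {V S : Set W} {γ : ℝ → W} {p : W}
    {w : TangentSpace (𝓡 m) p} (hγ : IsCurveIn V γ p w) (hS : S ∈ 𝓝[V] p) {f : W → ℝ}
    (hf : ContMDiffOn (𝓡 m) 𝓘(ℝ, ℝ) ∞ f S) : DifferentiableAt ℝ (fun t => f (γ t)) 0 := by
  have hγS : γ ⁻¹' S ∈ 𝓝 (0 : ℝ) := hγ.tendsto hS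
  have h1 : ContMDiffWithinAt 𝓘(ℝ, ℝ) 𝓘(ℝ, ℝ) ∞ (fun t => f (γ t)) (γ ⁻¹' S) 0 :=
    ContMDiffWithinAt.comp (t := S) (g := f) (0 : ℝ)
      (hf _ (show (0 : ℝ) ∈ γ ⁻¹' S from mem_of_mem_nhds hγS))
      hγ.smooth.contMDiffWithinAt fun _ ht => ht
  exact (h1.contDiffWithinAt.contDiffAt hγS).differentiableAt (by simp)

namespace FLIFData

variable {Φ : FLIFData ζ}

namespace Collar

variable (C : Φ.Collar)

lemma contMDiffWithinAt_comp_toFun {G : W → ℝ} (hG : ContMDiffOn (𝓡 m) 𝓘(ℝ, ℝ) ∞ G C.U) {p : W}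
    (hp : p ∈ Φ.Sig) : ContMDiffWithinAt ((𝓡 m).prod 𝓘(ℝ, ℝ)) 𝓘(ℝ, ℝ) ∞
      (fun q : W × ℝ => G (C.toFun q.1 q.2)) (Φ.Sig ×ˢ Set.univ) (p, 0) := by
  have h1 : ContMDiffOn ((𝓡 m).prod 𝓘(ℝ, ℝ)) 𝓘(ℝ, ℝ) ∞
      (fun q : W × ℝ => G (C.toFun q.1 q.2)) (Φ.Sig ×ˢ Set.Icc (-C.ε) C.ε) :=
    hG.comp (C.smooth.mono (Set.prod_mono_right (Set.subset_univ _))) fun q hq => C.mem_U hq.1 hq.2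
  refine (h1 (p, 0) ⟨hp, by linarith [C.ε_pos], C.ε_pos.le⟩).mono_of_mem_nhdsWithin ?_
  rw [nhdsWithin_prod_eq]
  refine Filter.prod_mem_prod self_mem_nhdsWithin (mem_nhdsWithin_of_mem_nhds ?_)
  exact Icc_mem_nhds (by linarith [C.ε_pos]) C.ε_pos

lemma hasDerivAt_comp_toFun {G : W → ℝ} (hG : ContMDiffOn (𝓡 m) 𝓘(ℝ, ℝ) ∞ G C.U) {p : W}
    (hp : p ∈ Φ.Sig) :
    HasDerivAt (fun t => G (C.toFun p t)) (deriv (fun t => G (C.toFun p t)) 0) 0 := by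
  have h1 : ContMDiffWithinAt 𝓘(ℝ, ℝ) 𝓘(ℝ, ℝ) ∞ (fun t => G (C.toFun p t)) Set.univ 0 :=
    ContMDiffWithinAt.comp (t := Φ.Sig ×ˢ Set.univ) (g := fun q : W × ℝ => G (C.toFun q.1 q.2))
      (0 : ℝ) (C.contMDiffWithinAt_comp_toFun hG hp)
      (contMDiffWithinAt_const.prodMk contMDiffWithinAt_id) fun _ _ => ⟨hp, trivial⟩
  exact (h1.contDiffWithinAt.contDiffAt Filter.univ_mem).differentiableAt (by simp) |>.hasDerivAt

lemma tendsto_toFun_div {G : W → ℝ} (hG : ContMDiffOn (𝓡 m) 𝓘(ℝ, ℝ) ∞ G C.U)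
    (h0 : ∀ s ∈ Φ.Sig, G s = 0) {p : W} (hp : p ∈ Φ.Sig) :
    Filter.Tendsto (fun q : W × ℝ => G (C.toFun q.1 q.2) / q.2) (𝓝[Φ.Sig ×ˢ {0}ᶜ] (p, 0))
      (𝓝 (deriv (fun t => G (C.toFun p t)) 0)) := by
  set φ := extChartAt (𝓡 m) p
  have hpφ : φ.symm (φ p) = p := extChartAt_to_inv p
  set T : Set (EuclideanSpace ℝ (Fin m)) := φ.target ∩ φ.symm ⁻¹' Φ.Sig
  have hpT : φ p ∈ T := ⟨mem_extChartAt_target p, by rw [Set.mem_preimage, hpφ]; exact hp⟩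
  let H : EuclideanSpace ℝ (Fin m) × ℝ → ℝ := fun q => G (C.toFun (φ.symm q.1) q.2)
  have hH : ContDiffWithinAt ℝ 1 H (T ×ˢ Set.univ) (φ p, 0) := by
    have h1 : ContMDiffWithinAt 𝓘(ℝ, EuclideanSpace ℝ (Fin m) × ℝ) ((𝓡 m).prod 𝓘(ℝ, ℝ)) ∞
        (fun q : EuclideanSpace ℝ (Fin m) × ℝ => (φ.symm q.1, q.2)) (T ×ˢ Set.univ) (φ p, 0) := by
      refine ContMDiffWithinAt.prodMk ?_ contDiff_snd.contMDiff.contMDiffAt.contMDiffWithinAt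
      refine ContMDiffWithinAt.comp (t := φ.target) (I' := 𝓘(ℝ, EuclideanSpace ℝ (Fin m)))
        (g := φ.symm) (f := Prod.fst) _
        (contMDiffOn_extChartAt_symm p _ (mem_extChartAt_target p))
        contDiff_fst.contMDiff.contMDiffAt.contMDiffWithinAt fun q hq => hq.1.1
    have h2 := ContMDiffWithinAt.comp (t := Φ.Sig ×ˢ Set.univ)
      (g := fun q : W × ℝ => G (C.toFun q.1 q.2)) (φ p, (0 : ℝ))
      (by simp only [hpφ]; exact C.contMDiffWithinAt_comp_toFun hG hp) h1
      fun q hq => ⟨hq.1.2, trivial⟩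
    exact h2.contDiffWithinAt.of_le (by simp)
  have hH0 : ∀ u ∈ T, H (u, 0) = 0 := fun u hu => by
    simp only [H]
    rw [C.map_zero _ hu.2]
    exact h0 _ hu.2
  have key := tendsto_div_snd hpT hH hH0 (by
    simp only [H, hpφ]; exact C.hasDerivAt_comp_toFun hG hp)
  have hsrc : ∀ᶠ q : W × ℝ in 𝓝[Φ.Sig ×ˢ {0}ᶜ] (p, (0 : ℝ)), q.1 ∈ φ.source :=
    (continuous_fst.continuousWithinAt (x := (p, (0 : ℝ)))).eventually_mem (extChartAt_source_mem_nhds p)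
  have hφ : Filter.Tendsto (fun q : W × ℝ => (φ q.1, q.2)) (𝓝[Φ.Sig ×ˢ {0}ᶜ] (p, 0))
      (𝓝[T ×ˢ {0}ᶜ] (φ p, 0)) := by
    refine tendsto_nhdsWithin_iff.2 ⟨?_, ?_⟩
    · refine Filter.Tendsto.mono_left ?_ nhdsWithin_le_nhds
      rw [nhds_prod_eq, nhds_prod_eq]
      exact (continuousAt_extChartAt p).tendsto.prodMap Filter.tendsto_id
    · filter_upwards [hsrc, self_mem_nhdsWithin] with q hq hqS
      refine ⟨⟨φ.map_source hq, ?_⟩, hqS.2⟩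
      rw [Set.mem_preimage, φ.left_inv hq]
      exact hqS.1
  refine (key.comp hφ).congr' ?_
  filter_upwards [hsrc] with q hq
  simp only [Function.comp, H, φ.left_inv hq]

lemma image_mem_nhdsWithin {p : W} (hp : p ∈ Φ.Sig) :
    (fun q : W × ℝ => C.toFun q.1 q.2) '' (Φ.Sig ×ˢ Set.univ) ∈ 𝓝[Φ.V] p := by
  obtain ⟨O, hO, himg⟩ := C.open_image
  have hx : p ∈ (fun q : W × ℝ => C.toFun q.1 q.2) '' (Φ.Sig ×ˢ Set.univ) :=
    ⟨(p, 0), ⟨hp, trivial⟩, C.map_zero p hp⟩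
  rw [himg] at hx ⊢
  exact Filter.inter_mem self_mem_nhdsWithin (mem_nhdsWithin_of_mem_nhds (hO.mem_nhds hx.2))

/-- Near `Σ`, a smooth function on `U` which vanishes on `Σ` is divisible by the collar
coordinate. -/
lemma tendsto_div_coord {G : W → ℝ} (hG : ContMDiffOn (𝓡 m) 𝓘(ℝ, ℝ) ∞ G C.U)
    (h0 : ∀ s ∈ Φ.Sig, G s = 0) {p : W} (hp : p ∈ Φ.Sig) :
    Filter.Tendsto (fun x => G x / C.coord x) (𝓝[Φ.V \ Φ.Sig] p)
      (𝓝 (deriv (fun t => G (C.toFun p t)) 0)) := by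
  have himg := C.image_mem_nhdsWithin hp
  have hp' : p ∈ (fun q : W × ℝ => C.toFun q.1 q.2) '' (Φ.Sig ×ˢ Set.univ) :=
    mem_of_mem_nhdsWithin hp.1 himg
  have hle : 𝓝[Φ.V \ Φ.Sig] p ≤ 𝓝[(fun q : W × ℝ => C.toFun q.1 q.2) '' (Φ.Sig ×ˢ Set.univ)] p :=
    (nhdsWithin_mono p Set.sdiff_subset).trans (nhdsWithin_le_iff.2 himg)
  have hb : Filter.Tendsto C.base (𝓝[Φ.V \ Φ.Sig] p) (𝓝 p) := by
    have := C.base_smooth.continuousOn p hp'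
    have hbp : C.base p = p := by conv_lhs => rw [← C.map_zero p hp]; exact C.base_map p hp 0
    rw [ContinuousWithinAt, hbp] at this
    exact this.mono_left hle
  have hc : Filter.Tendsto C.coord (𝓝[Φ.V \ Φ.Sig] p) (𝓝 0) := by
    have := C.coord_smooth.continuousOn p hp'
    have hbp : C.coord p = 0 := by conv_lhs => rw [← C.map_zero p hp]; exact C.coord_map p hp 0
    rw [ContinuousWithinAt, hbp] at this
    exact this.mono_left hle
  have himg' : ∀ᶠ x in 𝓝[Φ.V \ Φ.Sig] p, ∃ s ∈ Φ.Sig, ∃ t ≠ 0, C.toFun s t = x := by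
    filter_upwards [hle self_mem_nhdsWithin, self_mem_nhdsWithin] with x hx hxS
    obtain ⟨⟨s, t⟩, ⟨hs, -⟩, rfl⟩ := hx
    exact ⟨s, hs, t, fun h => hxS.2 ((C.toFun_mem_Sig_iff hs t).2 h), rfl⟩
  refine ((C.tendsto_toFun_div hG h0 hp).comp (tendsto_nhdsWithin_iff.2
    ⟨by rw [nhds_prod_eq]; exact hb.prodMk hc, ?_⟩)).congr' ?_
  · filter_upwards [himg'] with x hx
    obtain ⟨s, hs, t, ht, rfl⟩ := hx
    rw [C.base_map s hs, C.coord_map s hs]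
    exact ⟨hs, ht⟩
  · filter_upwards [himg'] with x hx
    obtain ⟨s, hs, t, ht, rfl⟩ := hx
    simp only [Function.comp, C.base_map s hs, C.coord_map s hs]

/-- Continuity on a subset of `V` may be checked on the tube and on its complement, where only the
boundary of the tube has to be considered as well. -/
lemma continuousOn_of_tube {Y : Type*} [TopologicalSpace Y] {f : W → Y} {S : Set W} (hS : S ⊆ Φ.V)
    (h1 : ContinuousOn f (S ∩ C.U))
    (h2 : ∀ x ∈ S, C.U ∉ 𝓝[Φ.V] x → ContinuousWithinAt f (S \ C.U) x) : ContinuousOn f S := by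
  intro x hx
  rw [← Set.inter_union_sdiff S C.U, continuousWithinAt_union]
  constructor
  · by_cases hU : x ∈ C.U
    · exact h1 x ⟨hx, hU⟩
    · have hbot : 𝓝[S ∩ C.U] x = ⊥ := by
        rw [← Filter.empty_mem_iff_bot]
        filter_upwards [nhdsWithin_mono x (Set.inter_subset_left.trans hS)
          (C.compl_U_mem_nhdsWithin (hS hx) hU), self_mem_nhdsWithin] with y hy hy' using hy hy'.2
      rw [ContinuousWithinAt, hbot]
      exact Filter.tendsto_bot
  · by_cases hU : C.U ∈ 𝓝[Φ.V] x
    · have hbot : 𝓝[S \ C.U] x = ⊥ := by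
        rw [← Filter.empty_mem_iff_bot]
        filter_upwards [nhdsWithin_mono x (Set.sdiff_subset.trans hS) hU, self_mem_nhdsWithin]
          with y hy hy' using hy'.2 hy
      rw [ContinuousWithinAt, hbot]
      exact Filter.tendsto_bot
    · exact h2 x hx hU

include C in
lemma subset_closure_diff : Φ.V ⊆ closure (Φ.V \ Φ.Sig) := by
  intro x hx
  by_cases hxS : x ∈ Φ.Sig
  · have h1 : Filter.Tendsto (C.toFun x) (𝓝[≠] 0) (𝓝 x) := by
      have := (C.toFun_smooth hxS).continuous.tendsto 0
      rw [C.map_zero x hxS] at this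
      exact this.mono_left nhdsWithin_le_nhds
    refine mem_closure_of_tendsto h1 ?_
    filter_upwards [self_mem_nhdsWithin] with t ht
    exact ⟨C.map_mem x hxS t, fun h => ht ((C.toFun_mem_Sig_iff hxS t).1 h)⟩
  · exact subset_closure ⟨hx, hxS⟩

end Collar

namespace IsFLIF

variable (hΦ : Φ.IsFLIF n) (C : Φ.TwistChoices)

lemma sinAmp_smooth : ContMDiffOn (𝓡 m) 𝓘(ℝ, ℝ) ∞ (fun x => C.cT x * Real.sin (C.θ x)) C.U :=
  C.cT_smooth.mul (Real.contDiff_sin.contMDiff.comp_contMDiffOn C.θ_smooth)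

/-- The function `c̃ sin θ` vanishes to first order along `Σ`. -/
lemma deriv_sinAmp_ne_zero {p : W} (hp : p ∈ Φ.Sig) :
    deriv (fun t => C.cT (C.toFun p t) * Real.sin (C.θ (C.toFun p t))) 0 ≠ 0 := by
  have h1 := C.hasDerivAt_comp_toFun C.cT_smooth hp
  have h2 := (C.hasDerivAt_comp_toFun C.θ_smooth hp).sin
  have hU := C.Sig_subset_U hp
  have hθ : C.θ (C.toFun p 0) = 0 := by rw [C.map_zero p hp]; exact (C.θ_zero p hU).2 hp
  rw [(h1.fun_mul h2).deriv, hθ, Real.sin_zero, Real.cos_zero, mul_zero, zero_add, one_mul,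
    C.map_zero p hp]
  exact mul_ne_zero (C.cT_pos p hU).ne' (C.θ_regular p hp)

/-- On the boundary of the tube `c` is `± c̃` and `sin θ` is `± 1`. -/
lemma eq_sinAmp_of_notMem_nhdsWithin {x : W} (hx : x ∈ C.U) (hxU : C.U ∉ 𝓝[Φ.V] x) :
    C.c x = C.cT x * Real.sin (C.θ x) ∧ C.c x ≠ 0 := by
  have hcT := (C.cT_pos _ hx).ne'
  obtain ⟨⟨s, t⟩, ⟨hs, ht⟩, rfl⟩ := hx
  dsimp only at hcT hxU ⊢
  rcases eq_or_ne t C.ε with rfl | h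
  · rw [C.theta_top_eq hs, Real.sin_pi_div_two, mul_one, ← C.cT_top s hs]
    exact ⟨rfl, hcT⟩
  · have : t = -C.ε := by
      by_contra h'
      exact hxU (C.U_mem_nhdsWithin hs
        ⟨lt_of_le_of_ne ht.1 (Ne.symm h'), lt_of_le_of_ne ht.2 h⟩)
    subst this
    have h2 := C.cT_bot s hs
    rw [C.theta_bot_eq hs, Real.sin_neg, Real.sin_pi_div_two, mul_neg, mul_one, h2, neg_neg]
    exact ⟨rfl, fun h0 => hcT (by rw [h2, h0, neg_zero])⟩

include hΦ

/-- The eigenvalue `c` vanishes to first order along `Σ`: otherwise `det Φ2`, a multiple of `c`,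
would vanish to second order. -/
lemma deriv_c_ne_zero {p : W} (hp : p ∈ Φ.Sig) : deriv (fun t => C.c (C.toFun p t)) 0 ≠ 0 := by
  intro hd
  obtain ⟨w, γ, hγ, hγd⟩ := hΦ.Φ2_transverse p hp
  have hlim := C.tendsto_div_coord (hΦ.c_smooth C) (fun s hs => hΦ.c_eq_zero C hs) hp
  rw [hd] at hlim
  have hγV := hγ.tendsto
  have hcoord := (hγ.differentiableAt_comp (C.image_mem_nhdsWithin hp) C.coord_smooth).hasDerivAt.isBigO_sub
  have hcoord0 : C.coord p = 0 := by
    conv_lhs => rw [← C.map_zero p hp]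
    exact C.coord_map p hp 0
  simp only [hγ.left_eq, hcoord0, sub_zero] at hcoord
  -- on `Σ` the quotient is `0 / 0 = 0`
  have hr : Filter.Tendsto (fun x => C.c x / C.coord x) (𝓝[Φ.V] p) (𝓝 0) := by
    rw [← Set.sdiff_union_of_subset (fun s hs => hs.1 : Φ.Sig ⊆ Φ.V), nhdsWithin_union]
    refine hlim.sup (tendsto_const_nhds.congr' ?_)
    filter_upwards [self_mem_nhdsWithin] with s hs
    rw [hΦ.c_eq_zero C hs, zero_div]
  have hmul : (fun t => C.c (γ t)) =ᶠ[𝓝 0] fun t => C.c (γ t) / C.coord (γ t) * C.coord (γ t) := by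
    filter_upwards [hγV (C.image_mem_nhdsWithin hp)] with t ht
    obtain ⟨⟨s, r⟩, ⟨hs, -⟩, hst⟩ := ht
    simp only at hst
    by_cases hr : r = 0
    · rw [← hst, hr, C.map_zero s hs, hΦ.c_eq_zero C hs, zero_div, zero_mul]
    · rw [div_mul_cancel₀]
      rwa [← hst, C.coord_map s hs]
  have hc : HasDerivAt (fun t => C.c (γ t)) 0 0 := by
    rw [hasDerivAt_iff_isLittleO]
    simp only [hγ.left_eq, hΦ.c_eq_zero C hp, sub_zero, smul_zero]
    have h1 : (fun t => C.c (γ t) / C.coord (γ t)) =o[𝓝 (0 : ℝ)] fun _ => (1 : ℝ) :=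
      (Asymptotics.isLittleO_one_iff ℝ).2 (hr.comp hγV)
    have h2 := h1.mul_isBigO hcoord
    simp only [one_mul] at h2
    exact h2.congr' hmul.symm .rfl
  have hdet := (hγ.differentiableAt_comp (C.U_mem_nhdsWithin_of_mem_Sig hp) (hΦ.det_modify_smooth C)).hasDerivAt
  have hprod := hc.mul hdet
  simp only [hγ.left_eq, hΦ.c_eq_zero C hp, zero_mul, zero_add] at hprod
  refine hγd ((hprod.congr_of_eventuallyEq ?_).deriv)
  filter_upwards [hγV (C.U_mem_nhdsWithin_of_mem_Sig hp)] with t ht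
  exact hΦ.det_Φ2 C ht

/-- The quotient of `c` by `c̃ sin θ` extends over `Σ` and, by the constant `1`, over `V` to a
positive continuous function. -/
lemma exists_ratio : ∃ h : W → ℝ, ContinuousOn h Φ.V ∧ (∀ x ∈ Φ.V, 0 < h x) ∧
    (∀ x ∈ C.U, h x * (C.cT x * Real.sin (C.θ x)) = C.c x) ∧ ∀ x ∈ Φ.V, x ∉ C.U → h x = 1 := by
  classical
  set k : W → ℝ := fun x => if x ∈ C.U then C.c x / (C.cT x * Real.sin (C.θ x)) else 1 with hk
  have hkU : ∀ x ∈ C.U, k x = C.c x / (C.cT x * Real.sin (C.θ x)) := fun x hx => if_pos hx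
  have hkU' : ∀ x ∉ C.U, k x = 1 := fun x hx => if_neg hx
  have hamp : ∀ x ∈ C.U, x ∉ Φ.Sig → C.cT x * Real.sin (C.θ x) ≠ 0 := fun x hx hxS =>
    mul_ne_zero (C.cT_pos x hx).ne' fun h => hxS ((C.sin_eq_zero_iff hx).1 h)
  have hpos : ∀ x ∈ Φ.V \ Φ.Sig, 0 < k x := by
    intro x hx
    by_cases hU : x ∈ C.U
    · rw [hkU x hU]; exact hΦ.div_sinAmp_pos C hU hx.2
    · rw [hkU' x hU]; exact one_pos
  have hcont : ContinuousOn k (Φ.V \ Φ.Sig) := by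
    refine C.continuousOn_of_tube Set.sdiff_subset ?_ fun x hx hxU => ?_
    · have hsub : Φ.V \ Φ.Sig ∩ C.U ⊆ C.U := Set.inter_subset_right
      exact (((hΦ.c_smooth C).continuousOn.mono hsub).div
        ((sinAmp_smooth C).continuousOn.mono hsub)
        fun y hy => hamp y hy.2 hy.1.2).congr fun y hy => hkU y hy.2
    · have h1 : k x = 1 := by
        by_cases hU : x ∈ C.U
        · obtain ⟨h2, h3⟩ := eq_sinAmp_of_notMem_nhdsWithin C hU hxU
          rw [hkU x hU, ← h2, div_self h3]
        · exact hkU' x hU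
      exact (continuousWithinAt_const (b := (1 : ℝ))).congr (fun y hy => hkU' y hy.2) h1
  have hlim : ∀ p ∈ Φ.Sig, ∃ l, 0 < l ∧ Filter.Tendsto k (𝓝[Φ.V \ Φ.Sig] p) (𝓝 l) := by
    intro p hp
    have h1 := C.tendsto_div_coord (hΦ.c_smooth C) (fun s hs => hΦ.c_eq_zero C hs) hp
    have h2 := C.tendsto_div_coord (sinAmp_smooth C) (fun s hs => by
      rw [(C.sin_eq_zero_iff (C.Sig_subset_U hs)).2 hs, mul_zero]) hp
    have hne := deriv_sinAmp_ne_zero C hp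
    have h3 : Filter.Tendsto k (𝓝[Φ.V \ Φ.Sig] p) (𝓝 (deriv (fun t => C.c (C.toFun p t)) 0 /
        deriv (fun t => C.cT (C.toFun p t) * Real.sin (C.θ (C.toFun p t))) 0)) := by
      refine (h1.div h2 hne).congr' ?_
      filter_upwards [nhdsWithin_mono p Set.sdiff_subset (C.U_mem_nhdsWithin_of_mem_Sig hp),
        nhdsWithin_mono p Set.sdiff_subset (C.image_mem_nhdsWithin hp), self_mem_nhdsWithin]
        with x hxU hx hxS
      obtain ⟨⟨s, t⟩, ⟨hs, -⟩, rfl⟩ := hx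
      have ht : t ≠ 0 := fun h => hxS.2 ((C.toFun_mem_Sig_iff hs t).2 h)
      rw [Pi.div_apply, hkU _ hxU]
      exact div_div_div_cancel_right₀ (by rwa [C.coord_map s hs]) _ _
    have hne' := div_ne_zero (hΦ.deriv_c_ne_zero C hp) hne
    have : (𝓝[Φ.V \ Φ.Sig] p).NeBot := mem_closure_iff_nhdsWithin_neBot.1 (C.subset_closure_diff hp.1)
    refine ⟨_, lt_of_le_of_ne (ge_of_tendsto h3 ?_) hne'.symm, h3⟩
    filter_upwards [self_mem_nhdsWithin] with x hx using (hpos x hx).le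
  have hext : ∀ x ∈ Φ.V \ Φ.Sig, extendFrom (Φ.V \ Φ.Sig) k x = k x := fun x hx =>
    extendFrom_eq (C.subset_closure_diff hx.1) (hcont x hx)
  refine ⟨extendFrom (Φ.V \ Φ.Sig) k, continuousOn_extendFrom C.subset_closure_diff fun x hx => ?_,
    fun x hx => ?_, fun x hx => ?_, fun x hx hxU => ?_⟩
  · by_cases hxS : x ∈ Φ.Sig
    · obtain ⟨l, -, hl⟩ := hlim x hxS
      exact ⟨l, hl⟩
    · exact ⟨_, hcont x ⟨hx, hxS⟩⟩
  · by_cases hxS : x ∈ Φ.Sig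
    · obtain ⟨l, hl0, hl⟩ := hlim x hxS
      rwa [extendFrom_eq (C.subset_closure_diff hx) hl]
    · rw [hext x ⟨hx, hxS⟩]
      exact hpos x ⟨hx, hxS⟩
  · by_cases hxS : x ∈ Φ.Sig
    · rw [(C.sin_eq_zero_iff hx).2 hxS, hΦ.c_eq_zero C hxS, mul_zero, mul_zero]
    · rw [hext x ⟨C.U_subset_V hx, hxS⟩, hkU x hx, div_mul_cancel₀ _ (hamp x hx hxS)]
  · rw [hext x ⟨hx, fun h => hxU (C.Sig_subset_U h)⟩, hkU' x hxU]

omit hΦ in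
/-- The angle `θ` increases through zero along the fibres of the collar. -/
lemma deriv_theta_pos {p : W} (hp : p ∈ Φ.Sig) : 0 < deriv (fun t => C.θ (C.toFun p t)) 0 := by
  refine lt_of_le_of_ne (ge_of_tendsto
    (C.hasDerivAt_comp_toFun C.θ_smooth hp).tendsto_slope_zero_right ?_) (C.θ_regular p hp).symm
  filter_upwards [Ioc_mem_nhdsGT C.ε_pos] with t ht
  rw [zero_add, C.map_zero p hp, (C.θ_zero p (C.Sig_subset_U hp)).2 hp, sub_zero]
  exact smul_nonneg (inv_nonneg.2 ht.1.le) (C.theta_pos hp ht).le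

end IsFLIF

end FLIFData

/-! ### The push-forward to the twisted normal bundle is prepared -/

lemma tangentTo_mono {S T : Set W} (h : S ⊆ T) (p : W) :
    tangentTo (m := m) S p ≤ tangentTo T p :=
  Submodule.span_mono fun _ ⟨c, hc⟩ => ⟨c, hc.smooth, hc.mem.mono fun _ ht => h ht, hc.velocity_eq⟩

/-- A covector at `p` which annihilates a distribution extends to a smooth form near `p` which
annihilates the distribution. -/
lemma LocalFrame.exists_annihilating_form {O : Set W} (L : LocalFrame n ζ O) {p : W} (hp : p ∈ O)
    (ℓ : TangentSpace (𝓡 m) p →L[ℝ] ℝ) (hℓ : ∀ w ∈ ζ p, ℓ w = 0) :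
    ∃ (O' : Set W) (α : ∀ x : W, TangentSpace (𝓡 m) x →L[ℝ] ℝ), IsOpen O' ∧ p ∈ O' ∧
      SmoothForm O' α ∧ (∀ x ∈ O', ∀ w ∈ ζ x, α x w = 0) ∧ α p = ℓ := by
  obtain ⟨A, β, hA, hpA, hβ, hβp⟩ := exists_smoothForm p ℓ
  refine ⟨O ∩ A, fun x => β x - ∑ i, β x (L.e i x : TangentSpace (𝓡 m) x) • L.κ i x,
    L.isOpen.inter hA, ⟨hp, hpA⟩, ?_, fun x hx w hw => ?_, ?_⟩
  · exact (hβ.mono Set.inter_subset_right).sub (SmoothForm.sum fun i _ => SmoothForm.smul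
      (hβ.apply le_rfl Set.inter_subset_right ((L.e_smooth i).mono Set.inter_subset_left))
      ((L.κ_smooth i).mono Set.inter_subset_left))
  · have h1 := congrArg (β x) (L.expand_coe hx.1 ⟨w, hw⟩)
    simp only [map_sum, map_smul, smul_eq_mul] at h1
    simp only [sub_apply, sum_apply,
      smul_apply, smul_eq_mul]
    rw [h1, sub_eq_zero]
    exact Finset.sum_congr rfl fun i _ => mul_comm _ _
  · change β p - _ = ℓ
    rw [hβp]
    simp [hℓ]

namespace FLIFData

variable {Φ : FLIFData ζ}

/-- The index coorientation depends on the ray of the vector only, as curves may be reparametrized. -/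
lemma IsIndexCoorientation.smul {s : W} {w : TangentSpace (𝓡 m) s}
    (h : Φ.IsIndexCoorientation s w) {a : ℝ} (ha : 0 < a) : Φ.IsIndexCoorientation s (a • w) := by
  refine ⟨Submodule.smul_mem _ _ h.1, fun h' => h.2.1 ?_, fun c hc => ?_⟩
  · rwa [Submodule.smul_mem_iff _ ha.ne'] at h'
  · have h1 := hc.comp_mul a⁻¹
    rw [inv_smul_smul₀ ha.ne'] at h1
    obtain ⟨hr, hl⟩ := h.2.2 _ h1
    have hcont : Filter.Tendsto (fun t : ℝ => a * t) (𝓝 0) (𝓝 0) :=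
      (by fun_prop : Continuous fun t : ℝ => a * t).tendsto' 0 0 (mul_zero a)
    have hr' : Filter.Tendsto (fun t : ℝ => a * t) (𝓝[>] 0) (𝓝[>] 0) :=
      tendsto_nhdsWithin_iff.2 ⟨hcont.mono_left nhdsWithin_le_nhds, by
        filter_upwards [self_mem_nhdsWithin] with t ht using mul_pos ha ht⟩
    have hl' : Filter.Tendsto (fun t : ℝ => a * t) (𝓝[<] 0) (𝓝[<] 0) :=
      tendsto_nhdsWithin_iff.2 ⟨hcont.mono_left nhdsWithin_le_nhds, by
        filter_upwards [self_mem_nhdsWithin] with t ht using mul_neg_of_pos_of_neg ha ht⟩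
    constructor
    · filter_upwards [hr'.eventually hr] with t ht
      rwa [inv_mul_cancel_left₀ ha.ne'] at ht
    · filter_upwards [hl'.eventually hl] with t ht
      rwa [inv_mul_cancel_left₀ ha.ne'] at ht

lemma IsIndexCoorientation.push {N : Set W} {F : ∀ x : W, ζ x →ₗ[ℝ] TangentSpace (𝓡 m) x}
    (hVN : Φ.V ⊆ N) (hNdom : N ⊆ Φ.dom) (hF : IsBundleMonoOn N F) {s : W} (hs : s ∈ Φ.V)
    {w : TangentSpace (𝓡 m) s} (h : Φ.IsIndexCoorientation s w) :
    (Φ.push N F).IsIndexCoorientation s w := by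
  rw [IsIndexCoorientation, push_V hVN hNdom hF, push_Sig hVN hNdom hF,
    push_index (hF.1 s (hVN hs))]
  refine ⟨h.1, h.2.1, fun c hc => ?_⟩
  obtain ⟨hr, hl⟩ := h.2.2 c hc
  constructor
  · filter_upwards [hr, nhdsWithin_le_nhds hc.mem] with t ht htV
    rwa [push_index (hF.1 _ (hVN htV))]
  · filter_upwards [hl, nhdsWithin_le_nhds hc.mem] with t ht htV
    rwa [push_index (hF.1 _ (hVN htV))]

namespace IsFLIF

variable {C : Φ.TwistChoices} {g : Metric m W} {N : Set W}
  {F : ∀ x : W, ζ x →ₗ[ℝ] TangentSpace (𝓡 m) x}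

lemma map_lamT (hFΔ : ∀ v ∈ Φ.V, ∀ z : ζ v, F v z = C.delta g v z) {x : W} (hx : x ∈ C.U) :
    F x (C.lamT x) = C.cT x • C.muPlus g x := by
  rw [hFΔ x (C.U_subset_V hx), TwistChoices.delta, if_pos hx, C.lamT_unit x hx, one_smul, sub_self,
    map_zero, gammaInv_zero, zero_add, one_smul]

lemma map_lam (hFΔ : ∀ v ∈ Φ.V, ∀ z : ζ v, F v z = C.delta g v z) {s : W} (hs : s ∈ Φ.Sig) :
    F s (Φ.lam s) = C.cT s • C.τ s := by
  have hU := C.Sig_subset_U hs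
  rw [← C.lamT_eq s hs, map_lamT hFΔ hU, TwistChoices.muPlus, (C.θ_zero s hU).2 hs, Real.sin_zero,
    Real.cos_zero, zero_smul, zero_add, one_smul]

variable (hΦ : Φ.IsFLIF n)
include hΦ

lemma gammaHat_map (hFΔ : ∀ v ∈ Φ.V, ∀ z : ζ v, F v z = C.delta g v z) {x : W} (hx : x ∈ Φ.V)
    (z : ζ x) : Φ.gammaHat x (F x z) = C.twist x z := by
  rw [hFΔ x hx, hΦ.gammaHat_delta C g hx]

lemma map_mem_tangentTo_iff (hFΔ : ∀ v ∈ Φ.V, ∀ z : ζ v, F v z = C.delta g v z) {x : W}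
    (hx : x ∈ Φ.V) (z : ζ x) : F x z ∈ tangentTo Φ.V x ↔ C.twist x z = 0 := by
  rw [hΦ.mem_tangentTo_iff hx, hΦ.gammaHat_map hFΔ hx, ZeroMemClass.coe_eq_zero]

lemma tangentTo_inf_range (hFΔ : ∀ v ∈ Φ.V, ∀ z : ζ v, F v z = C.delta g v z) {s : W}
    (hs : s ∈ Φ.Sig) :
    tangentTo Φ.V s ⊓ LinearMap.range (F s) = Submodule.span ℝ {F s (Φ.lam s)} := by
  apply le_antisymm
  · rintro _ ⟨h, z, rfl⟩
    rw [SetLike.mem_coe, hΦ.map_mem_tangentTo_iff hFΔ hs.1, hΦ.twist_of_mem_Sig C hs] at h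
    obtain ⟨a, rfl⟩ := hΦ.exists_eq_smul_lamT C hs h
    rw [map_smul, C.lamT_eq s hs]
    exact Submodule.smul_mem _ _ (Submodule.mem_span_singleton_self _)
  · rw [Submodule.span_singleton_le_iff_mem]
    refine ⟨?_, ⟨_, rfl⟩⟩
    rw [SetLike.mem_coe, hΦ.map_mem_tangentTo_iff hFΔ hs.1, hΦ.twist_of_mem_Sig C hs,
      hΦ.lam_ker s hs]

/-- On the part of the tube where `|θ| < π/2` the field `τ` is smooth, being a combination of the
smooth fields `F(λ̃⁺)` and `Γ⁻¹(λ̃⁺)`. -/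
lemma tau_fieldOn (hVN : Φ.V ⊆ N) (hNdom : N ⊆ Φ.dom) (hF : IsBundleMonoOn N F)
    (hFΔ : ∀ v ∈ Φ.V, ∀ z : ζ v, F v z = C.delta g v z) :
    FieldOn ∞ {x | x ∈ C.U ∧ Real.cos (C.θ x) ≠ 0} C.τ := by
  have hsub : {x | x ∈ C.U ∧ Real.cos (C.θ x) ≠ 0} ⊆ C.U := fun x hx => hx.1
  have hl : FieldOn ∞ {x | x ∈ C.U ∧ Real.cos (C.θ x) ≠ 0}
      (fun x => (C.lamT x : TangentSpace (𝓡 m) x)) := FieldOn.mono C.lamT_smooth hsub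
  have hθ := C.θ_smooth.mono hsub
  refine (FieldOn.smul (f := fun x => (Real.cos (C.θ x))⁻¹)
    (contMDiffOn_inv (Real.contDiff_cos.contMDiff.comp_contMDiffOn hθ) fun x hx => hx.2)
    ((FieldOn.smul (f := fun x => (C.cT x)⁻¹)
      (contMDiffOn_inv (C.cT_smooth.mono hsub) fun x hx => (C.cT_pos x hx.1).ne')
      (hΦ.F_fieldOn hNdom hF le_rfl ((hsub.trans C.U_subset_V).trans hVN) hl)).sub
    (FieldOn.smul (f := fun x => Real.sin (C.θ x)) (Real.contDiff_sin.contMDiff.comp_contMDiffOn hθ)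
      (hΦ.gammaInv_fieldOn g le_rfl (hsub.trans C.U_subset_V) hl)))).congr fun x hx => ?_
  rw [map_lamT hFΔ hx.1, inv_smul_smul₀ (C.cT_pos x hx.1).ne', TwistChoices.muPlus,
    add_sub_cancel_left, inv_smul_smul₀ hx.2]

/-- At a point of `Σ`, the field `τ` is the vector part of a tangency pair. Since the form of the
pair annihilates `μ⁺`, its value on `τ` is `-tan θ` times its value on `Γ⁻¹(λ̃⁺)`. -/
lemma exists_isTangencyPair (hN : IsOpen N) (hVN : Φ.V ⊆ N) (hNdom : N ⊆ Φ.dom)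
    (hF : IsBundleMonoOn N F) (hFΔ : ∀ v ∈ Φ.V, ∀ z : ζ v, F v z = C.delta g v z) {s : W}
    (hs : s ∈ Φ.Sig) : ∃ α, IsTangencyPair Φ.V (fun x => LinearMap.range (F x)) s α C.τ ∧
      0 < α s (Φ.gammaInv g s (Φ.lam s)) ∧
      deriv (fun t => α (C.toFun s t) (C.τ (C.toFun s t))) 0 < 0 := by
  have hU := C.Sig_subset_U hs
  have hmulam : ∀ w : TangentSpace (𝓡 m) s, Φ.gammaHat s w ∈ ζ s := hΦ.gammaHat_mem hs.1
  have : T2Space (TangentSpace (𝓡 m) s) := inferInstanceAs (T2Space (EuclideanSpace ℝ (Fin m)))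
  let ℓ : TangentSpace (𝓡 m) s →L[ℝ] ℝ := LinearMap.toContinuousLinearMap
    (((Φ.metric s).flip (Φ.lam s)) ∘ₗ (Φ.gammaHat s).toLinearMap.codRestrict (ζ s) hmulam)
  have hℓ : ∀ (w : TangentSpace (𝓡 m) s) (z : ζ s), Φ.gammaHat s w = z →
      ℓ w = Φ.metric s z (Φ.lam s) := by
    intro w z hz
    have : (⟨Φ.gammaHat s w, hmulam w⟩ : ζ s) = z := Subtype.ext hz
    rw [← this]
    rfl
  obtain ⟨O, L, L', hsO, hON, hL'⟩ := hΦ.exists_localFrame_push hN hNdom hF (hVN hs.1)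
  obtain ⟨A, α, hA, hsA, hα, hα0, hαs⟩ := L'.exists_annihilating_form hsO ℓ (by
    rintro _ ⟨z, rfl⟩
    rw [hℓ _ _ (hΦ.gammaHat_map hFΔ hs.1 z), hΦ.twist_of_mem_Sig C hs, hΦ.Φ2_selfAdjoint s hs.1,
      hΦ.lam_ker s hs, map_zero])
  -- `α` is positive on `Γ⁻¹(λ⁺)`, since it is `⟨Γ̂ ·, λ⁺⟩` at `s`
  have hαn : α s (Φ.gammaInv g s (Φ.lam s)) = 1 := by
    rw [hαs, hℓ _ _ (hΦ.gammaInv_spec g hs.1 _).2, hΦ.lam_unit s hs]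
  have hτ0 : C.τ s ≠ 0 := fun h => (C.index_coorientation s hs).2.1 (h ▸ Submodule.zero_mem _)
  have hcos : {x | x ∈ C.U ∧ Real.cos (C.θ x) ≠ 0} ∈ 𝓝[Φ.V] s := by
    have h1 : ContinuousWithinAt (fun x => Real.cos (C.θ x)) Φ.V s :=
      ((Real.continuous_cos.comp_continuousOn C.θ_smooth.continuousOn) s hU).mono_of_mem_nhdsWithin
        (C.U_mem_nhdsWithin_of_mem_Sig hs)
    have h2 : Real.cos (C.θ s) ≠ 0 := by rw [(C.θ_zero s hU).2 hs]; simp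
    filter_upwards [C.U_mem_nhdsWithin_of_mem_Sig hs, h1.eventually_ne h2] with x hx hx'
      using ⟨hx, hx'⟩
  obtain ⟨B, hB, hsB, hBsub⟩ := mem_nhdsWithin.1 hcos
  refine ⟨α, ⟨⟨A ∩ B, hA.inter hB, ⟨hsA, hsB⟩, hα.mono Set.inter_subset_left,
    fun x hx => hα0 x hx.1, ?_, ?_⟩, ?_, ?_, hτ0, ?_⟩, by rw [hαn]; exact one_pos, ?_⟩
  · exact (hΦ.tau_fieldOn hVN hNdom hF hFΔ).mono fun x hx => hBsub ⟨hx.2.2, hx.1⟩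
  · exact fun x hx => C.tau_mem_of_mem_U (hBsub ⟨hx.2.2, hx.1⟩).1
  · intro h
    rw [h] at hαn
    exact zero_ne_one hαn
  · intro w hw
    rw [hαs, hℓ w 0 ((hΦ.mem_tangentTo_iff hs.1 w).1 hw), map_zero, LinearMap.zero_apply]
  · have h1 := map_lam hFΔ hs
    refine ⟨(C.cT s)⁻¹ • Φ.lam s, ?_⟩
    rw [map_smul, h1, inv_smul_smul₀ (C.cT_pos s hU).ne']
  · have hcurve := C.isCurveIn_zero hs
    have hS : C.U ∩ A ∈ 𝓝[Φ.V] s := Filter.inter_mem (C.U_mem_nhdsWithin_of_mem_Sig hs)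
      (mem_nhdsWithin_of_mem_nhds (hA.mem_nhds hsA))
    have hsm : ContMDiffOn (𝓡 m) 𝓘(ℝ, ℝ) ∞ (fun x => α x (Φ.gammaInv g x (C.lamT x))) (C.U ∩ A) :=
      hα.apply le_rfl Set.inter_subset_right (FieldOn.mono
        (hΦ.gammaInv_fieldOn g le_rfl C.U_subset_V C.lamT_smooth) Set.inter_subset_left)
    have ha := (hcurve.differentiableAt_comp hS hsm).hasDerivAt
    have hθ0 : C.θ (C.toFun s 0) = 0 := by rw [C.map_zero s hs]; exact (C.θ_zero s hU).2 hs
    have htan := HasDerivAt.comp (0 : ℝ)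
      (Real.hasDerivAt_tan (x := C.θ (C.toFun s 0)) (by rw [hθ0]; simp))
      (C.hasDerivAt_comp_toFun C.θ_smooth hs)
    have hprod := (htan.mul ha).neg
    have heq : (fun t => α (C.toFun s t) (C.τ (C.toFun s t))) =ᶠ[𝓝 0]
        -((Real.tan ∘ fun t => C.θ (C.toFun s t)) *
          fun t => α (C.toFun s t) (Φ.gammaInv g (C.toFun s t) (C.lamT (C.toFun s t)))) := by
      filter_upwards [hcurve.tendsto hcos, hcurve.tendsto hS] with t ht htA
      have h1 := hα0 _ htA.2 _ ⟨C.lamT (C.toFun s t), rfl⟩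
      rw [map_lamT hFΔ ht.1, map_smul, smul_eq_mul, TwistChoices.muPlus, map_add, map_smul, map_smul,
        smul_eq_mul, smul_eq_mul] at h1
      have h2 := (mul_eq_zero.1 h1).resolve_left (C.cT_pos _ ht.1).ne'
      have hc := ht.2
      simp only [Pi.neg_apply, Pi.mul_apply, Function.comp, Real.tan_eq_sin_div_cos]
      field_simp
      linarith
    rw [(hprod.congr_of_eventuallyEq heq).deriv]
    simp only [Function.comp, hθ0, Real.tan_zero, Real.cos_zero, zero_mul, add_zero]
    rw [C.map_zero s hs, C.lamT_eq s hs, hαn]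
    have := deriv_theta_pos C hs
    simpa using this

/-- The push-forward of a FLIF to the twisted normal bundle is prepared. -/
lemma push_isPrepared (hN : IsOpen N) (hVN : Φ.V ⊆ N) (hNdom : N ⊆ Φ.dom)
    (hF : IsBundleMonoOn N F) (hFΔ : ∀ v ∈ Φ.V, ∀ z : ζ v, F v z = C.delta g v z) :
    (Φ.push N F).IsPrepared g := by
  have hV := push_V hVN hNdom hF
  have hS := push_Sig hVN hNdom hF
  have hne : ∀ s ∈ Φ.Sig, F s (Φ.lam s) ≠ 0 := by
    intro s hs h
    have h1 := hF.1 s (hVN hs.1) (h.trans (map_zero (F s)).symm)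
    rw [← C.lamT_eq s hs] at h1
    exact C.lamT_ne_zero (C.Sig_subset_U hs) h1
  refine ⟨?_, ?_, ?_, ?_⟩
  · rw [hV, hS]
    refine ⟨fun s hs => hs.1, fun p hp => ⟨fun hpS h => ?_, fun h => ?_⟩, fun s hs => ⟨?_, ?_, ?_⟩⟩
    · rw [hΦ.tangentTo_inf_range hFΔ hpS, Submodule.span_singleton_eq_bot] at h
      exact hne p hpS h
    · by_contra hpS
      refine h ((Submodule.eq_bot_iff _).2 ?_)
      rintro _ ⟨hz, z, rfl⟩
      rw [SetLike.mem_coe, hΦ.map_mem_tangentTo_iff hFΔ hp] at hz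
      rw [hΦ.twist_injective C hp hpS (hz.trans (map_zero _).symm), map_zero]
    · rw [hΦ.tangentTo_inf_range hFΔ hs]
      exact finrank_span_singleton (hne s hs)
    · obtain ⟨α, hα, -, hd⟩ := hΦ.exists_isTangencyPair hN hVN hNdom hF hFΔ hs
      exact ⟨α, C.τ, hα, C.τ s, C.toFun s, C.isCurveIn_zero hs, hd.ne⟩
    · rw [Submodule.eq_bot_iff]
      rintro w ⟨hw, hw'⟩
      have h1 : w ∈ tangentTo Φ.V s ⊓ LinearMap.range (F s) :=
        ⟨tangentTo_mono (fun _ h => h.1) s hw, hw'⟩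
      rw [hΦ.tangentTo_inf_range hFΔ hs, map_lam hFΔ hs] at h1
      obtain ⟨a, rfl⟩ := Submodule.mem_span_singleton.1 h1
      by_contra h0
      rw [smul_smul] at hw h0
      exact (C.index_coorientation s hs).2.1
        ((Submodule.smul_mem_iff _ fun h => h0 (by rw [h, zero_smul])).1 hw)
  · rw [hV, hS]
    exact fun s hs => hΦ.tangentTo_inf_range hFΔ hs
  · rw [hS]
    intro s hs
    have := ((C.index_coorientation s hs).smul (C.cT_pos s (C.Sig_subset_U hs))).push hVN hNdom hF hs.1
    rwa [← map_lam hFΔ hs] at this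
  · rw [hS]
    intro s hs
    obtain ⟨α, hα, hpos, hd⟩ := hΦ.exists_isTangencyPair hN hVN hNdom hF hFΔ hs
    have hspec := hΦ.gammaInv_spec g hs.1 (Φ.lam s)
    refine ⟨Φ.gammaInv g s (Φ.lam s), ?_, ?_, ?_⟩
    · rw [Norm, hV]
      exact hspec.1
    · rw [hΦ.push_gammaHat hN hVN hNdom hF hs.1]
      exact congrArg (F s) (Subtype.ext hspec.2)
    · rw [hV]
      exact ⟨α, C.τ, hα, hpos, C.toFun s, C.isCurveIn_zero hs, hd⟩

end IsFLIF
end FLIFData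

/-! ### The push-forward to the twisted normal bundle is well balanced -/

/-- The path `X + f Y` from continuous fields `X`, `Y` and a function `f` of the parameter is jointly
continuous. -/
lemma FieldOn.continuousOn_path {S : Set W} {X Y : ∀ x : W, TangentSpace (𝓡 m) x}
    (hX : FieldOn 0 S X) (hY : FieldOn 0 S Y) {f : ℝ → ℝ} (hf : Continuous f) (J : Set ℝ) :
    ContinuousOn (fun q : ℝ × W =>
      (⟨q.2, X q.2 + f q.1 • Y q.2⟩ : TangentBundle (𝓡 m) W)) (J ×ˢ S) := by
  rintro ⟨s, p⟩ ⟨hs, hp⟩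
  set T := trivializationAt (EuclideanSpace ℝ (Fin m)) (TangentSpace (𝓡 m) : W → Type _) p with hT
  have hpT : p ∈ T.baseSet := FiberBundle.mem_baseSet_trivializationAt' p
  have hsnd : ContinuousWithinAt (Prod.snd : ℝ × W → W) (J ×ˢ S) (s, p) :=
    continuous_snd.continuousWithinAt
  have hcoord : ∀ {Z : ∀ x : W, TangentSpace (𝓡 m) x}, FieldOn 0 S Z →
      ContinuousWithinAt (fun q : ℝ × W => (T (⟨q.2, Z q.2⟩ : TangentBundle (𝓡 m) W)).2)
        (J ×ˢ S) (s, p) := by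
    intro Z hZ
    have h1 := ((FiberBundle.continuousWithinAt_totalSpace (EuclideanSpace ℝ (Fin m)) _).1
      (continuousFieldOn_iff.2 hZ p hp)).2
    exact ContinuousWithinAt.comp (t := S) (x := (s, p)) (f := Prod.snd) h1 hsnd fun q hq => hq.2
  refine (FiberBundle.continuousWithinAt_totalSpace (EuclideanSpace ℝ (Fin m)) _).2 ⟨hsnd, ?_⟩
  have h2 : ContinuousWithinAt (fun q : ℝ × W => (T (⟨q.2, X q.2⟩ : TangentBundle (𝓡 m) W)).2 +
      f q.1 • (T (⟨q.2, Y q.2⟩ : TangentBundle (𝓡 m) W)).2) (J ×ˢ S) (s, p) :=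
    (hcoord hX).add ((hf.comp continuous_fst).continuousWithinAt.smul (hcoord hY))
  have hlin : ∀ x ∈ T.baseSet, ∀ v : TangentSpace (𝓡 m) x,
      (T (⟨x, v⟩ : TangentBundle (𝓡 m) W)).2 = T.continuousLinearMapAt ℝ x v := fun x hx v => by
    rw [T.continuousLinearMapAt_apply ℝ, T.linearMapAt_apply]
    exact (if_pos hx).symm
  have heq : ∀ q : ℝ × W, q.2 ∈ T.baseSet →
      (T (⟨q.2, X q.2 + f q.1 • Y q.2⟩ : TangentBundle (𝓡 m) W)).2 =
        (T (⟨q.2, X q.2⟩ : TangentBundle (𝓡 m) W)).2 +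
          f q.1 • (T (⟨q.2, Y q.2⟩ : TangentBundle (𝓡 m) W)).2 := fun q hq => by
    simp only [hlin q.2 hq, map_add, map_smul]
  refine h2.congr_of_eventuallyEq ?_ (heq (s, p) hpT)
  filter_upwards [hsnd.eventually_mem (T.open_baseSet.mem_nhds hpT)] with q hq using heq q hq

namespace FLIFData

variable {Φ : FLIFData ζ}

lemma push_Norm {N : Set W} {F : ∀ x : W, ζ x →ₗ[ℝ] TangentSpace (𝓡 m) x} (hVN : Φ.V ⊆ N)
    (hNdom : N ⊆ Φ.dom) (hF : IsBundleMonoOn N F) (g : Metric m W) (x : W) :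
    (Φ.push N F).Norm g x = Φ.Norm g x := by
  rw [Norm, push_V hVN hNdom hF]

namespace TwistChoices

variable (C : Φ.TwistChoices)

open Classical in
/-- The projection of `ζ` to the line spanned by `λ̃⁺` over the tube, and zero elsewhere. -/
noncomputable def tubeProj (x : W) : ζ x →ₗ[ℝ] ζ x := if x ∈ C.U then C.lamProj x else 0

/-- The operator on `ζ` which over the tube multiplies `λ̃⁺` by `k`, and is the identity on the
orthogonal complement of `λ̃⁺` and outside of the tube. -/
noncomputable def stretch (x : W) (k : ℝ) : ζ x →ₗ[ℝ] ζ x := LinearMap.id + (k - 1) • C.tubeProj x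

lemma stretch_apply (x : W) (k : ℝ) (z : ζ x) :
    C.stretch x k z = z + (k - 1) • C.tubeProj x z := rfl

@[simp] lemma stretch_one (x : W) (z : ζ x) : C.stretch x 1 z = z := by
  rw [stretch_apply, sub_self, zero_smul, add_zero]

lemma tubeProj_of_mem {x : W} (hx : x ∈ C.U) (z : ζ x) :
    C.tubeProj x z = Φ.metric x z (C.lamT x) • C.lamT x := by
  rw [tubeProj, if_pos hx, lamProj_apply]

lemma tubeProj_of_notMem {x : W} (hx : x ∉ C.U) (z : ζ x) : C.tubeProj x z = 0 := by
  rw [tubeProj, if_neg hx, LinearMap.zero_apply]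

lemma stretch_injective {x : W} {k : ℝ} (hk : 0 < k) : Function.Injective (C.stretch x k) := by
  rw [← LinearMap.ker_eq_bot, LinearMap.ker_eq_bot']
  intro z hz
  rw [C.stretch_apply] at hz
  by_cases hx : x ∈ C.U
  · rw [C.tubeProj_of_mem hx] at hz
    have h1 : Φ.metric x (z + (k - 1) • Φ.metric x z (C.lamT x) • C.lamT x) (C.lamT x) = 0 := by
      rw [hz, map_zero, LinearMap.zero_apply]
    simp only [map_add, map_smul, LinearMap.add_apply, LinearMap.smul_apply, smul_eq_mul,
      C.lamT_unit x hx, mul_one] at h1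
    have h2 : Φ.metric x z (C.lamT x) = 0 := by
      have : k * Φ.metric x z (C.lamT x) = 0 := by linarith
      exact (mul_eq_zero.1 this).resolve_left hk.ne'
    rwa [h2, zero_smul, smul_zero, add_zero] at hz
  · rwa [C.tubeProj_of_notMem hx, smul_zero, add_zero] at hz

lemma stretch_bijective {x : W} {k : ℝ} (hk : 0 < k) : Function.Bijective (C.stretch x k) :=
  ⟨C.stretch_injective hk, LinearMap.injective_iff_surjective.1 (C.stretch_injective hk)⟩

end TwistChoices

namespace IsFLIF

variable {C : Φ.TwistChoices} {g : Metric m W} {N : Set W}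
  {F : ∀ x : W, ζ x →ₗ[ℝ] TangentSpace (𝓡 m) x}

variable (hΦ : Φ.IsFLIF n)
include hΦ

/-- The homomorphism `Γ̂` with `ζ` as its codomain over `V`. -/
lemma exists_gammaHat_lift : ∃ G : ∀ x : W, TangentSpace (𝓡 m) x →ₗ[ℝ] ζ x,
    ∀ x ∈ Φ.V, ∀ w, (G x w : TangentSpace (𝓡 m) x) = Φ.gammaHat x w := by
  classical
  refine ⟨fun x => if hx : x ∈ Φ.V then
    (Φ.gammaHat x).toLinearMap.codRestrict (ζ x) (hΦ.gammaHat_mem hx) else 0, fun x hx w => ?_⟩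
  simp only [dif_pos hx]
  rfl

/-- The operator which relates `Φ2` to the composition of `Γ̂` with the bundle map `F`: it stretches
`λ̃⁺` by the quotient of `c` by `c̃ sin θ`. -/
lemma stretch_twist {h : W → ℝ} (hh : ∀ x ∈ C.U, h x * (C.cT x * Real.sin (C.θ x)) = C.c x) {x : W}
    (z : ζ x) : C.stretch x (h x) (C.twist x z) = Φ.Φ2 x z := by
  rw [C.stretch_apply]
  by_cases hx : x ∈ C.U
  · rw [C.tubeProj_of_mem hx, C.twist_of_mem hx, hΦ.metric_modify_lamT C hx, C.modify_apply,
      ← hh x hx]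
    module
  · rw [C.tubeProj_of_notMem hx, C.twist_of_notMem hx, smul_zero, add_zero]

/-- The projection to `λ̃⁺` over the tube becomes continuous over `V` when it is multiplied by a
function which vanishes outside of the interior of the tube. -/
lemma tubeProj_fieldOn {k : W → ℝ} {S : Set W} (hS : S ⊆ Φ.V) (hk : ContinuousOn k S)
    (hk0 : ∀ x ∈ S, C.U ∉ 𝓝[Φ.V] x → k x = 0) {Z : ∀ x : W, ζ x}
    (hZ : FieldOn 0 S fun x => (Z x : TangentSpace (𝓡 m) x)) :
    FieldOn 0 S fun x => k x • (C.tubeProj x (Z x) : TangentSpace (𝓡 m) x) := by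
  rw [← continuousFieldOn_iff]
  refine C.continuousOn_of_tube hS ?_ fun x hx hxU => ?_
  · have hl : FieldOn 0 (S ∩ C.U) fun x => (C.lamT x : TangentSpace (𝓡 m) x) :=
      FieldOn.of_le (FieldOn.mono C.lamT_smooth Set.inter_subset_right) (by simp)
    refine continuousFieldOn_iff.2 ((FieldOn.smul (f := fun x => k x * Φ.metric x (Z x) (C.lamT x))
      ((contMDiffOn_zero_iff.2 (hk.mono Set.inter_subset_left)).mul (hΦ.metric_contMDiffOn (by simp)
        (fun y hy => (hS hy.1).1) (hZ.mono Set.inter_subset_left) hl)) hl).congr fun y hy => ?_)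
    rw [C.tubeProj_of_mem hy.2, mul_smul]
    rfl
  · have h0 : FieldOn 0 (insert x (S \ C.U)) fun y => (0 : TangentSpace (𝓡 m) y) :=
      (Bundle.contMDiff_zeroSection ℝ (TangentSpace (𝓡 m) : W → Type _)).contMDiffOn
    have h1 : FieldOn 0 (insert x (S \ C.U)) fun y =>
        k y • (C.tubeProj y (Z y) : TangentSpace (𝓡 m) y) := by
      refine h0.congr fun y hy => ?_
      rcases hy with rfl | hy
      · rw [hk0 y hx hxU, zero_smul]
      · rw [C.tubeProj_of_notMem hy.2, ZeroMemClass.coe_zero, smul_zero]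
    exact (continuousFieldOn_iff.2 h1 x (Set.mem_insert _ _)).mono (Set.subset_insert _ _)

/-- The push-forward of a FLIF to the twisted normal bundle is well balanced. The isomorphism `Π`
is `F ∘ stretch ∘ Γ`, with the factor `h = c / (c̃ sin θ)` extended over `Σ`; as `h` is positive,
it is homotopic to `F ∘ Γ` by `h_s = 1 + (1 - s) (h - 1)`. -/
lemma push_isWellBalanced (hN : IsOpen N) (hVN : Φ.V ⊆ N) (hNdom : N ⊆ Φ.dom)
    (hF : IsBundleMonoOn N F) (hFΔ : ∀ v ∈ Φ.V, ∀ z : ζ v, F v z = C.delta g v z) :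
    (Φ.push N F).IsWellBalanced g := by
  have hV := push_V hVN hNdom hF
  have hS := push_Sig hVN hNdom hF
  have hNorm := push_Norm hVN hNdom hF g
  obtain ⟨G, hG⟩ := hΦ.exists_gammaHat_lift
  obtain ⟨h, hcont, hpos, hmul, hone⟩ := hΦ.exists_ratio C
  let A : ℝ → ∀ x : W, (Φ.push N F).Norm g x →ₗ[ℝ] LinearMap.range (F x) := fun s x =>
    (F x).rangeRestrict ∘ₗ C.stretch x (1 + (1 - s) * (h x - 1)) ∘ₗ G x ∘ₗ
      ((Φ.push N F).Norm g x).subtype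
  have hA : ∀ s x (w : (Φ.push N F).Norm g x),
      (A s x w : TangentSpace (𝓡 m) x) = F x (G x w) + (1 - s) • F x ((h x - 1) • C.tubeProj x (G x w)) := by
    intro s x w
    change F x (C.stretch x _ (G x w)) = _
    rw [C.stretch_apply, map_add, ← map_smul (F x), smul_smul, add_sub_cancel_left]
  have hpath : IsContinuousPathOn Φ.V A := by
    intro Z O hO hZ
    have hGZ : FieldOn 0 (Φ.V ∩ O) fun x => (G x (Z x) : TangentSpace (𝓡 m) x) :=
      (hΦ.gammaHat_fieldOn (by simp) Set.inter_subset_left (continuousFieldOn_iff.1 hZ)).congr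
        fun x hx => hG x hx.1 _
    have hD : FieldOn 0 (Φ.V ∩ O) fun x =>
        ((((h x - 1) • C.tubeProj x (G x (Z x)) : ζ x)) : TangentSpace (𝓡 m) x) := by
      refine hΦ.tubeProj_fieldOn Set.inter_subset_left
        ((hcont.mono Set.inter_subset_left).sub continuousOn_const) (fun x hx hxU => ?_) hGZ
      refine sub_eq_zero.2 ?_
      by_cases hU : x ∈ C.U
      · obtain ⟨h1, h2⟩ := eq_sinAmp_of_notMem_nhdsWithin C hU hxU
        have h3 := hmul x hU
        rw [← h1] at h3
        exact mul_right_cancel₀ h2 (by rw [h3, one_mul])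
      · exact hone x hx.1 hU
    have hVO : Φ.V ∩ O ⊆ N := fun x hx => hVN hx.1
    refine ((hΦ.F_fieldOn hNdom hF (by simp) hVO hGZ).continuousOn_path
      (hΦ.F_fieldOn hNdom hF (by simp) hVO hD) (f := fun s => 1 - s) (by fun_prop) _).congr
      fun q _ => ?_
    rw [hA]
  have hbij : ∀ s ∈ Set.Icc (0 : ℝ) 1, ∀ v ∈ Φ.V, Function.Bijective (A s v) := by
    intro s hs v hv
    have hk : 0 < 1 + (1 - s) * (h v - 1) := by
      rcases hs.2.lt_or_eq with h1 | rfl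
      · nlinarith [hs.1, hpos v hv]
      · simp
    have h1 : Function.Bijective (F v).rangeRestrict :=
      ⟨fun a b hab => hF.1 v (hVN hv) (congrArg Subtype.val hab), (F v).surjective_rangeRestrict⟩
    have h2 : Function.Bijective (G v ∘ₗ ((Φ.push N F).Norm g v).subtype) := by
      constructor
      · rw [← LinearMap.ker_eq_bot, LinearMap.ker_eq_bot']
        intro w hw
        refine Subtype.ext (hΦ.eq_zero_of_mem_norm g hv (hNorm v ▸ w.2) ?_)
        rw [← hG v hv]
        exact congrArg Subtype.val hw
      · intro z
        have hz := hΦ.gammaInv_spec g hv z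
        exact ⟨⟨_, (hNorm v).symm ▸ hz.1⟩, Subtype.ext ((hG v hv _).trans hz.2)⟩
    exact h1.comp ((C.stretch_bijective hk).comp h2)
  refine ⟨hΦ.push_isPrepared hN hVN hNdom hF hFΔ, A 0, ⟨?_, ?_, ?_⟩, A, ?_, ?_, ?_, ?_⟩
  · rw [hV]
    intro Z O hO hZ
    exact (hpath Z O hO hZ).comp (f := fun x => ((0 : ℝ), x)) (by fun_prop)
      fun x hx => ⟨⟨le_rfl, zero_le_one⟩, hx⟩
  · rw [hV]
    exact hbij 0 ⟨le_rfl, zero_le_one⟩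
  · rw [hV, hS]
    rintro v hv - ⟨_, z, rfl⟩ w hzw
    rw [hΦ.mem_tangentTo_iff hv, map_sub, hΦ.gammaHat_map hFΔ hv, ← hG v hv, sub_eq_zero] at hzw
    have h1 : G v w = C.twist v z := Subtype.ext hzw.symm
    have h2 : (1 : ℝ) + (1 - 0) * (h v - 1) = h v := by ring
    change (F v).rangeRestrict (C.stretch v _ (G v w)) = _
    rw [h1, h2, hΦ.stretch_twist hmul]
    exact (push_Φ2_apply (hF.1 v (hVN hv)) z).symm
  · rwa [hV]
  · rwa [hV]
  · exact fun v _ => rfl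
  · rw [hV]
    intro v hv w
    rw [hA, sub_self, zero_smul, add_zero, hΦ.push_gammaHat hN hVN hNdom hF hv]
    exact congrArg (F v) (Subtype.ext (hG v hv w))

/-- If `c̃ sin θ = c`, then `Γ̂ ∘ F = Φ2` over `V`, so that `Π` and `Γ` of the push-forward agree
off `Σ`, and by continuity over `V`. -/
lemma push_pi_eq_gammaHat (hN : IsOpen N) (hVN : Φ.V ⊆ N) (hNdom : N ⊆ Φ.dom)
    (hF : IsBundleMonoOn N F) (hFΔ : ∀ v ∈ Φ.V, ∀ z : ζ v, F v z = C.delta g v z)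
    (hc : ∀ v ∈ C.U, C.cT v * Real.sin (C.θ v) = C.c v)
    {P : ∀ x : W, (Φ.push N F).Norm g x →ₗ[ℝ] LinearMap.range (F x)}
    (hP : (Φ.push N F).IsPi g P) {v : W} (hv : v ∈ Φ.V) (w : (Φ.push N F).Norm g v) :
    (P v w : TangentSpace (𝓡 m) v) = (Φ.push N F).gammaHat v w := by
  classical
  have hV := push_V hVN hNdom hF
  have hS := push_Sig hVN hNdom hF
  have hNorm := push_Norm hVN hNdom hF g
  obtain ⟨G, hG⟩ := hΦ.exists_gammaHat_lift
  have hoff : ∀ v ∈ Φ.V, v ∉ Φ.Sig → ∀ w : (Φ.push N F).Norm g v,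
      (P v w : TangentSpace (𝓡 m) v) = (Φ.push N F).gammaHat v w := by
    intro v hv hvS w
    obtain ⟨z, hz⟩ := hΦ.twist_surjective C hv hvS (G v w)
    have h1 : Φ.Φ2 v z = G v w := by
      rw [← hz, ← hΦ.stretch_twist (C := C) (h := fun _ => 1)
        (fun x hx => by rw [one_mul, hc x hx]) z, C.stretch_one]
    have h2 := hP.eq_comp v (hV.symm ▸ hv) (hS.symm ▸ hvS) ((F v).rangeRestrict z) w (by
      rw [hV, hΦ.mem_tangentTo_iff hv, map_sub, sub_eq_zero]
      exact (hΦ.gammaHat_map hFΔ hv z).trans ((congrArg Subtype.val hz).trans (hG v hv w)))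
    rw [h2, push_Φ2_apply (hF.1 v (hVN hv)), h1, hΦ.push_gammaHat hN hVN hNdom hF hv]
    exact congrArg (F v) (Subtype.ext (hG v hv w))
  by_cases hvS : v ∈ Φ.Sig
  swap
  · exact hoff v hv hvS w
  -- extend `w` to a continuous section of the normal bundle
  obtain ⟨O, L, hvO, hO⟩ := hΦ.exists_localFrame hv.1
  let X : ∀ x : W, ζ x := fun x => ∑ i, L.κ i v (G v w : TangentSpace (𝓡 m) v) • L.e i x
  have hX : FieldOn 0 (Φ.V ∩ O) fun x => (X x : TangentSpace (𝓡 m) x) := by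
    have h1 : FieldOn 0 (Φ.V ∩ O) fun x => ∑ i, L.κ i v (G v w : TangentSpace (𝓡 m) v) •
        (L.e i x : TangentSpace (𝓡 m) x) := FieldOn.sum fun i _ => FieldOn.smul contMDiffOn_const
          (((L.e_smooth i).mono Set.inter_subset_right).of_le (by simp))
    exact h1.congr fun x _ => by simp [X]
  have hXv : X v = G v w := (L.expand v hvO (G v w)).symm
  let Z : ∀ x : W, (Φ.push N F).Norm g x := fun x => if hx : x ∈ Φ.V then
    ⟨Φ.gammaInv g x (X x), (hNorm x).symm ▸ (hΦ.gammaInv_spec g hx (X x)).1⟩ else 0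
  have hZ : FieldOn 0 (Φ.V ∩ O) fun x => (Z x : TangentSpace (𝓡 m) x) :=
    (hΦ.gammaInv_fieldOn g (by simp) Set.inter_subset_left hX).congr fun x hx => by
      simp only [Z, dif_pos hx.1]
  have hZv : Z v = w := by
    refine Subtype.ext ?_
    simp only [Z, dif_pos hv, hXv]
    exact hΦ.gammaInv_eq g hv (hNorm v ▸ w.2) (hG v hv w).symm
  have hD : FieldOn 0 (Φ.V ∩ O) fun x =>
      (P x (Z x) : TangentSpace (𝓡 m) x) - (Φ.push N F).gammaHat x (Z x) := by
    have h1 := hP.continuous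
    rw [hV] at h1
    exact FieldOn.sub (continuousFieldOn_iff.1 (h1 Z O L.isOpen (continuousFieldOn_iff.2 hZ)))
      ((hΦ.push hN hVN hNdom hF).gammaHat_fieldOn (by simp)
        (Set.inter_subset_left.trans hV.symm.subset) hZ)
  set D : ∀ x : W, TangentSpace (𝓡 m) x := fun x =>
    (P x (Z x) : TangentSpace (𝓡 m) x) - (Φ.push N F).gammaHat x (Z x)
  have hnorm := (g.fieldOn (by simp) hD hD).continuousOn v ⟨hv, hvO⟩
  have hcurve := (C.isCurveIn_zero hvS).tendsto
  have h1 : Filter.Tendsto (C.toFun v) (𝓝[≠] 0) (𝓝[Φ.V ∩ O] v) := by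
    rw [nhdsWithin_inter_of_mem' (mem_nhdsWithin_of_mem_nhds (L.isOpen.mem_nhds hvO))]
    exact hcurve.mono_left nhdsWithin_le_nhds
  have h2 := hnorm.tendsto.comp h1
  have h3 : Filter.Tendsto ((fun x => g.inner x (D x) (D x)) ∘ C.toFun v) (𝓝[≠] 0) (𝓝 0) := by
    refine tendsto_const_nhds.congr' ?_
    filter_upwards [self_mem_nhdsWithin] with t ht
    have ht' : C.toFun v t ∉ Φ.Sig := fun h => ht ((C.toFun_mem_Sig_iff hvS t).1 h)
    have : D (C.toFun v t) = 0 := sub_eq_zero.2 (hoff _ (C.map_mem v hvS t) ht' _)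
    simp [this]
  have h4 := tendsto_nhds_unique h2 h3
  have h5 : D v = 0 := by
    by_contra h
    exact (g.pos v _ h).ne' h4
  have h6 := sub_eq_zero.1 h5
  rwa [hZv] at h6

end IsFLIF
end FLIFData

end Igusa

theorem lemma3p4p4 {n k : ℕ} {W : Type*} [TopologicalSpace W] [T2Space W]
    [SecondCountableTopology W] [ChartedSpace (EuclideanSpace ℝ (Fin (n + k))) W]
    [IsManifold (𝓡 (n + k)) ∞ W] (g : Igusa.Metric (n + k) W)
    (ζ : ∀ x : W, Submodule ℝ (TangentSpace (𝓡 (n + k)) x))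
    (Φ : Igusa.FLIFData ζ) (hΦ : Φ.IsFLIF n) (C : Φ.TwistChoices)
    (N : Set W) (hN : IsOpen N) (hVN : Φ.V ⊆ N) (hNdom : N ⊆ Φ.dom)
    (F : ∀ x : W, ζ x →ₗ[ℝ] TangentSpace (𝓡 (n + k)) x)
    (hF : Igusa.IsBundleMonoOn N F)
    (hFΔ : ∀ v ∈ Φ.V, ∀ z : ζ v, F v z = C.delta g v z) :
    (∀ v ∈ Φ.V, LinearMap.range (F v) = C.twistedNormal g v) ∧
    (Φ.push N F).IsFLIF n ∧
    (Φ.push N F).IsWellBalanced g ∧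
    ((∀ v ∈ C.U, C.cT v * Real.sin (C.θ v) = C.c v) →
      ∀ P, (Φ.push N F).IsPi g P → ∀ v ∈ Φ.V, ∀ w : (Φ.push N F).Norm g v,
        (P v w : TangentSpace (𝓡 (n + k)) v) = (Φ.push N F).gammaHat v w) := by
  exact ⟨fun v hv => hΦ.range_eq_twistedNormal C g hv (hFΔ v hv), hΦ.push hN hVN hNdom hF,
    hΦ.push_isWellBalanced hN hVN hNdom hF hFΔ,
    fun hc _ hP _ hv w => hΦ.push_pi_eq_gammaHat hN hVN hNdom hF hFΔ hc hP hv w⟩
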